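/- A topological space $X$ is an interval space if its topology is the order topology of some linear ordering of $X$; it is a CO space if every closed subset of $X$ is homeomorphic to some clopen subset of $X$. For infinite cardinals $\lambda,\mu$ let $X_{\lambda,\mu}$ be the linearly ordered set $\lambda+1+\mu^*$ with its order topology, where $\mu^*$ is $\mu$ with the reversed order. Write $D_\alpha(Y)$ for the $\alpha$-th Cantor–Bendixson derivative of a space $Y$. The rank $\operatorname{rk}(Y)$ is the first ordinal $\alpha$ such that $D_\alpha(Y)$ is finite or has no isolated points in its relative topology. If $D_{\operatorname{rk}(Y)}(Y)$ is a singleton $\{e\}$, put $e^Y=e$. For $Y=X_{\lambda,\mu}$ this point exists: it is the point $\lambda$ in $\lambda+1+\mu^*$, at which the two parts meet. A point $x$ of a space $X$ is a double-limit point of $X$ if there are infinite cardinals $\lambda,\mu$ with $\operatorname{cf}(\mu)\ge\aleph_1$ and a topological embedding $f: X_{\lambda,\mu}\to X$ with $f(e^{X_{\lambda,\mu}})=x$. Proposition 7.2. Let $X$ be a compact interval space which is a CO space. (a) For every double-limit point $x$ of $X$ there are infinite regular cardinals $\lambda,\mu$ with $\mu\ge\aleph_1$ and a clopen set $U\subseteq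 X$ with $x\in U$ such that $U$ is homeomorphic to $X_{\lambda,\mu}$. (b) The set of double-limit points of $X$ is finite. -/

import Mathlib

universe u

/-- A topological space is an interval space if its topology is the order topology of some
linear ordering of its points. -/
def IsIntervalSpace (X : Type u) [TopologicalSpace X] : Prop :=
  ∃ _ : LinearOrder X, OrderTopology X

/-- A topological space is a CO space if every closed subset is homeomorphic to some clopen
subset. -/
def IsCOSpace (X : Type u) [TopologicalSpace X] : Prop :=
  ∀ F : Set X, IsClosed F → ∃ U : Set X, IsClopen U ∧ Nonempty (F ≃ₜ U)

/-- The linearly ordered set `lam + 1 + mu*`: the initial ordinal of `lam`, then one top point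
above it, then the initial ordinal of `mu` with its order reversed. -/
def DoubleOrd (lam mu : Cardinal.{u}) : Type u :=
  Lex (WithTop lam.ord.ToType ⊕ (mu.ord.ToType)ᵒᵈ)

noncomputable instance (lam mu : Cardinal.{u}) : LinearOrder (DoubleOrd lam mu) :=
  inferInstanceAs (LinearOrder (Lex (WithTop lam.ord.ToType ⊕ (mu.ord.ToType)ᵒᵈ)))

/-- The space `X_{lam, mu}` is `lam + 1 + mu*` with its order topology. -/
noncomputable instance (lam mu : Cardinal.{u}) : TopologicalSpace (DoubleOrd lam mu) :=
  Preorder.topology (DoubleOrd lam mu)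

instance (lam mu : Cardinal.{u}) : OrderTopology (DoubleOrd lam mu) := ⟨rfl⟩

/-- The rank of a space `X`: the first ordinal `a` such that the `a`-th Cantor-Bendixson
derivative of `X` is finite or has no isolated points. -/
noncomputable def cbRank (X : Type u) [TopologicalSpace X] : Ordinal.{u} :=
  sInf {a : Ordinal.{u} |
    (CantorBendixson.iteratedDerivedSet (Set.univ : Set X) a).Finite ∨
      Preperfect (CantorBendixson.iteratedDerivedSet (Set.univ : Set X) a)}

/-- `e` is the end point of the space `X`: the Cantor-Bendixson derivative of `X` at the rank
of `X` is the singleton `{e}`. A compact Hausdorff space with an end point is scattered, and is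
called unitary. -/
def IsEndPoint {X : Type u} [TopologicalSpace X] (e : X) : Prop :=
  CantorBendixson.iteratedDerivedSet (Set.univ : Set X) (cbRank X) = {e}

/-- `x` is a double-limit point of `X` if, for some infinite cardinals `lam` and `mu` with
`mu` of uncountable cofinality, there is a topological embedding of `X_{lam, mu}` into `X` that
maps the end point of `X_{lam, mu}` to `x`. Cardinals of the universe of `X` suffice because
`lam` and `mu` are bounded by the cardinality of `X`. -/
def IsDoubleLimitPoint {X : Type u} [TopologicalSpace X] (x : X) : Prop :=
  ∃ lam mu : Cardinal.{u}, Cardinal.aleph0 ≤ lam ∧ Cardinal.aleph0 ≤ mu ∧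
    Cardinal.aleph 1 ≤ mu.ord.cof ∧
    ∃ f : DoubleOrd lam mu → X, Topology.IsEmbedding f ∧
      ∃ e : DoubleOrd lam mu, IsEndPoint e ∧ f e = x

open Set Filter Topology Cardinal

universe v w

set_option linter.unusedSectionVars false
set_option linter.unusedVariables false

/-- A property of pointed topological spaces. -/
abbrev PointClass := ∀ (Y : Type u) [TopologicalSpace Y], Y → Prop

/-- A property of pointed spaces is local if it is preserved and reflected by open embeddings. -/
def IsLocal (P : PointClass.{u}) : Prop :=
  ∀ ⦃Y Z : Type u⦄ [TopologicalSpace Y] [TopologicalSpace Z] (e : Y → Z),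
    IsOpenEmbedding e → ∀ y, P Y y ↔ P Z (e y)

/-- The point `x` lies in `F` and has the property `P` in the subspace `F`. -/
def HoldsOn {X : Type u} [TopologicalSpace X] (P : PointClass.{u}) (F : Set X) (x : X) : Prop :=
  ∃ h : x ∈ F, P F ⟨x, h⟩

section local_classes

variable {X : Type u} [TopologicalSpace X] {P Q : PointClass.{u}}

theorem HoldsOn.mem {F : Set X} {x : X} (h : HoldsOn P F x) : x ∈ F := h.1

theorem holdsOn_coe {F : Set X} (x : F) : HoldsOn P F x ↔ P F x :=
  ⟨fun ⟨_, h⟩ => h, fun h => ⟨x.2, h⟩⟩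

theorem IsLocal.holdsOn_inter (hP : IsLocal P) {F O : Set X} (hO : IsOpen O) {x : X}
    (hx : x ∈ O) : HoldsOn P (F ∩ O) x ↔ HoldsOn P F x := by
  have he : IsOpenEmbedding (Set.inclusion (inter_subset_left : F ∩ O ⊆ F)) := by
    refine ⟨IsEmbedding.inclusion _, ?_⟩
    rw [Set.range_inclusion]
    refine ⟨O, hO, ?_⟩
    ext ⟨z, hz⟩
    simp
  constructor
  · rintro ⟨h, hp⟩
    exact ⟨h.1, (hP _ he ⟨x, h⟩).1 hp⟩
  · rintro ⟨h, hp⟩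
    exact ⟨⟨h, hx⟩, (hP _ he ⟨x, h, hx⟩).2 hp⟩

theorem IsLocal.holdsOn_congr (hP : IsLocal P) {F R O : Set X} (hO : IsOpen O)
    (h : F ∩ O = R ∩ O) {x : X} (hx : x ∈ O) : HoldsOn P F x ↔ HoldsOn P R x := by
  rw [← hP.holdsOn_inter hO hx, h, hP.holdsOn_inter hO hx]

theorem IsLocal.holdsOn_isOpen (hP : IsLocal P) {O : Set X} (hO : IsOpen O) {x : X}
    (hx : x ∈ O) : HoldsOn P O x ↔ P X x := by
  refine ⟨fun ⟨h, hp⟩ => (hP _ hO.isOpenEmbedding_subtypeVal ⟨x, h⟩).1 hp,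
    fun hp => ⟨hx, (hP _ hO.isOpenEmbedding_subtypeVal ⟨x, hx⟩).2 hp⟩⟩

theorem IsLocal.holdsOn_of_subset (hP : IsLocal P) {F O : Set X} (hO : IsOpen O) (h : O ⊆ F)
    {x : X} (hx : x ∈ O) : HoldsOn P F x ↔ P X x := by
  rw [hP.holdsOn_congr (R := O) hO (by rw [inter_self, inter_eq_right.2 h]) hx,
    hP.holdsOn_isOpen hO hx]

theorem isLocal_and (hP : IsLocal P) (hQ : IsLocal Q) :
    IsLocal fun Y _ y => P Y y ∧ Q Y y :=
  fun _ _ _ _ e he y => and_congr (hP e he y) (hQ e he y)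

theorem isLocal_not (hP : IsLocal P) : IsLocal fun Y _ y => ¬ P Y y :=
  fun _ _ _ _ e he y => not_congr (hP e he y)

theorem isLocal_forall {ι : Sort*} {P : ι → PointClass.{u}} (hP : ∀ i, IsLocal (P i)) :
    IsLocal fun Y _ y => ∀ i, P i Y y :=
  fun _ _ _ _ e he y => forall_congr' fun i => hP i e he y

theorem isLocal_exists {ι : Sort*} {P : ι → PointClass.{u}} (hP : ∀ i, IsLocal (P i)) :
    IsLocal fun Y _ y => ∃ i, P i Y y :=
  fun _ _ _ _ e he y => exists_congr fun i => hP i e he y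

/-- A monotone property of neighbourhoods that is invariant under open embeddings gives a local
class. -/
theorem isLocal_forall_nhds (R : ∀ (Y : Type u) [TopologicalSpace Y], Y → Set Y → Prop)
    (mono : ∀ (Y : Type u) [TopologicalSpace Y] (y : Y) (A B : Set Y), A ⊆ B → R Y y A → R Y y B)
    (inv : ∀ (Y Z : Type u) [TopologicalSpace Y] [TopologicalSpace Z] (e : Y → Z),
      IsOpenEmbedding e → ∀ y A, R Y y A ↔ R Z (e y) (e '' A)) :
    IsLocal fun Y _ y => ∀ N ∈ 𝓝 y, R Y y N := by
  intro Y Z _ _ e he y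
  constructor
  · intro h N hN
    have h1 := h (e ⁻¹' N) (he.continuous.continuousAt hN)
    exact mono Z _ _ _ (image_preimage_subset e N) ((inv Y Z e he y _).1 h1)
  · intro h N hN
    exact (inv Y Z e he y N).2 (h _ (he.isOpenMap.image_mem_nhds hN))

theorem isLocal_exists_nhds (R : ∀ (Y : Type u) [TopologicalSpace Y], Y → Set Y → Prop)
    (anti : ∀ (Y : Type u) [TopologicalSpace Y] (y : Y) (A B : Set Y), A ⊆ B → R Y y B → R Y y A)
    (inv : ∀ (Y Z : Type u) [TopologicalSpace Y] [TopologicalSpace Z] (e : Y → Z),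
      IsOpenEmbedding e → ∀ y A, R Y y A ↔ R Z (e y) (e '' A)) :
    IsLocal fun Y _ y => ∃ N ∈ 𝓝 y, R Y y N := by
  have := isLocal_not (isLocal_forall_nhds (fun Y _ y N => ¬ R Y y N)
    (fun Y _ y A B h h' h'' => h' (anti Y y A B h h''))
    (fun Y Z _ _ e he y A => not_congr (inv Y Z e he y A)))
  simpa only [not_forall, not_not, exists_prop] using this

theorem isLocal_near {ι : Type*} {P : ι → PointClass.{u}} (hP : ∀ i, IsLocal (P i))
    (𝒰 : Set ι → Prop) (h𝒰 : ∀ A B, A ⊆ B → 𝒰 A → 𝒰 B) :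
    IsLocal fun Y _ y => ∀ N ∈ 𝓝 y, 𝒰 {i | ∃ z ∈ N, P i Y z} := by
  refine isLocal_forall_nhds (fun Y _ y N => 𝒰 {i | ∃ z ∈ N, P i Y z}) ?_ ?_
  · intro Y _ y A B hAB h
    refine h𝒰 _ _ ?_ h
    rintro i ⟨z, hz, hp⟩
    exact ⟨z, hAB hz, hp⟩
  · intro Y Z _ _ e he y A
    have : {i | ∃ z ∈ A, P i Y z} = {i | ∃ z ∈ e '' A, P i Z z} := by
      ext i
      simp only [mem_ofPred_eq, exists_mem_image]
      exact exists_congr fun z => and_congr_right fun _ => hP i e he z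
    rw [this]

theorem isLocal_forall_near (hP : IsLocal P) :
    IsLocal fun Y _ y => ∀ N ∈ 𝓝 y, ∃ z ∈ N, P Y z := by
  refine isLocal_forall_nhds (fun Y _ y N => ∃ z ∈ N, P Y z) ?_ ?_
  · rintro Y _ y A B hAB ⟨z, hz, hp⟩
    exact ⟨z, hAB hz, hp⟩
  · intro Y Z _ _ e he y A
    simp only [exists_mem_image]
    exact exists_congr fun z => and_congr_right fun _ => hP e he z

theorem isLocal_exists_near (hP : IsLocal P) :
    IsLocal fun Y _ y => ∃ N ∈ 𝓝 y, ∀ z ∈ N, P Y z := by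
  have := isLocal_not (isLocal_forall_near (isLocal_not hP))
  simpa only [not_forall, not_exists, not_and, not_not, exists_prop] using this

theorem isLocal_accumulation (hP : IsLocal P) :
    IsLocal fun Y _ y => ∀ N ∈ 𝓝 y, ∃ z ∈ N, z ≠ y ∧ P Y z := by
  refine isLocal_forall_nhds (fun Y _ y N => ∃ z ∈ N, z ≠ y ∧ P Y z) ?_ ?_
  · rintro Y _ y A B hAB ⟨z, hz, hp⟩
    exact ⟨z, hAB hz, hp⟩
  · intro Y Z _ _ e he y A
    simp only [exists_mem_image]
    exact exists_congr fun z => and_congr_right fun _ =>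
      and_congr he.injective.ne_iff.symm (hP e he z)

theorem isLocal_isolated (hP : IsLocal P) :
    IsLocal fun Y _ y => ∃ N ∈ 𝓝 y, ∀ z ∈ N, P Y z → z = y := by
  refine isLocal_exists_nhds (fun Y _ y N => ∀ z ∈ N, P Y z → z = y) ?_ ?_
  · intro Y _ y A B hAB h z hz
    exact h z (hAB hz)
  · intro Y Z _ _ e he y A
    simp only [forall_mem_image]
    exact forall_congr' fun z => forall_congr' fun _ =>
      imp_congr (hP e he z) he.injective.eq_iff.symm

theorem mk_holds_image (hP : IsLocal P) {Y Z : Type u} [TopologicalSpace Y] [TopologicalSpace Z]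
    {e : Y → Z} (he : IsOpenEmbedding e) (A : Set Y) :
    #{z | z ∈ A ∧ P Y z} = #{z | z ∈ e '' A ∧ P Z z} := by
  have : {z | z ∈ e '' A ∧ P Z z} = e '' {z | z ∈ A ∧ P Y z} := by
    ext z
    constructor
    · rintro ⟨⟨a, ha, rfl⟩, hp⟩
      exact ⟨a, ⟨ha, (hP e he a).2 hp⟩, rfl⟩
    · rintro ⟨a, ⟨ha, hp⟩, rfl⟩
      exact ⟨⟨a, ha, rfl⟩, (hP e he a).1 hp⟩
  rw [this, mk_image_eq he.injective]

theorem isLocal_le_count (hP : IsLocal P) (δ : Cardinal.{u}) :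
    IsLocal fun Y _ y => ∀ N ∈ 𝓝 y, δ ≤ #{z | z ∈ N ∧ P Y z} := by
  refine isLocal_forall_nhds (fun Y _ y N => δ ≤ #{z | z ∈ N ∧ P Y z}) ?_ ?_
  · intro Y _ y A B hAB h
    exact h.trans (mk_le_mk_of_subset fun z (hz : z ∈ A ∧ P Y z) => ⟨hAB hz.1, hz.2⟩)
  · intro Y Z _ _ e he y A
    rw [mk_holds_image hP he]

theorem isLocal_count_le (hP : IsLocal P) (δ : Cardinal.{u}) :
    IsLocal fun Y _ y => ∃ N ∈ 𝓝 y, #{z | z ∈ N ∧ P Y z} ≤ δ := by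
  refine isLocal_exists_nhds (fun Y _ y N => #{z | z ∈ N ∧ P Y z} ≤ δ) ?_ ?_
  · intro Y _ y A B hAB h
    refine le_trans (mk_le_mk_of_subset ?_) h
    rintro z ⟨hz, hp⟩
    exact ⟨hAB hz, hp⟩
  · intro Y Z _ _ e he y A
    rw [mk_holds_image hP he]

/-- Every neighbourhood of the point contains an embedded compact space with the property `S`. -/
theorem isLocal_embeds (S : ∀ (W : Type u) [TopologicalSpace W], Prop) :
    IsLocal fun Y _ y => ∀ N ∈ 𝓝 y, ∃ (W : Type u) (_ : TopologicalSpace W), CompactSpace W ∧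
      S W ∧ ∃ f : W → Y, IsEmbedding f ∧ range f ⊆ N := by
  refine isLocal_forall_nhds (fun Y _ y N => ∃ (W : Type u) (_ : TopologicalSpace W),
    CompactSpace W ∧ S W ∧ ∃ f : W → Y, IsEmbedding f ∧ range f ⊆ N) ?_ ?_
  · rintro Y _ y A B hAB ⟨W, tW, hc, hS, f, hf, h⟩
    exact ⟨W, tW, hc, hS, f, hf, h.trans hAB⟩
  · intro Y Z _ _ e he y A
    refine exists_congr fun W => exists_congr fun tW => and_congr_right fun hc =>
      and_congr_right fun hS => ?_
    constructor
    · rintro ⟨f, hf, h⟩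
      refine ⟨e ∘ f, he.isEmbedding.comp hf, ?_⟩
      rw [range_comp]
      exact image_mono h
    · rintro ⟨f, hf, h⟩
      have h' : ∀ w, ∃ a ∈ A, e a = f w := fun w => h ⟨w, rfl⟩
      choose g hgA hg using h'
      have hfg : e ∘ g = f := funext hg
      refine ⟨g, ?_, ?_⟩
      · rw [← he.isEmbedding.of_comp_iff, hfg]
        exact hf
      · rintro _ ⟨w, rfl⟩
        exact hgA w

/-- The point has a neighbourhood homeomorphic to a neighbourhood of `z₀` in `Z₀`. -/
def PointGerm (Z₀ : Type u) [TopologicalSpace Z₀] (z₀ : Z₀) : PointClass.{u} := fun Y _ y =>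
  ∃ (W : Type u) (_ : TopologicalSpace W) (w : W) (i : W → Y) (j : W → Z₀),
    IsOpenEmbedding i ∧ IsOpenEmbedding j ∧ i w = y ∧ j w = z₀

theorem PointGerm.trans {Y₁ Y₂ Y₃ : Type u} [TopologicalSpace Y₁] [TopologicalSpace Y₂]
    [TopologicalSpace Y₃] {y₁ : Y₁} {y₂ : Y₂} {y₃ : Y₃} (h : PointGerm Y₁ y₁ Y₂ y₂)
    (h' : PointGerm Y₂ y₂ Y₃ y₃) : PointGerm Y₁ y₁ Y₃ y₃ := by
  obtain ⟨W, tW, w, i, j, hi, hj, rfl, rfl⟩ := h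
  obtain ⟨W', tW', w', i', j', hi', hj', rfl, hw⟩ := h'
  have hk : ∀ a : i ⁻¹' range j', ∃ b, j' b = i a := fun a => a.2
  choose k hk using hk
  have hc : j' ∘ k = i ∘ Subtype.val := funext hk
  have hk' : IsOpenEmbedding k := by
    refine IsOpenEmbedding.of_comp k hj' ?_
    rw [hc]
    exact hi.comp (hj'.isOpen_range.preimage hi.continuous).isOpenEmbedding_subtypeVal
  have hw' : k ⟨w, w', hw⟩ = w' := hj'.injective ((hk _).trans hw.symm)
  exact ⟨i ⁻¹' range j', inferInstance, ⟨w, w', hw⟩, i' ∘ k, j ∘ Subtype.val, hi'.comp hk',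
    hj.comp (hj'.isOpen_range.preimage hi.continuous).isOpenEmbedding_subtypeVal,
    congrArg i' hw', rfl⟩

theorem PointGerm.symm {Y₁ Y₂ : Type u} [TopologicalSpace Y₁] [TopologicalSpace Y₂]
    {y₁ : Y₁} {y₂ : Y₂} (h : PointGerm Y₁ y₁ Y₂ y₂) : PointGerm Y₂ y₂ Y₁ y₁ := by
  obtain ⟨W, tW, w, i, j, hi, hj, h1, h2⟩ := h
  exact ⟨W, tW, w, j, i, hj, hi, h2, h1⟩

theorem PointGerm.refl {Y : Type u} [TopologicalSpace Y] (y : Y) : PointGerm Y y Y y :=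
  ⟨Y, _, y, id, id, .id, .id, rfl, rfl⟩

theorem pointGerm_of_isOpenEmbedding {Y Z : Type u} [TopologicalSpace Y] [TopologicalSpace Z]
    {e : Y → Z} (he : IsOpenEmbedding e) (y : Y) : PointGerm Y y Z (e y) :=
  ⟨Y, _, y, e, id, he, .id, rfl, rfl⟩

theorem isLocal_pointGerm (Z₀ : Type u) [TopologicalSpace Z₀] (z₀ : Z₀) : IsLocal (PointGerm Z₀ z₀) :=
  fun _ _ _ _ _ he y => ⟨fun h => h.trans (pointGerm_of_isOpenEmbedding he y),
    fun h => h.trans (pointGerm_of_isOpenEmbedding he y).symm⟩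

end local_classes

section order

variable {X : Type u} [TopologicalSpace X] [LinearOrder X] [OrderTopology X]

theorem isClopen_ordConnectedComponent {V : Set X} (hV : IsClopen V) (x : X) :
    IsClopen (ordConnectedComponent V x) := by
  have ho : ∀ x, IsOpen (ordConnectedComponent V x) := by
    intro x
    rw [isOpen_iff_mem_nhds]
    intro y hy
    rw [ordConnectedComponent_eq hy]
    exact ordConnectedComponent_mem_nhds.2
      (hV.isOpen.mem_nhds (ordConnectedComponent_subset hy))
  refine ⟨⟨?_⟩, ho x⟩
  rw [isOpen_iff_mem_nhds]
  intro y hy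
  by_cases hyV : y ∈ V
  · refine mem_of_superset ((ho y).mem_nhds (self_mem_ordConnectedComponent.2 hyV)) ?_
    intro z hz hz'
    exact hy (mem_ordConnectedComponent_trans hz' (mem_ordConnectedComponent_comm.1 hz))
  · refine mem_of_superset (hV.isClosed.isOpen_compl.mem_nhds hyV) ?_
    intro z hz hz'
    exact hz (ordConnectedComponent_subset hz')

/-- Pairwise disjoint convex clopen sets `J i` with points `m i` of the class `P i`, such that no
other class of the family occurs in `J i`. -/
structure SeparatedFamily {ι : Type v} (P : ι → PointClass.{u}) (J : ι → Set X) (m : ι → X) :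
    Prop where
  isLocal : ∀ i, IsLocal (P i)
  isClopen : ∀ i, IsClopen (J i)
  ordConnected : ∀ i, OrdConnected (J i)
  disjoint : ∀ i j, i ≠ j → Disjoint (J i) (J j)
  mem : ∀ i, m i ∈ J i
  holds : ∀ i, P i X (m i)
  eq_of_holds : ∀ i j, ∀ x ∈ J i, P j X x → j = i

theorem exists_separatedFamily (hCO : IsCOSpace X) {ι : Type v} {P : ι → PointClass.{u}}
    (hP : ∀ i, IsLocal (P i)) {F : ι → Set X} (hF : ∀ i, IsClosed (F i)) {x : ι → X}
    (hx : ∀ i, HoldsOn (P i) (F i) (x i))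
    (hind : ∀ i j y, HoldsOn (P j) (F i) y → j = i) :
    ∃ (J : ι → Set X) (m : ι → X), SeparatedFamily P J m ∧
      ∀ i, ∃ e : J i → F i, IsOpenEmbedding e := by
  choose V hV hh using fun i => hCO (F i) (hF i)
  let h : ∀ i, F i ≃ₜ V i := fun i => (hh i).some
  let m : ι → X := fun i => h i ⟨x i, (hx i).mem⟩
  have hmV : ∀ i, m i ∈ V i := fun i => Subtype.coe_prop _
  have hPV : ∀ i j y (hy : y ∈ V i), P j X y → j = i := by
    intro i j y hy hp
    have h1 := ((hP j).holdsOn_isOpen (hV i).isOpen hy).2 hp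
    obtain ⟨h2, h3⟩ := h1
    have h4 := (hP j _ (h i).symm.isOpenEmbedding _).1 h3
    exact hind i j _ ⟨Subtype.coe_prop _, h4⟩
  have hm : ∀ i, P i X (m i) := by
    intro i
    obtain ⟨h2, h3⟩ := hx i
    have h4 := (hP i _ (h i).isOpenEmbedding _).1 h3
    exact ((hP i).holdsOn_isOpen (hV i).isOpen (hmV i)).1 ⟨hmV i, h4⟩
  have hmne : ∀ i j, i ≠ j → m i ∉ V j := fun i j hij hmj => hij (hPV j i _ hmj (hm i))
  have hminj : ∀ i j, i ≠ j → m i ≠ m j := fun i j hij h => hmne i j hij (h ▸ hmV j)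
  let C : ι → Set X := fun i => ordConnectedComponent (V i) (m i)
  have hCV : ∀ i, C i ⊆ V i := fun i => ordConnectedComponent_subset
  have hmC : ∀ i, m i ∈ C i := fun i => self_mem_ordConnectedComponent.2 (hmV i)
  have hCo : ∀ i, OrdConnected (C i) := fun i => inferInstance
  have hCc : ∀ i, IsClopen (C i) := fun i => isClopen_ordConnectedComponent (hV i) _
  have hmCne : ∀ i j, i ≠ j → m i ∉ C j := fun i j hij hmj => hmne i j hij (hCV j hmj)
  have key : ∀ i j k, m i < m j → m j < m k → Disjoint (C i) (C k) := by
    intro i j k hij hjk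
    rw [Set.disjoint_left]
    intro c hci hck
    have h1 : c < m j := by
      by_contra hc
      exact hmCne j i (fun e => hij.ne (by rw [e])) ((hCo i).out (hmC i) hci ⟨hij.le, not_lt.1 hc⟩)
    exact hmCne j k (fun e => hjk.ne (by rw [e])) ((hCo k).out hck (hmC k) ⟨h1.le, hjk.le⟩)
  let J : ι → Set X := fun i => {z | z ∈ C i ∧ ∀ j, m i < m j → z ∉ C j}
  have hJC : ∀ i, J i ⊆ C i := fun i z hz => hz.1
  have hJ : ∀ i, J i = C i ∨ ∃ j, m i < m j ∧ J i = C i \ C j := by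
    intro i
    by_cases hd : ∀ j, m i < m j → Disjoint (C i) (C j)
    · left
      ext z
      exact ⟨fun hz => hz.1, fun hz => ⟨hz, fun j hj => Set.disjoint_left.1 (hd j hj) hz⟩⟩
    · right
      push Not at hd
      obtain ⟨j, hij, hj⟩ := hd
      refine ⟨j, hij, ?_⟩
      ext z
      refine ⟨fun hz => ⟨hz.1, hz.2 j hij⟩, fun hz => ⟨hz.1, fun k hk hzk => ?_⟩⟩
      rcases eq_or_ne k j with rfl | hkj
      · exact hz.2 hzk
      · rcases lt_or_gt_of_ne (hminj _ _ hkj) with h1 | h1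
        · exact hj (key i k j hk h1)
        · exact Set.disjoint_left.1 (key i j k hij h1) hz.1 hzk
  refine ⟨J, m, ⟨hP, ?_, ?_, ?_, ?_, hm, ?_⟩, ?_⟩
  · intro i
    rcases hJ i with h | ⟨j, -, h⟩ <;> rw [h]
    · exact hCc i
    · exact (hCc i).diff (hCc j)
  · intro i
    rcases hJ i with h | ⟨j, hij, h⟩ <;> rw [h]
    · exact hCo i
    · have hji : j ≠ i := fun e => hij.ne (by rw [e])
      refine ⟨fun a ha b hb c hc => ⟨(hCo i).out ha.1 hb.1 hc, fun hcj => hb.2 ?_⟩⟩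
      have h1 : b < m j := by
        by_contra hc
        exact hmCne j i hji ((hCo i).out (hmC i) hb.1 ⟨hij.le, not_lt.1 hc⟩)
      exact (hCo j).out hcj (hmC j) ⟨hc.2, h1.le⟩
  · intro i j hij
    rw [Set.disjoint_left]
    intro z hzi hzj
    rcases lt_or_gt_of_ne (hminj _ _ hij) with h1 | h1
    · exact hzi.2 j h1 hzj.1
    · exact hzj.2 i h1 hzi.1
  · exact fun i => ⟨hmC i, fun j hj => hmCne i j (fun e => hj.ne (by rw [e]))⟩
  · exact fun i j z hz hp => hPV i j z (hCV i (hJC i hz)) hp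
  · intro i
    have hJo : IsOpen (J i) := by
      rcases hJ i with h | ⟨j, -, h⟩ <;> rw [h]
      · exact (hCc i).isOpen
      · exact ((hCc i).diff (hCc j)).isOpen
    have hs : J i ⊆ V i := (hJC i).trans (hCV i)
    refine ⟨(h i).symm ∘ Set.inclusion hs, (h i).symm.isOpenEmbedding.comp ⟨.inclusion _, ?_⟩⟩
    rw [Set.range_inclusion]
    exact hJo.preimage continuous_subtype_val

variable {ι : Type v} {P : ι → PointClass.{u}} {J : ι → Set X} {m : ι → X}

theorem SeparatedFamily.injective (h : SeparatedFamily P J m) : Function.Injective m := by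
  intro i j hij
  by_contra hne
  exact Set.disjoint_left.1 (h.disjoint i j hne) (h.mem i) (hij ▸ h.mem j)

theorem SeparatedFamily.notMem (h : SeparatedFamily P J m) {i j : ι} (hij : i ≠ j) : m i ∉ J j :=
  Set.disjoint_left.1 (h.disjoint i j hij) (h.mem i)

theorem SeparatedFamily.comp (h : SeparatedFamily P J m) {κ : Type w} {s : κ → ι}
    (hs : Function.Injective s) : SeparatedFamily (P ∘ s) (J ∘ s) (m ∘ s) where
  isLocal i := h.isLocal _
  isClopen i := h.isClopen _
  ordConnected i := h.ordConnected _
  disjoint i j hij := h.disjoint _ _ (hs.ne hij)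
  mem i := h.mem _
  holds i := h.holds _
  eq_of_holds i j x hx hp := hs (h.eq_of_holds _ _ x hx hp)

/-- A point in the closure of a union of convex clopen sets, but in none of them, has a
neighbourhood that contains infinitely many of them; two suffice below. -/
theorem SeparatedFamily.exists_subset_nhds (h : SeparatedFamily P J m) {S : Set ι} {y : X}
    (hy : y ∈ closure (⋃ k ∈ S, J k)) (hy' : ∀ k ∈ S, y ∉ J k) {N : Set X} (hN : N ∈ 𝓝 y)
    (k₀ : ι) : ∃ k ∈ S, k ≠ k₀ ∧ J k ⊆ N := by
  classical
  set N' := ordConnectedComponent N y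
  have hN' : N' ∈ 𝓝 y := ordConnectedComponent_mem_nhds.2 hN
  have hoc : OrdConnected N' := inferInstance
  have hyN' : y ∈ N' := mem_of_mem_nhds hN'
  have step : ∀ T : Finset ι, ∃ k ∈ S, k ∉ T ∧ ∃ a ∈ J k, a ∈ N' := by
    intro T
    have hT : (⋂ k ∈ T.filter (· ∈ S), (J k)ᶜ) ∈ 𝓝 y := by
      rw [Filter.biInter_finset_mem]
      intro k hk
      exact (h.isClopen k).compl.isOpen.mem_nhds (hy' k (Finset.mem_filter.1 hk).2)
    obtain ⟨a, ha, ha'⟩ := mem_closure_iff_nhds.1 hy _ (inter_mem hN' hT)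
    obtain ⟨k, hk, hak⟩ := mem_iUnion₂.1 ha'
    refine ⟨k, hk, fun hkT => ?_, a, hak, ha.1⟩
    exact mem_iInter₂.1 ha.2 k (Finset.mem_filter.2 ⟨hkT, hk⟩) hak
  obtain ⟨k₁, hk₁, hn₁, a₁, ha₁, hb₁⟩ := step {k₀}
  obtain ⟨k₂, hk₂, hn₂, a₂, ha₂, hb₂⟩ := step {k₀, k₁}
  obtain ⟨k₃, hk₃, hn₃, a₃, ha₃, hb₃⟩ := step {k₀, k₁, k₂}
  simp only [Finset.mem_insert, Finset.mem_singleton, not_or] at hn₁ hn₂ hn₃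
  have low : ∀ i ∈ S, i ≠ k₀ → ∀ j ∈ S, j ≠ k₀ → i ≠ j → ∀ a ∈ J i, a ∈ N' → ∀ b ∈ J j, b ∈ N' →
      a < y → b < y → ∃ k ∈ S, k ≠ k₀ ∧ J k ⊆ N := by
    intro i hi hi0 j hj hj0 hij a ha haN b hb hbN hay hby
    wlog hab : a < b generalizing i j a b
    · refine this j hj hj0 i hi hi0 hij.symm b hb hbN a ha haN hby hay (lt_of_le_of_ne
        (not_lt.1 hab) fun e => ?_)
      subst e
      exact Set.disjoint_left.1 (h.disjoint i j hij) ha hb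
    refine ⟨j, hj, hj0, fun c hc => ?_⟩
    have h1 : a < c := by
      by_contra hca
      exact Set.disjoint_left.1 (h.disjoint i j hij) ha
        ((h.ordConnected j).out hc hb ⟨not_lt.1 hca, hab.le⟩)
    have h2 : c < y := by
      by_contra hcy
      exact hy' j hj ((h.ordConnected j).out hb hc ⟨hby.le, not_lt.1 hcy⟩)
    exact ordConnectedComponent_subset (hoc.out haN hyN' ⟨h1.le, h2.le⟩)
  have high : ∀ i ∈ S, i ≠ k₀ → ∀ j ∈ S, j ≠ k₀ → i ≠ j → ∀ a ∈ J i, a ∈ N' → ∀ b ∈ J j, b ∈ N' →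
      y < a → y < b → ∃ k ∈ S, k ≠ k₀ ∧ J k ⊆ N := by
    intro i hi hi0 j hj hj0 hij a ha haN b hb hbN hay hby
    wlog hab : b < a generalizing i j a b
    · refine this j hj hj0 i hi hi0 hij.symm b hb hbN a ha haN hby hay (lt_of_le_of_ne
        (not_lt.1 hab) fun e => ?_)
      subst e
      exact Set.disjoint_left.1 (h.disjoint i j hij) ha hb
    refine ⟨j, hj, hj0, fun c hc => ?_⟩
    have h1 : c < a := by
      by_contra hca
      exact Set.disjoint_left.1 (h.disjoint i j hij) ha
        ((h.ordConnected j).out hb hc ⟨hab.le, not_lt.1 hca⟩)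
    have h2 : y < c := by
      by_contra hcy
      exact hy' j hj ((h.ordConnected j).out hc hb ⟨not_lt.1 hcy, hby.le⟩)
    exact ordConnectedComponent_subset (hoc.out hyN' haN ⟨h2.le, h1.le⟩)
  have hne : ∀ k ∈ S, ∀ a ∈ J k, a < y ∨ y < a := fun k hk a ha =>
    lt_or_gt_of_ne fun e => hy' k hk (e ▸ ha)
  have n12 : k₁ ≠ k₂ := fun e => hn₂.2 e.symm
  have n13 : k₁ ≠ k₃ := fun e => hn₃.2.1 e.symm
  have n23 : k₂ ≠ k₃ := fun e => hn₃.2.2 e.symm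
  rcases hne _ hk₁ _ ha₁ with l₁ | l₁ <;> rcases hne _ hk₂ _ ha₂ with l₂ | l₂ <;>
    rcases hne _ hk₃ _ ha₃ with l₃ | l₃
  · exact low _ hk₁ hn₁ _ hk₂ hn₂.1 n12 _ ha₁ hb₁ _ ha₂ hb₂ l₁ l₂
  · exact low _ hk₁ hn₁ _ hk₂ hn₂.1 n12 _ ha₁ hb₁ _ ha₂ hb₂ l₁ l₂
  · exact low _ hk₁ hn₁ _ hk₃ hn₃.1 n13 _ ha₁ hb₁ _ ha₃ hb₃ l₁ l₃
  · exact high _ hk₂ hn₂.1 _ hk₃ hn₃.1 n23 _ ha₂ hb₂ _ ha₃ hb₃ l₂ l₃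
  · exact low _ hk₂ hn₂.1 _ hk₃ hn₃.1 n23 _ ha₂ hb₂ _ ha₃ hb₃ l₂ l₃
  · exact high _ hk₁ hn₁ _ hk₃ hn₃.1 n13 _ ha₁ hb₁ _ ha₃ hb₃ l₁ l₃
  · exact high _ hk₁ hn₁ _ hk₂ hn₂.1 n12 _ ha₁ hb₁ _ ha₂ hb₂ l₁ l₂
  · exact high _ hk₁ hn₁ _ hk₂ hn₂.1 n12 _ ha₁ hb₁ _ ha₂ hb₂ l₁ l₂

/-- Disjoint open sets `O i` that shrink to the point `y`. -/
structure ShrinksTo (O : ℕ → Set X) (y : X) : Prop where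
  isOpen : ∀ i, IsOpen (O i)
  disjoint : ∀ i j, i ≠ j → Disjoint (O i) (O j)
  notMem : ∀ i, y ∉ O i
  eventually : ∀ N ∈ 𝓝 y, ∃ n, ∀ i, n ≤ i → O i ⊆ N

theorem exists_shrinksTo_of_strictMono [CompactSpace X] {m : ℕ → X} (hm : StrictMono m) :
    ∃ y, ShrinksTo (fun i => Ioo (m (2 * i)) (m (2 * i + 2))) y := by
  obtain ⟨y, -, hy⟩ := (isClosed_closure (s := range m)).isCompact.exists_isLUB
    (range_nonempty m).closure
  rw [isLUB_congr (upperBounds_closure _)] at hy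
  have hlim : Tendsto m atTop (𝓝 y) := tendsto_atTop_isLUB hm.monotone hy
  have hlt : ∀ i, m i < y := fun i => (hm (Nat.lt_succ_self i)).trans_le (hy.1 ⟨_, rfl⟩)
  refine ⟨y, fun i => isOpen_Ioo, ?_, fun i hi => (hlt _).not_gt hi.2, ?_⟩
  · intro i j hij
    wlog h : i < j generalizing i j
    · exact (this j i hij.symm (lt_of_le_of_ne (not_lt.1 h) hij.symm)).symm
    rw [Set.disjoint_left]
    intro z hz hz'
    have : m (2 * i + 2) ≤ m (2 * j) := hm.monotone (by lia)
    exact (hz.2.trans_le this).not_gt hz'.1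
  · intro N hN
    have hN' : ordConnectedComponent N y ∈ 𝓝 y := ordConnectedComponent_mem_nhds.2 hN
    obtain ⟨n, hn⟩ := eventually_atTop.1 (hlim.eventually hN')
    refine ⟨n, fun i hi z hz => ?_⟩
    have hoc : OrdConnected (ordConnectedComponent N y) := inferInstance
    exact ordConnectedComponent_subset (hoc.out (hn (2 * i) (by lia)) (mem_of_mem_nhds hN')
      ⟨hz.1.le, (hz.2.trans (hlt _)).le⟩)

end order

section sequences

variable {X : Type u} [TopologicalSpace X] [LinearOrder X] [OrderTopology X] [CompactSpace X]

theorem exists_shrinksTo {m : ℕ → X} (hm : Function.Injective m) :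
    ∃ (s : ℕ → ℕ) (O : ℕ → Set X) (y : X), StrictMono s ∧ ShrinksTo O y ∧ ∀ i,
      m (s i) ∈ O i ∧ ∀ J : Set X, OrdConnected J → m (s i) ∈ J →
        (∀ k, k ≠ s i → m k ∉ J) → J ⊆ O i := by
  obtain ⟨g, hg⟩ := exists_increasing_or_nonincreasing_subseq (· < ·) m
  rcases hg with hg | hg
  · have hmono : StrictMono (m ∘ g) := fun a b hab => hg a b hab
    obtain ⟨y, hy⟩ := exists_shrinksTo_of_strictMono hmono
    refine ⟨fun i => g (2 * i + 1), _, y, fun a b hab => g.strictMono (by lia), hy, fun i =>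
      ⟨⟨hmono (by lia), hmono (by lia)⟩, fun J hJ hmJ hk z hz => ⟨?_, ?_⟩⟩⟩
    · by_contra hlt
      exact hk (g (2 * i)) (g.injective.ne (by lia)) (hJ.out hz hmJ ⟨not_lt.1 hlt,
        (hmono (by lia : 2 * i < 2 * i + 1)).le⟩)
    · by_contra hlt
      exact hk (g (2 * i + 2)) (g.injective.ne (by lia)) (hJ.out hmJ hz
        ⟨(hmono (by lia : 2 * i + 1 < 2 * i + 2)).le, not_lt.1 hlt⟩)
  · have hanti : StrictAnti (m ∘ g) := fun a b hab => lt_of_le_of_ne (not_lt.1 (hg a b hab))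
      (fun e => hab.ne (g.injective (hm e)).symm)
    have hmono : StrictMono (OrderDual.toDual ∘ m ∘ g) := hanti.dual_right
    have : CompactSpace Xᵒᵈ := inferInstanceAs (CompactSpace X)
    obtain ⟨y, hy⟩ := exists_shrinksTo_of_strictMono hmono
    refine ⟨fun i => g (2 * i + 1), fun i => Ioo (m (g (2 * i + 2))) (m (g (2 * i))),
      OrderDual.ofDual y, fun a b hab => g.strictMono (by lia), ?_, fun i =>
      ⟨⟨hanti (by lia), hanti (by lia)⟩, fun J hJ hmJ hk z hz => ⟨?_, ?_⟩⟩⟩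
    · refine ⟨fun i => isOpen_Ioo, fun i j hij => ?_, fun i hi => ?_, fun N hN => ?_⟩
      · have := hy.disjoint i j hij
        rw [Set.disjoint_left] at this ⊢
        exact fun z hz hz' => this (a := OrderDual.toDual z) ⟨hz.2, hz.1⟩ ⟨hz'.2, hz'.1⟩
      · exact hy.notMem i ⟨hi.2, hi.1⟩
      · obtain ⟨n, hn⟩ := hy.eventually (OrderDual.ofDual ⁻¹' N) hN
        exact ⟨n, fun i hi z hz => hn i hi (a := OrderDual.toDual z) ⟨hz.2, hz.1⟩⟩
    · by_contra hlt
      exact hk (g (2 * i + 2)) (g.injective.ne (by lia)) (hJ.out hz hmJ ⟨not_lt.1 hlt,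
        (hanti (by lia : 2 * i + 1 < 2 * i + 2)).le⟩)
    · by_contra hlt
      exact hk (g (2 * i)) (g.injective.ne (by lia)) (hJ.out hmJ hz
        ⟨(hanti (by lia : 2 * i < 2 * i + 1)).le, not_lt.1 hlt⟩)

end sequences

section shrinking

variable {X : Type u} [TopologicalSpace X] {O : ℕ → Set X} {y : X}

/-- The point `y` together with the sets `K i`, `i ∈ B`. -/
def pointedUnion (y : X) (K : ℕ → Set X) (B : Set ℕ) : Set X := insert y (⋃ i ∈ B, K i)

theorem mem_pointedUnion {K : ℕ → Set X} {B : Set ℕ} {z : X} :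
    z ∈ pointedUnion y K B ↔ z = y ∨ ∃ i ∈ B, z ∈ K i := by
  simp [pointedUnion]

variable [LinearOrder X] [OrderTopology X]

theorem ShrinksTo.isClosed_pointedUnion (h : ShrinksTo O y) {K : ℕ → Set X}
    (hK : ∀ i, IsClosed (K i)) (hKO : ∀ i, K i ⊆ O i) (B : Set ℕ) :
    IsClosed (pointedUnion y K B) := by
  refine ⟨?_⟩
  rw [isOpen_iff_mem_nhds]
  intro x hx
  have hx' : x ≠ y ∧ ∀ i ∈ B, x ∉ K i := by
    simpa [mem_pointedUnion, not_or] using hx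
  obtain ⟨A, A', hA, hA', hxA, hyA', hd⟩ := t2_separation hx'.1
  obtain ⟨n, hn⟩ := h.eventually A' (hA'.mem_nhds hyA')
  have h1 : (⋂ i ∈ {i | i ∈ B ∧ i < n}, (K i)ᶜ) ∈ 𝓝 x := by
    rw [Filter.biInter_mem ((finite_lt_nat n).subset fun i hi => hi.2)]
    exact fun i hi => (hK i).isOpen_compl.mem_nhds (hx'.2 i hi.1)
  filter_upwards [h1, hA.mem_nhds hxA] with z hz hzA hzF
  rcases mem_pointedUnion.1 hzF with rfl | ⟨i, hi, hzi⟩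
  · exact Set.disjoint_left.1 hd hzA hyA'
  · rcases lt_or_ge i n with hin | hin
    · exact mem_iInter₂.1 hz i ⟨hi, hin⟩ hzi
    · exact Set.disjoint_left.1 hd hzA (hn i hin (hKO i hzi))

theorem ShrinksTo.pointedUnion_inter (h : ShrinksTo O y) {K : ℕ → Set X}
    (hKO : ∀ i, K i ⊆ O i) {B : Set ℕ} {i : ℕ} (hi : i ∈ B) :
    pointedUnion y K B ∩ O i = K i ∩ O i := by
  ext z
  constructor
  · rintro ⟨hz, hzO⟩
    refine ⟨?_, hzO⟩
    rcases mem_pointedUnion.1 hz with rfl | ⟨j, hj, hzj⟩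
    · exact absurd hzO (h.notMem i)
    · rcases eq_or_ne j i with rfl | hji
      · exact hzj
      · exact absurd hzO (Set.disjoint_left.1 (h.disjoint j i hji) (hKO j hzj))
  · rintro ⟨hz, hzO⟩
    exact ⟨mem_pointedUnion.2 (.inr ⟨i, hi, hz⟩), hzO⟩

theorem ShrinksTo.holdsOn_iff (h : ShrinksTo O y) {K : ℕ → Set X} (hKO : ∀ i, K i ⊆ O i)
    {B : Set ℕ} {i : ℕ} (hi : i ∈ B) {Q : PointClass.{u}} (hQ : IsLocal Q) {z : X}
    (hz : z ∈ K i) : HoldsOn Q (pointedUnion y K B) z ↔ HoldsOn Q (K i) z :=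
  hQ.holdsOn_congr (h.isOpen i) (h.pointedUnion_inter hKO hi) (hKO i hz)

end shrinking

section subtype

variable {X : Type u} [TopologicalSpace X] {F : Set X}

theorem forall_nhds_subtype {x : F} {p : Set F → Prop} (hp : ∀ A B, A ⊆ B → p A → p B) :
    (∀ N ∈ 𝓝 x, p N) ↔ ∀ N ∈ 𝓝 (x : X), p (Subtype.val ⁻¹' N) := by
  constructor
  · exact fun h N hN => h _ (continuous_subtype_val.continuousAt hN)
  · intro h N hN
    obtain ⟨M, hM, hMN⟩ := mem_nhds_subtype F x N |>.1 hN
    exact hp _ _ hMN (h M hM)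

theorem exists_nhds_subtype {x : F} {p : Set F → Prop} (hp : ∀ A B, A ⊆ B → p B → p A) :
    (∃ N ∈ 𝓝 x, p N) ↔ ∃ N ∈ 𝓝 (x : X), p (Subtype.val ⁻¹' N) := by
  constructor
  · rintro ⟨N, hN, h⟩
    obtain ⟨M, hM, hMN⟩ := mem_nhds_subtype F x N |>.1 hN
    exact ⟨M, hM, hp _ _ hMN h⟩
  · exact fun ⟨N, hN, h⟩ => ⟨_, continuous_subtype_val.continuousAt hN, h⟩

theorem holdsOn_near_iff {ι : Type*} {P : ι → PointClass.{u}}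
    {𝒰 : Set ι → Prop} (h𝒰 : ∀ A B, A ⊆ B → 𝒰 A → 𝒰 B) {x : X} :
    HoldsOn (fun Y _ y => ∀ N ∈ 𝓝 y, 𝒰 {i | ∃ z ∈ N, P i Y z}) F x ↔
      x ∈ F ∧ ∀ N ∈ 𝓝 x, 𝒰 {i | ∃ z ∈ N, HoldsOn (P i) F z} := by
  have key : ∀ N : Set X, {i | ∃ z ∈ (Subtype.val ⁻¹' N : Set F), P i F z} =
      {i | ∃ z ∈ N, HoldsOn (P i) F z} := by
    intro N
    ext i
    constructor
    · rintro ⟨⟨z, hz⟩, hzN, h⟩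
      exact ⟨z, hzN, hz, h⟩
    · rintro ⟨z, hzN, hz, h⟩
      exact ⟨⟨z, hz⟩, hzN, h⟩
  have mono : ∀ A B : Set F, A ⊆ B → 𝒰 {i | ∃ z ∈ A, P i F z} → 𝒰 {i | ∃ z ∈ B, P i F z} := by
    rintro A B hAB hA
    refine h𝒰 _ _ ?_ hA
    rintro i ⟨z, hz, hp⟩
    exact ⟨z, hAB hz, hp⟩
  refine ⟨fun ⟨hx, h⟩ => ⟨hx, ?_⟩, fun ⟨hx, h⟩ => ⟨hx, ?_⟩⟩
  · replace h := (forall_nhds_subtype mono).1 h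
    simpa only [key] using h
  · refine (forall_nhds_subtype mono).2 ?_
    simpa only [key] using h

theorem holdsOn_forall_near_iff {P : PointClass.{u}} {x : X} :
    HoldsOn (fun Y _ y => ∀ N ∈ 𝓝 y, ∃ z ∈ N, P Y z) F x ↔
      x ∈ F ∧ ∀ N ∈ 𝓝 x, ∃ z ∈ N, HoldsOn P F z := by
  have := holdsOn_near_iff (F := F) (x := x) (P := fun _ : Unit => P) (𝒰 := fun A => () ∈ A)
    (fun A B hAB h => hAB h)
  simpa using this

theorem holdsOn_exists_near_iff {P : PointClass.{u}} {x : X} :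
    HoldsOn (fun Y _ y => ∃ N ∈ 𝓝 y, ∀ z ∈ N, P Y z) F x ↔
      x ∈ F ∧ ∃ N ∈ 𝓝 x, ∀ z ∈ N, z ∈ F → HoldsOn P F z := by
  have anti : ∀ A B : Set F, A ⊆ B → (∀ z ∈ B, P F z) → ∀ z ∈ A, P F z :=
    fun A B hAB h z hz => h z (hAB hz)
  refine ⟨fun ⟨hx, h⟩ => ⟨hx, ?_⟩, fun ⟨hx, h⟩ => ⟨hx, ?_⟩⟩
  · replace h := (exists_nhds_subtype anti).1 h
    obtain ⟨N, hN, h⟩ := h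
    exact ⟨N, hN, fun z hz hzF => ⟨hzF, h ⟨z, hzF⟩ hz⟩⟩
  · refine (exists_nhds_subtype anti).2 ?_
    obtain ⟨N, hN, h⟩ := h
    exact ⟨N, hN, fun z hz => (h z hz z.2).2⟩

theorem holdsOn_isolated_iff {P : PointClass.{u}} {x : X} :
    HoldsOn (fun Y _ y => ∃ N ∈ 𝓝 y, ∀ z ∈ N, P Y z → z = y) F x ↔
      x ∈ F ∧ ∃ N ∈ 𝓝 x, ∀ z ∈ N, HoldsOn P F z → z = x := by
  have anti : ∀ x : F, ∀ A B : Set F, A ⊆ B → (∀ z ∈ B, P F z → z = x) →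
      ∀ z ∈ A, P F z → z = x := fun x A B hAB h z hz => h z (hAB hz)
  refine ⟨fun ⟨hx, h⟩ => ⟨hx, ?_⟩, fun ⟨hx, h⟩ => ⟨hx, ?_⟩⟩
  · replace h := (exists_nhds_subtype (anti _)).1 h
    obtain ⟨N, hN, h⟩ := h
    exact ⟨N, hN, fun z hz ⟨hzF, hp⟩ => congrArg Subtype.val (h ⟨z, hzF⟩ hz hp)⟩
  · refine (exists_nhds_subtype (anti _)).2 ?_
    obtain ⟨N, hN, h⟩ := h
    exact ⟨N, hN, fun z hz hp => Subtype.ext (h z hz ⟨z.2, hp⟩)⟩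

theorem holdsOn_accumulation_iff {P : PointClass.{u}} {x : X} :
    HoldsOn (fun Y _ y => ∀ N ∈ 𝓝 y, ∃ z ∈ N, z ≠ y ∧ P Y z) F x ↔
      x ∈ F ∧ ∀ N ∈ 𝓝 x, ∃ z ∈ N, z ≠ x ∧ HoldsOn P F z := by
  have mono : ∀ x : F, ∀ A B : Set F, A ⊆ B → (∃ z ∈ A, z ≠ x ∧ P F z) →
      ∃ z ∈ B, z ≠ x ∧ P F z := fun x A B hAB ⟨z, hz, h⟩ => ⟨z, hAB hz, h⟩
  refine ⟨fun ⟨hx, h⟩ => ⟨hx, ?_⟩, fun ⟨hx, h⟩ => ⟨hx, ?_⟩⟩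
  · replace h := (forall_nhds_subtype (mono _)).1 h
    intro N hN
    obtain ⟨z, hz, hne, hp⟩ := h N hN
    exact ⟨z, hz, fun e => hne (Subtype.ext e), z.2, hp⟩
  · refine (forall_nhds_subtype (mono _)).2 ?_
    intro N hN
    obtain ⟨z, hz, hne, hzF, hp⟩ := h N hN
    exact ⟨⟨z, hzF⟩, hz, fun e => hne (congrArg Subtype.val e), hp⟩

theorem mk_holdsOn {P : PointClass.{u}} (N : Set X) :
    #{z | z ∈ (Subtype.val ⁻¹' N : Set F) ∧ P F z} = #{z | z ∈ N ∧ HoldsOn P F z} := by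
  rw [← mk_image_eq (Subtype.val_injective (p := (· ∈ F)))]
  congr 2
  ext z
  constructor
  · rintro ⟨⟨z, hz⟩, ⟨hzN, h⟩, rfl⟩
    exact ⟨hzN, hz, h⟩
  · rintro ⟨hzN, hz, h⟩
    exact ⟨⟨z, hz⟩, ⟨hzN, h⟩, rfl⟩

theorem holdsOn_le_count_iff {P : PointClass.{u}} {x : X} {δ : Cardinal.{u}} :
    HoldsOn (fun Y _ y => ∀ N ∈ 𝓝 y, δ ≤ #{z | z ∈ N ∧ P Y z}) F x ↔
      x ∈ F ∧ ∀ N ∈ 𝓝 x, δ ≤ #{z | z ∈ N ∧ HoldsOn P F z} := by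
  have mono : ∀ A B : Set F, A ⊆ B → δ ≤ #{z | z ∈ A ∧ P F z} → δ ≤ #{z | z ∈ B ∧ P F z} := by
    refine fun A B hAB h => h.trans (mk_le_mk_of_subset ?_)
    rintro z ⟨hz, hp⟩
    exact ⟨hAB hz, hp⟩
  refine ⟨fun ⟨hx, h⟩ => ⟨hx, ?_⟩, fun ⟨hx, h⟩ => ⟨hx, ?_⟩⟩
  · replace h := (forall_nhds_subtype mono).1 h
    simpa only [mk_holdsOn] using h
  · refine (forall_nhds_subtype mono).2 ?_
    simpa only [mk_holdsOn] using h

theorem holdsOn_count_le_iff {P : PointClass.{u}} {x : X} {δ : Cardinal.{u}} :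
    HoldsOn (fun Y _ y => ∃ N ∈ 𝓝 y, #{z | z ∈ N ∧ P Y z} ≤ δ) F x ↔
      x ∈ F ∧ ∃ N ∈ 𝓝 x, #{z | z ∈ N ∧ HoldsOn P F z} ≤ δ := by
  have anti : ∀ A B : Set F, A ⊆ B → #{z | z ∈ B ∧ P F z} ≤ δ → #{z | z ∈ A ∧ P F z} ≤ δ := by
    refine fun A B hAB h => le_trans (mk_le_mk_of_subset ?_) h
    rintro z ⟨hz, hp⟩
    exact ⟨hAB hz, hp⟩
  refine ⟨fun ⟨hx, h⟩ => ⟨hx, ?_⟩, fun ⟨hx, h⟩ => ⟨hx, ?_⟩⟩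
  · replace h := (exists_nhds_subtype anti).1 h
    simpa only [mk_holdsOn] using h
  · refine (exists_nhds_subtype anti).2 ?_
    simpa only [mk_holdsOn] using h

theorem holdsOn_and_iff {P Q : PointClass.{u}} {x : X} :
    HoldsOn (fun Y _ y => P Y y ∧ Q Y y) F x ↔ HoldsOn P F x ∧ HoldsOn Q F x :=
  ⟨fun ⟨hx, h⟩ => ⟨⟨hx, h.1⟩, hx, h.2⟩, fun ⟨⟨hx, h⟩, _, h'⟩ => ⟨hx, h, h'⟩⟩

theorem holdsOn_imp {P Q : PointClass.{u}} (h : ∀ (Y : Type u) [TopologicalSpace Y] (y : Y),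
    P Y y → Q Y y) {x : X} (hx : HoldsOn P F x) : HoldsOn Q F x :=
  ⟨hx.1, h _ _ hx.2⟩

end subtype

section solo

variable {ι : Type v} {P : ι → PointClass.{u}}

/-- The class `P i`, with no other class of the family `P` nearby. -/
def Solo (P : ι → PointClass.{u}) (i : ι) : PointClass.{u} := fun Y _ y =>
  P i Y y ∧ ∃ N ∈ 𝓝 y, ∀ z ∈ N, ∀ j, P j Y z → j = i

theorem isLocal_solo (hP : ∀ i, IsLocal (P i)) (i : ι) : IsLocal (Solo P i) :=
  isLocal_and (hP i) (isLocal_exists_near (isLocal_forall fun j =>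
    fun _ _ _ _ e he y => imp_congr_left (hP j e he y)))

variable {X : Type u} [TopologicalSpace X] [LinearOrder X]
  {J : ι → Set X} {m : ι → X}

theorem SeparatedFamily.solo (h : SeparatedFamily P J m) (i : ι) : Solo P i X (m i) :=
  ⟨h.holds i, J i, (h.isClopen i).isOpen.mem_nhds (h.mem i), fun z hz j hj =>
    h.eq_of_holds i j z hz hj⟩

end solo

section marks

/-- Infinitely many classes of the family `u` occur separately near the point. -/
def AccMany (u : ℕ → PointClass.{u}) : PointClass.{u} := fun Y _ y =>
  ∀ N ∈ 𝓝 y, {i | ∃ z ∈ N, Solo u i Y z}.Infinite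

/-- The point is isolated among the points of the class `AccMany u`; infinitely many classes
`u i` of colour `n` occur near it, and none of greater colour. -/
def Mark (u : ℕ → PointClass.{u}) (n : ℕ) : PointClass.{u} := fun Y _ y =>
  (∃ N ∈ 𝓝 y, ∀ w ∈ N, AccMany u Y w → w = y) ∧
  (∀ N ∈ 𝓝 y, {i | i.unpair.1 = n ∧ ∃ z ∈ N, Solo u i Y z}.Infinite) ∧
  ∃ N ∈ 𝓝 y, ∀ z ∈ N, ∀ i, Solo u i Y z → i.unpair.1 ≤ n

def AnyMark (u : ℕ → PointClass.{u}) : PointClass.{u} := fun Y _ y => ∃ n, Mark u n Y y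

variable {u : ℕ → PointClass.{u}}

theorem infinite_mono {α : Type*} (A B : Set α) (h : A ⊆ B) (hA : A.Infinite) : B.Infinite :=
  hA.mono h

theorem isLocal_accMany (hu : ∀ i, IsLocal (u i)) : IsLocal (AccMany u) :=
  isLocal_near (isLocal_solo hu) Set.Infinite infinite_mono

theorem isLocal_mark (hu : ∀ i, IsLocal (u i)) (n : ℕ) : IsLocal (Mark u n) := by
  refine isLocal_and (isLocal_isolated (isLocal_accMany hu)) (isLocal_and ?_ ?_)
  · have := isLocal_near (isLocal_solo hu) (fun A => {i | i.unpair.1 = n ∧ i ∈ A}.Infinite)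
      (fun A B hAB h => h.mono fun i hi => ⟨hi.1, hAB hi.2⟩)
    exact this
  · exact isLocal_exists_near (isLocal_forall fun i _ _ _ _ e he y =>
      imp_congr_left (isLocal_solo hu i e he y))

theorem isLocal_anyMark (hu : ∀ i, IsLocal (u i)) : IsLocal (AnyMark u) :=
  isLocal_exists (isLocal_mark hu)

theorem Mark.accMany {n : ℕ} {Y : Type u} [TopologicalSpace Y] {y : Y} (h : Mark u n Y y) :
    AccMany u Y y := fun N hN => (h.2.1 N hN).mono fun _ hi => hi.2

theorem Mark.isolated {n : ℕ} {Y : Type u} [TopologicalSpace Y] {y : Y} (h : Mark u n Y y) :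
    ∃ N ∈ 𝓝 y, ∀ w ∈ N, AnyMark u Y w → w = y := by
  obtain ⟨N, hN, hN'⟩ := h.1
  exact ⟨N, hN, fun w hw ⟨k, hk⟩ => hN' w hw hk.accMany⟩

theorem Mark.unique {n k : ℕ} {Y : Type u} [TopologicalSpace Y] {y : Y} (h : Mark u n Y y)
    (h' : Mark u k Y y) : n = k := by
  have key : ∀ {n k : ℕ}, Mark u n Y y → Mark u k Y y → n ≤ k := by
    intro n k h h'
    obtain ⟨N, hN, hN'⟩ := h'.2.2
    obtain ⟨i, rfl, z, hz, hi⟩ := (h.2.1 N hN).nonempty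
    exact hN' z hz i hi
  exact le_antisymm (key h h') (key h' h)

/-- The space `W` has exactly one marked point, with the mark `k`. -/
def IsPure (u : ℕ → PointClass.{u}) (k : ℕ) (W : Type u) [TopologicalSpace W] : Prop :=
  ∃ z : W, ∀ j w, Mark u j W w ↔ j = k ∧ w = z

theorem IsPure.congr (hu : ∀ i, IsLocal (u i)) {k : ℕ} {W W' : Type u} [TopologicalSpace W]
    [TopologicalSpace W'] (h : IsPure u k W) (e : W ≃ₜ W') : IsPure u k W' := by
  obtain ⟨z, hz⟩ := h
  refine ⟨e z, fun j w => ?_⟩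
  rw [isLocal_mark hu j e.symm e.symm.isOpenEmbedding w, hz, e.symm_apply_eq]

/-- Every neighbourhood of the point contains a compact space that is pure of mark `k`. -/
def Rich (u : ℕ → PointClass.{u}) (k : ℕ) : PointClass.{u} := fun Y _ y =>
  ∀ N ∈ 𝓝 y, ∃ (W : Type u) (_ : TopologicalSpace W), CompactSpace W ∧ IsPure u k W ∧
    ∃ f : W → Y, IsEmbedding f ∧ range f ⊆ N

theorem isLocal_rich (k : ℕ) : IsLocal (Rich u k) := isLocal_embeds (IsPure u k)

variable {X : Type u} [TopologicalSpace X]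

theorem isPure_coe_iff {k : ℕ} {K : Set X} :
    IsPure u k K ↔ ∃ z, z ∈ K ∧ ∀ j w, HoldsOn (Mark u j) K w ↔ j = k ∧ w = z := by
  constructor
  · rintro ⟨z, hz⟩
    refine ⟨z, z.2, fun j w => ⟨fun ⟨hw, h⟩ => ?_, ?_⟩⟩
    · exact ⟨((hz _ _).1 h).1, congrArg Subtype.val ((hz _ _).1 h).2⟩
    · rintro ⟨rfl, rfl⟩
      exact ⟨z.2, (hz _ _).2 ⟨rfl, rfl⟩⟩
  · rintro ⟨z, hzK, hz⟩
    refine ⟨⟨z, hzK⟩, fun j w => ?_⟩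
    rw [← holdsOn_coe (P := Mark u j), hz, Subtype.ext_iff]

theorem rich_iff [CompactSpace X] [T2Space X] (hu : ∀ i, IsLocal (u i)) {k : ℕ} {F : Set X}
    {x : X} : HoldsOn (Rich u k) F x ↔
      x ∈ F ∧ ∀ N ∈ 𝓝 x, ∃ K ⊆ N ∩ F, IsClosed K ∧ IsPure u k K := by
  constructor
  · rintro ⟨hx, h⟩
    refine ⟨hx, fun N hN => ?_⟩
    obtain ⟨W, tW, hc, hS, f, hf, h⟩ := h _ (continuous_subtype_val.continuousAt hN)
    have hg : IsEmbedding (Subtype.val ∘ f) := IsEmbedding.subtypeVal.comp hf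
    refine ⟨range (Subtype.val ∘ f), ?_, (isCompact_range hg.continuous).isClosed,
      hS.congr hu hg.toHomeomorph⟩
    rintro _ ⟨w, rfl⟩
    exact ⟨h ⟨w, rfl⟩, (f w).2⟩
  · rintro ⟨hx, h⟩
    refine ⟨hx, fun N hN => ?_⟩
    obtain ⟨M, hM, hMN⟩ := mem_nhds_subtype F _ N |>.1 hN
    obtain ⟨K, hK, hKc, hp⟩ := h M hM
    refine ⟨K, inferInstance, isCompact_iff_compactSpace.1 hKc.isCompact, hp,
      Set.inclusion fun z hz => (hK hz).2, .inclusion _, ?_⟩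
    rintro _ ⟨z, rfl⟩
    exact hMN (hK z.2).1

variable [LinearOrder X] [OrderTopology X] {J : ℕ → Set X} {m : ℕ → X}
  {O : ℕ → Set X} {y : X}

theorem SeparatedFamily.holdsOn_pointedUnion_iff {P : ℕ → PointClass.{u}}
    (h : SeparatedFamily P J m) (hO : ShrinksTo O y)
    (hJO : ∀ i, J i ⊆ O i) {B : Set ℕ} {Q : PointClass.{u}} (hQ : IsLocal Q) {i : ℕ} (hi : i ∈ B)
    {z : X} (hz : z ∈ J i) : HoldsOn Q (pointedUnion y J B) z ↔ Q X z := by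
  rw [hO.holdsOn_iff hJO hi hQ hz, hQ.holdsOn_isOpen (h.isClopen i).isOpen hz]

theorem SeparatedFamily.exists_subset_of_nhds (hO : ShrinksTo O y)
    (hJO : ∀ i, J i ⊆ O i) {B : Set ℕ} (hB : B.Infinite) {N : Set X} (hN : N ∈ 𝓝 y) (i : ℕ) :
    ∃ k ∈ B, i < k ∧ J k ⊆ N := by
  obtain ⟨n, hn⟩ := hO.eventually N hN
  obtain ⟨k, hk, hk'⟩ := hB.exists_gt (max n i)
  exact ⟨k, hk, by lia, (hJO k).trans (hn k (by lia))⟩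

/-- A member of an infinite pointed union that is separately of the class `P i` lies in `J i`. -/
theorem SeparatedFamily.solo_pointedUnion_iff {P : ℕ → PointClass.{u}}
    (h : SeparatedFamily P J m) (hO : ShrinksTo O y) (hJO : ∀ i, J i ⊆ O i)
    {B : Set ℕ} (hB : B.Infinite) {i : ℕ} {z : X} :
    HoldsOn (Solo P i) (pointedUnion y J B) z ↔ i ∈ B ∧ z ∈ J i ∧ Solo P i X z := by
  constructor
  · intro hz
    rcases mem_pointedUnion.1 hz.mem with rfl | ⟨k, hk, hzk⟩
    · exfalso
      obtain ⟨-, h2⟩ := holdsOn_and_iff.1 hz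
      obtain ⟨-, N, hN, h3⟩ := holdsOn_exists_near_iff.1 h2
      obtain ⟨k, hk, hik, hkN⟩ := SeparatedFamily.exists_subset_of_nhds hO hJO hB hN i
      have h4 := (h.holdsOn_pointedUnion_iff hO hJO (h.isLocal k) hk (h.mem k)).2 (h.holds k)
      have := (h3 (m k) (hkN (h.mem k)) h4.mem).2 k h4.2
      lia
    · have h1 := (h.holdsOn_pointedUnion_iff hO hJO (isLocal_solo h.isLocal i) hk hzk).1 hz
      obtain rfl := h.eq_of_holds k i z hzk h1.1
      exact ⟨hk, hzk, h1⟩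
  · rintro ⟨hi, hz, hs⟩
    exact (h.holdsOn_pointedUnion_iff hO hJO (isLocal_solo h.isLocal i) hi hz).2 hs

theorem infinite_colour (n N : ℕ) : {i : ℕ | i.unpair.1 = n ∧ N ≤ i}.Infinite := by
  rw [infinite_iff_exists_gt]
  intro a
  refine ⟨Nat.pair n (a + N + 1), ⟨by simp, ?_⟩, ?_⟩
  · exact le_trans (by lia) (Nat.right_le_pair n (a + N + 1))
  · exact lt_of_lt_of_le (by lia) (Nat.right_le_pair n (a + N + 1))

theorem SeparatedFamily.mark_pointedUnion_iff (h : SeparatedFamily u J m) (hO : ShrinksTo O y)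
    (hJO : ∀ i, J i ⊆ O i) {n a k : ℕ} {w : X} :
    HoldsOn (Mark u k) (pointedUnion y J {i | i.unpair.1 ≤ n ∧ a ≤ i}) w ↔ k = n ∧ w = y := by
  set B : Set ℕ := {i | i.unpair.1 ≤ n ∧ a ≤ i}
  have hB : B.Infinite := (infinite_colour n a).mono fun i hi => ⟨hi.1.le, hi.2⟩
  have hsolo := fun i z => h.solo_pointedUnion_iff hO hJO hB (i := i) (z := z)
  have hacc : ∀ w, HoldsOn (AccMany u) (pointedUnion y J B) w → w = y := by
    intro w hw
    obtain ⟨hwF, hw⟩ := (holdsOn_near_iff infinite_mono).1 hw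
    by_contra hne
    obtain ⟨i, hi, hwi⟩ := (mem_pointedUnion.1 hwF).resolve_left hne
    refine hw (J i) ((h.isClopen i).isOpen.mem_nhds hwi) ((finite_singleton i).subset ?_)
    rintro j ⟨z, hz, hj⟩
    exact h.eq_of_holds i j z hz ((hsolo j z).1 hj).2.2.1
  have hmark : HoldsOn (Mark u n) (pointedUnion y J B) y := by
    refine holdsOn_and_iff.2 ⟨?_, holdsOn_and_iff.2 ⟨?_, ?_⟩⟩
    · exact holdsOn_isolated_iff.2 ⟨mem_pointedUnion.2 (.inl rfl), univ, univ_mem,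
        fun z _ hz => hacc z hz⟩
    · have hmono : ∀ A B : Set ℕ, A ⊆ B → {i | i.unpair.1 = n ∧ i ∈ A}.Infinite →
          {i | i.unpair.1 = n ∧ i ∈ B}.Infinite :=
        fun A B hAB h => h.mono fun i hi => ⟨hi.1, hAB hi.2⟩
      refine (holdsOn_near_iff (𝒰 := fun A => {i : ℕ | i.unpair.1 = n ∧ i ∈ A}.Infinite)
        hmono).2
        ⟨mem_pointedUnion.2 (.inl rfl), fun N hN => ?_⟩
      obtain ⟨b, hb⟩ := hO.eventually N hN
      refine (infinite_colour n (max a b)).mono ?_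
      rintro i ⟨hi, hi'⟩
      exact ⟨hi, m i, hb i (by lia) (hJO i (h.mem i)),
        (hsolo i _).2 ⟨⟨hi.le, by lia⟩, h.mem i, h.solo i⟩⟩
    · exact holdsOn_exists_near_iff.2 ⟨mem_pointedUnion.2 (.inl rfl), univ, univ_mem,
        fun z _ hz => ⟨hz, fun i hi => ((hsolo i z).1 ⟨hz, hi⟩).1.1⟩⟩
  constructor
  · intro hk
    obtain rfl := hacc w (holdsOn_imp (fun Y _ y h => h.accMany) hk)
    exact ⟨hk.2.unique hmark.2, rfl⟩
  · rintro ⟨rfl, rfl⟩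
    exact hmark

theorem SeparatedFamily.rich_pointedUnion [CompactSpace X] (h : SeparatedFamily u J m)
    (hO : ShrinksTo O y) (hJO : ∀ i, J i ⊆ O i) {n k : ℕ} (hk : k ≤ n) :
    HoldsOn (Rich u k) (pointedUnion y J {i | i.unpair.1 ≤ n ∧ 0 ≤ i}) y := by
  refine (rich_iff h.isLocal).2 ⟨mem_pointedUnion.2 (.inl rfl), fun N hN => ?_⟩
  obtain ⟨b, hb⟩ := hO.eventually N hN
  refine ⟨pointedUnion y J {i | i.unpair.1 ≤ k ∧ b ≤ i}, ?_,
    hO.isClosed_pointedUnion (fun i => (h.isClopen i).isClosed) hJO _,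
    isPure_coe_iff.2 ⟨y, mem_pointedUnion.2 (.inl rfl), fun j w =>
      h.mark_pointedUnion_iff hO hJO⟩⟩
  intro z hz
  rcases mem_pointedUnion.1 hz with rfl | ⟨i, hi, hzi⟩
  · exact ⟨mem_of_mem_nhds hN, mem_pointedUnion.2 (.inl rfl)⟩
  · exact ⟨hb i hi.2 (hJO i hzi), mem_pointedUnion.2 (.inr ⟨i, ⟨hi.1.trans hk, Nat.zero_le _⟩, hzi⟩)⟩

end marks

section cardinal

/-- An infinite set of cardinality `δ` has more than `δ` subsets of cardinality `δ` with pairwise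
intersections of cardinality less than `δ`. -/
theorem exists_almostDisjoint (ι : Type u) (hι : ℵ₀ ≤ #ι) :
    ∃ (Λ : Type u) (A : Λ → Set ι), #ι < #Λ ∧ (∀ a, #(A a) = #ι) ∧
      ∀ a b, a ≠ b → #(A a ∩ A b : Set ι) < #ι := by
  let T : Type u := (#ι).ord.ToType
  have hT : #T = #ι := mk_ord_toType _
  let Λ : Type u := (Order.succ #ι).ord.ToType
  have hidx : ∀ z : Λ, ∃ g : Iio z → T, Function.Injective g := by
    intro z
    have h1 : #(Iio z) < Order.succ #ι := by simpa [Λ] using mk_Iio_lt z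
    have h2 : #(Iio z) ≤ #T := by rw [hT]; exact Order.lt_succ_iff.1 h1
    obtain ⟨g⟩ := h2
    exact ⟨g, g.injective⟩
  choose idx hidx using hidx
  have hex : ∀ (z : Λ) (rec : ∀ a, a < z → T → T) (t : T),
      ∃ x : T, ∀ a (ha : a < z), idx z ⟨a, ha⟩ < t → rec a ha t ≠ x := by
    intro z rec t
    by_contra! hc
    have h1 : #T ≤ #(Iio t) := by
      choose a ha hlt he using hc
      refine mk_le_of_injective (f := fun x => ⟨idx z ⟨a x, ha x⟩, hlt x⟩) ?_
      intro x y hxy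
      have h2 := hidx z (Subtype.ext_iff.1 hxy)
      have h3 : ∀ b (hb : b < z), b = a y → rec b hb t = rec (a y) (ha y) t := by
        rintro b hb rfl
        rfl
      rw [← he x, ← he y]
      exact h3 _ _ (congrArg Subtype.val h2)
    have h2 : #(Iio t) < #ι := by simpa [T] using mk_Iio_lt t
    exact (h2.trans_le hT.ge).not_ge h1
  choose nxt hnxt using hex
  let f : Λ → T → T := (wellFounded_lt (α := Λ)).fix nxt
  have hf : ∀ a z (h : a < z) t, idx z ⟨a, h⟩ < t → f a t ≠ f z t := by
    intro a z h t hlt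
    have : f z = nxt z (fun a _ => f a) := (wellFounded_lt (α := Λ)).fix_eq nxt z
    rw [this]
    exact hnxt z (fun a _ => f a) t a h hlt
  have hTT : #(T × T) = #ι := by
    rw [← mul_def, hT, mul_eq_self hι]
  obtain ⟨φ⟩ := Cardinal.eq.1 hTT
  have hsmall : ∀ a z (h : a < z),
      #(range (fun t => φ (t, f z t)) ∩ range (fun t => φ (t, f a t)) : Set ι) < #ι := by
    intro a z h
    have hsub : (range (fun t => φ (t, f z t)) ∩ range (fun t => φ (t, f a t)) : Set ι) ⊆
        (fun t => φ (t, f z t)) '' Iic (idx z ⟨a, h⟩) := by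
      rintro _ ⟨⟨t, rfl⟩, s, hs⟩
      have := φ.injective hs
      simp only [Prod.mk.injEq] at this
      obtain ⟨rfl, h2⟩ := this
      exact ⟨s, not_lt.1 fun hlt => hf a z h s hlt h2, rfl⟩
    refine (mk_le_mk_of_subset hsub).trans_lt (mk_image_le.trans_lt ?_)
    rw [← Iio_insert]
    refine mk_insert_le.trans_lt (add_lt_of_lt hι ?_ (one_lt_aleph0.trans_le hι))
    simpa [T] using mk_Iio_lt (idx z ⟨a, h⟩)
  refine ⟨Λ, fun z => range fun t => φ (t, f z t), ?_, ?_, ?_⟩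
  · rw [mk_ord_toType]
    exact Order.lt_succ _
  · intro z
    rw [mk_range_eq, hT]
    intro s t hst
    exact congrArg Prod.fst (φ.injective hst)
  · intro a b hab
    rcases lt_or_gt_of_ne hab with h | h
    · rw [inter_comm]
      exact hsmall a b h
    · exact hsmall b a h

theorem exists_complete_accumulation {X : Type u} [TopologicalSpace X] [CompactSpace X]
    {ι : Type u} (m : ι → X) (A : Set ι) (hA : ℵ₀ ≤ #A) :
    ∃ x, ∀ N ∈ 𝓝 x, #A ≤ #{i | i ∈ A ∧ m i ∈ N} := by
  by_contra! hc
  have : #{i | i ∈ A ∧ m i ∈ Set.univ} < #A := by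
    refine isCompact_univ.induction_on (p := fun s => #{i | i ∈ A ∧ m i ∈ s} < #A) ?_ ?_ ?_ ?_
    · simpa using aleph0_pos.trans_le hA
    · intro s t hst ht
      exact (mk_le_mk_of_subset fun i (hi : i ∈ A ∧ m i ∈ s) =>
        (⟨hi.1, hst hi.2⟩ : i ∈ A ∧ m i ∈ t)).trans_lt ht
    · intro s t hs ht
      refine lt_of_le_of_lt (le_trans (mk_le_mk_of_subset ?_) (mk_union_le _ _))
        (add_lt_of_lt hA hs ht)
      rintro i ⟨hi, h | h⟩
      · exact .inl ⟨hi, h⟩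
      · exact .inr ⟨hi, h⟩
    · intro x _
      obtain ⟨N, hN, h⟩ := hc x
      exact ⟨N, mem_nhdsWithin_of_mem_nhds hN, h⟩
  simp at this

end cardinal

section marked

variable {X : Type u} [TopologicalSpace X] [LinearOrder X] [OrderTopology X]

/-- A separated family of classes whose points are rich of all marks less than `n`, realized by
clopen sets without marks less than `n` and with at most `β` marked points. -/
structure MarkedFamily (u : ℕ → PointClass.{u}) (n : ℕ) (β : Cardinal.{u}) {ι : Type u}
    (P : ι → PointClass.{u}) (J : ι → Set X) (m : ι → X) : Prop
    extends SeparatedFamily P J m where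
  not_mark : ∀ i, ∀ x ∈ J i, ∀ k < n, ¬ Mark u k X x
  count : ∀ i, #{x | x ∈ J i ∧ AnyMark u X x} ≤ β
  near : ∀ i (Y : Type u) [TopologicalSpace Y] (y : Y), P i Y y →
    ∀ N ∈ 𝓝 y, ∃ z ∈ N, AnyMark u Y z
  rich : ∀ i (Y : Type u) [TopologicalSpace Y] (y : Y), P i Y y → ∀ k < n, Rich u k Y y

variable {u : ℕ → PointClass.{u}} {n : ℕ} {β : Cardinal.{u}}

theorem exists_markedFamily (hCO : IsCOSpace X) (hu : ∀ i, IsLocal (u i)) {ι : Type u}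
    {P : ι → PointClass.{u}} (hP : ∀ i, IsLocal (P i)) {F : ι → Set X}
    (hF : ∀ i, IsClosed (F i)) {x : ι → X} (hx : ∀ i, HoldsOn (P i) (F i) (x i))
    (hind : ∀ i j y, HoldsOn (P j) (F i) y → j = i)
    (hmark : ∀ i z, ∀ k < n, ¬ HoldsOn (Mark u k) (F i) z)
    (hcount : ∀ i, #{z | HoldsOn (AnyMark u) (F i) z} ≤ β)
    (hnear : ∀ i (Y : Type u) [TopologicalSpace Y] (y : Y), P i Y y →
      ∀ N ∈ 𝓝 y, ∃ z ∈ N, AnyMark u Y z)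
    (hrich : ∀ i (Y : Type u) [TopologicalSpace Y] (y : Y), P i Y y → ∀ k < n, Rich u k Y y) :
    ∃ (J : ι → Set X) (m : ι → X), MarkedFamily u n β P J m := by
  obtain ⟨J, m, hJ, he⟩ := exists_separatedFamily hCO hP hF hx hind
  refine ⟨J, m, hJ, ?_, ?_, hnear, hrich⟩
  · intro i z hz k hk h
    obtain ⟨e, he⟩ := he i
    obtain ⟨hz', h'⟩ := ((isLocal_mark hu k).holdsOn_isOpen (hJ.isClopen i).isOpen hz).2 h
    exact hmark i _ k hk ((holdsOn_coe _).2 ((isLocal_mark hu k e he _).1 h'))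
  · intro i
    obtain ⟨e, he⟩ := he i
    refine le_trans ?_ (hcount i)
    have h1 : ∀ z : {x | x ∈ J i ∧ AnyMark u X x}, HoldsOn (AnyMark u) (F i) (e ⟨z, z.2.1⟩) := by
      rintro ⟨z, hz, h⟩
      obtain ⟨hz', h'⟩ := ((isLocal_anyMark hu).holdsOn_isOpen (hJ.isClopen i).isOpen hz).2 h
      exact (holdsOn_coe _).2 ((isLocal_anyMark hu e he _).1 h')
    refine mk_le_of_injective (f := fun z => ⟨_, h1 z⟩) ?_
    intro z w hzw
    have h2 : e ⟨z, z.2.1⟩ = e ⟨w, w.2.1⟩ := Subtype.ext (Subtype.mk.inj hzw)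
    have h3 : (z : X) = w := Subtype.mk.inj (he.injective h2)
    exact Subtype.ext h3

/-- Marked families of cardinality `β` exist. -/
def HasMarkedFamily (X : Type u) [TopologicalSpace X] [LinearOrder X]
    (u : ℕ → PointClass.{u}) (n : ℕ) (β : Cardinal.{u}) : Prop :=
  ∃ (ι : Type u) (P : ι → PointClass.{u}) (J : ι → Set X) (m : ι → X),
    #ι = β ∧ MarkedFamily u n β P J m

theorem HasMarkedFamily.le (h : HasMarkedFamily X u n β) : β ≤ #X := by
  obtain ⟨ι, P, J, m, rfl, h⟩ := h
  exact mk_le_of_injective h.injective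

variable [CompactSpace X]

theorem SeparatedFamily.exists_shrinksTo {P : ℕ → PointClass.{u}} {J : ℕ → Set X} {m : ℕ → X}
    (h : SeparatedFamily P J m) : ∃ (s : ℕ → ℕ) (O : ℕ → Set X) (y : X), StrictMono s ∧
      ShrinksTo O y ∧ ∀ i, J (s i) ⊆ O i := by
  obtain ⟨s, O, y, hs, hO, hJ⟩ := _root_.exists_shrinksTo h.injective
  exact ⟨s, O, y, hs, hO, fun i => (hJ i).2 _ (h.ordConnected _) (h.mem _) fun k hk =>
    h.notMem hk⟩

theorem hasMarkedFamily_aleph0 (hCO : IsCOSpace X) {J : ℕ → Set X} {m : ℕ → X}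
    {O : ℕ → Set X} {y : X} (h : SeparatedFamily u J m) (hO : ShrinksTo O y)
    (hJO : ∀ i, J i ⊆ O i) (n : ℕ) : HasMarkedFamily X u n ℵ₀ := by
  have hmark := fun n k w => h.mark_pointedUnion_iff hO hJO (n := n) (a := 0) (k := k) (w := w)
  have hany : ∀ n w, HoldsOn (AnyMark u)
      (pointedUnion y J {i | i.unpair.1 ≤ n ∧ 0 ≤ i}) w → w = y := by
    rintro n w ⟨hw, k, hk⟩
    exact ((hmark n k w).1 ⟨hw, hk⟩).2
  obtain ⟨J', m', hJ'⟩ := exists_markedFamily (n := n) (β := ℵ₀) hCO h.isLocal (ι := ULift.{u} ℕ)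
    (P := fun i Y _ y => Mark u (n + i.down) Y y ∧ ∀ k, k < n → Rich u k Y y)
    (F := fun i => pointedUnion y J {j | j.unpair.1 ≤ n + i.down ∧ 0 ≤ j}) (x := fun _ => y)
    (fun i => isLocal_and (isLocal_mark h.isLocal _)
      (isLocal_forall fun k => isLocal_forall fun _ => isLocal_rich k))
    (fun i => hO.isClosed_pointedUnion (fun i => (h.isClopen i).isClosed) hJO _)
    (fun i => holdsOn_and_iff.2 ⟨(hmark _ _ _).2 ⟨rfl, rfl⟩, mem_pointedUnion.2 (.inl rfl),
      fun k hk => (h.rich_pointedUnion hO hJO (hk.le.trans (Nat.le_add_right _ _))).2⟩)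
    (fun i j w hw => by
      have := ((hmark _ _ _).1 (holdsOn_and_iff.1 hw).1).1
      exact ULift.ext _ _ (by lia))
    (fun i z k hk hz => by
      have := ((hmark _ _ _).1 hz).1
      lia)
    (fun i => (mk_le_one_iff_set_subsingleton.2 fun a ha b hb =>
      (hany _ _ ha).trans (hany _ _ hb).symm).trans one_lt_aleph0.le)
    (fun i Y _ w hw N hN => ⟨w, mem_of_mem_nhds hN, _, hw.1⟩)
    (fun i Y _ w hw => hw.2)
  exact ⟨_, _, J', m', by simp, hJ'⟩

theorem SeparatedFamily.holdsOn_closure_iff {ι : Type v} {P : ι → PointClass.{u}} {J : ι → Set X}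
    {m : ι → X} (h : SeparatedFamily P J m) {A : Set ι} {Q : PointClass.{u}} (hQ : IsLocal Q)
    {i : ι} (hi : i ∈ A) {z : X} (hz : z ∈ J i) :
    HoldsOn Q (closure (⋃ k ∈ A, J k)) z ↔ Q X z :=
  hQ.holdsOn_of_subset (h.isClopen i).isOpen
    ((subset_biUnion_of_mem (u := J) hi).trans subset_closure) hz

/-- From a marked family of cardinality `δ` to one of greater cardinality, with at least `δ` marked
points near every point of its classes. -/
theorem HasMarkedFamily.succ (hCO : IsCOSpace X) (hu : ∀ i, IsLocal (u i)) {δ : Cardinal.{u}}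
    (hδ : ℵ₀ ≤ δ) (h : HasMarkedFamily X u n δ) :
    ∃ (ι : Type u) (P : ι → PointClass.{u}) (J : ι → Set X) (m : ι → X), δ < #ι ∧
      MarkedFamily u n δ P J m ∧ ∀ i (Y : Type u) [TopologicalSpace Y] (y : Y), P i Y y →
        ∀ N ∈ 𝓝 y, δ ≤ #{z | z ∈ N ∧ AnyMark u Y z} := by
  obtain ⟨ι, P, J, m, rfl, h⟩ := h
  obtain ⟨Λ, A, hΛ, hA, hAd⟩ := exists_almostDisjoint ι hδ
  let F : Λ → Set X := fun a => closure (⋃ k ∈ A a, J k)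
  have hsep := h.toSeparatedFamily
  have hcases : ∀ a z, z ∈ F a → (∃ i ∈ A a, z ∈ J i) ∨ ∀ i ∈ A a, z ∉ J i := by
    intro a z _
    by_cases hz : ∃ i ∈ A a, z ∈ J i
    · exact .inl hz
    · exact .inr fun i hi hzi => hz ⟨i, hi, hzi⟩
  have hsolo : ∀ a i z, HoldsOn (Solo P i) (F a) z → i ∈ A a := by
    intro a i z hz
    rcases hcases a z hz.mem with ⟨j, hj, hzj⟩ | hrem
    · obtain rfl := h.eq_of_holds j i z hzj
        ((hsep.holdsOn_closure_iff (isLocal_solo h.isLocal i) hj hzj).1 hz).1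
      exact hj
    · exfalso
      obtain ⟨-, N, hN, h3⟩ := holdsOn_exists_near_iff.1 (holdsOn_and_iff.1 hz).2
      obtain ⟨k, hk, hki, hkN⟩ := hsep.exists_subset_nhds hz.mem hrem hN i
      have h4 := (hsep.holdsOn_closure_iff (h.isLocal k) hk (h.mem k)).2 (h.holds k)
      exact hki ((h3 (m k) (hkN (h.mem k)) h4.mem).2 k h4.2)
  have hany : ∀ a z, HoldsOn (AnyMark u) (F a) z → ∃ i ∈ A a, z ∈ J i ∧ AnyMark u X z := by
    intro a z hz
    rcases hcases a z hz.mem with ⟨j, hj, hzj⟩ | hrem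
    · exact ⟨j, hj, hzj, (hsep.holdsOn_closure_iff (isLocal_anyMark hu) hj hzj).1 hz⟩
    · exfalso
      obtain ⟨hzF, k, hk⟩ := hz
      obtain ⟨-, N, hN, h3⟩ := holdsOn_isolated_iff.1 ⟨hzF, hk.isolated⟩
      obtain ⟨i, hi, -, hiN⟩ := hsep.exists_subset_nhds hzF hrem hN (m := m)
        (k₀ := (mk_ne_zero_iff.1 (aleph0_pos.trans_le hδ).ne').some)
      obtain ⟨w, hw, hwm⟩ := h.near i X (m i) (h.holds i) (J i)
        ((h.isClopen i).isOpen.mem_nhds (h.mem i))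
      have := h3 w (hiN hw) ((hsep.holdsOn_closure_iff (isLocal_anyMark hu) hi hw).2 hwm)
      exact hrem i hi (this ▸ hw)
  have hacc : ∀ a, ∃ x, ∀ N ∈ 𝓝 x, #ι ≤ #{i | i ∈ A a ∧ m i ∈ N} := by
    intro a
    have := exists_complete_accumulation m (A a) (by rwa [hA])
    rwa [hA] at this
  choose x hx using hacc
  have hne : ∀ a, ∀ N ∈ 𝓝 (x a), ∃ i ∈ A a, m i ∈ N := by
    intro a N hN
    have := (aleph0_pos.trans_le hδ).trans_le (hx a N hN)
    obtain ⟨i, hi⟩ := mk_ne_zero_iff.1 this.ne'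
    exact ⟨i, hi⟩
  have hxF : ∀ a, x a ∈ F a := by
    intro a
    rw [mem_closure_iff_nhds]
    intro N hN
    obtain ⟨i, hi, hiN⟩ := hne a N hN
    exact ⟨m i, hiN, mem_iUnion₂.2 ⟨i, hi, h.mem i⟩⟩
  have hmono : ∀ a, ∀ S S' : Set ι, S ⊆ S' → #ι ≤ #{i | i ∈ A a ∧ i ∈ S} →
      #ι ≤ #{i | i ∈ A a ∧ i ∈ S'} := fun a S S' hS hc =>
    hc.trans (mk_le_mk_of_subset fun i (hi : i ∈ A a ∧ i ∈ S) =>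
      (⟨hi.1, hS hi.2⟩ : i ∈ A a ∧ i ∈ S'))
  obtain ⟨J', m', hJ'⟩ := exists_markedFamily (n := n) (β := #ι) hCO hu (ι := Λ)
    (P := fun a Y _ y => (∀ N ∈ 𝓝 y, #ι ≤ #{i | i ∈ A a ∧ i ∈ {i | ∃ z ∈ N, Solo P i Y z}}) ∧
      (∀ N ∈ 𝓝 y, #ι ≤ #{z | z ∈ N ∧ AnyMark u Y z}) ∧ ∀ k, k < n → Rich u k Y y)
    (F := F) (x := x)
    (fun a => isLocal_and (isLocal_near (isLocal_solo h.isLocal)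
      (fun S => #ι ≤ #{i | i ∈ A a ∧ i ∈ S}) (hmono a)) (isLocal_and
      (isLocal_le_count (isLocal_anyMark hu) _)
      (isLocal_forall fun k => isLocal_forall fun _ => isLocal_rich k)))
    (fun a => isClosed_closure)
    (fun a => by
      refine holdsOn_and_iff.2 ⟨?_, holdsOn_and_iff.2 ⟨?_, hxF a, fun k hk => ?_⟩⟩
      · refine (holdsOn_near_iff (𝒰 := fun S : Set ι => #ι ≤ #{i | i ∈ A a ∧ i ∈ S}) (hmono a)).2
          ⟨hxF a, fun N hN => (hx a N hN).trans (mk_le_mk_of_subset ?_)⟩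
        rintro i ⟨hi, hiN⟩
        exact ⟨hi, m i, hiN, (hsep.holdsOn_closure_iff (isLocal_solo h.isLocal i) hi
          (h.mem i)).2 (hsep.solo i)⟩
      · refine holdsOn_le_count_iff.2 ⟨hxF a, fun N hN => (hx a _ (interior_mem_nhds.2 hN)).trans ?_⟩
        have h1 : ∀ i : {i | i ∈ A a ∧ m i ∈ interior N}, ∃ z, (z ∈ N ∧
            HoldsOn (AnyMark u) (F a) z) ∧ z ∈ J i := by
          rintro ⟨i, hi, hiN⟩
          obtain ⟨z, hz, hzm⟩ := h.near i X (m i) (h.holds i) (interior N ∩ J i)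
            ((isOpen_interior.inter (h.isClopen i).isOpen).mem_nhds ⟨hiN, h.mem i⟩)
          exact ⟨z, ⟨interior_subset hz.1,
            (hsep.holdsOn_closure_iff (isLocal_anyMark hu) hi hz.2).2 hzm⟩, hz.2⟩
        choose g hg hgJ using h1
        refine mk_le_of_injective (f := fun i => ⟨g i, hg i⟩) ?_
        intro i j hij
        by_contra hne
        have h2 : g i = g j := Subtype.ext_iff.1 hij
        exact Set.disjoint_left.1 (h.disjoint i j fun e => hne (Subtype.ext e)) (hgJ i)
          (h2 ▸ hgJ j)
      · refine ((rich_iff hu).2 ⟨hxF a, fun N hN => ?_⟩).2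
        obtain ⟨i, hi, hiN⟩ := hne a _ (interior_mem_nhds.2 hN)
        have h1 := (hsep.holdsOn_closure_iff (isLocal_rich k) hi (h.mem i)).2
          (h.rich i X (m i) (h.holds i) k hk)
        exact ((rich_iff hu).1 h1).2 N (mem_interior_iff_mem_nhds.1 hiN))
    (fun a b z hz => by
      by_contra hne
      have h1 := ((holdsOn_near_iff (𝒰 := fun S : Set ι => #ι ≤ #{i | i ∈ A b ∧ i ∈ S})
        (hmono b)).1 (holdsOn_and_iff.1 hz).1).2 univ univ_mem
      refine (h1.trans (mk_le_mk_of_subset ?_)).not_gt (hAd b a hne)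
      rintro i ⟨hi, z, -, hz⟩
      exact ⟨hi, hsolo a i z hz⟩)
    (fun a z k hk hz => by
      obtain ⟨i, hi, hzi, -⟩ := hany a z (holdsOn_imp (fun Y _ y h => ⟨k, h⟩) hz)
      exact h.not_mark i z hzi k hk ((hsep.holdsOn_closure_iff (isLocal_mark hu k) hi hzi).1 hz))
    (fun a => by
      have h1 : {z | HoldsOn (AnyMark u) (F a) z} ⊆ ⋃ i : A a, {x | x ∈ J i ∧ AnyMark u X x} := by
        intro z hz
        obtain ⟨i, hi, hzi⟩ := hany a z hz
        exact mem_iUnion.2 ⟨⟨i, hi⟩, hzi⟩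
      refine (mk_le_mk_of_subset h1).trans ((mk_iUnion_le _).trans ?_)
      rw [hA]
      exact (mul_le_mul_right (ciSup_le' fun i : A a => h.count i) _).trans (mul_eq_self hδ).le)
    (fun a Y _ y hy N hN => by
      have := (aleph0_pos.trans_le hδ).trans_le (hy.2.1 N hN)
      obtain ⟨z, hz⟩ := mk_ne_zero_iff.1 this.ne'
      exact ⟨z, hz⟩)
    (fun a Y _ y hy => hy.2.2)
  exact ⟨Λ, _, J', m', hΛ, hJ', fun a Y _ y hy => hy.2.1⟩

end marked

section marked_sequence

variable {X : Type u} [TopologicalSpace X] [LinearOrder X] [OrderTopology X] [CompactSpace X]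
variable {u : ℕ → PointClass.{u}} {n : ℕ}

/-- A convergent sequence of members of a marked family, alternating with pure pieces of mark
`n`, has a closed union with exactly one accumulation point of the mark `n`. -/
theorem MarkedFamily.exists_sequence (hu : ∀ i, IsLocal (u i)) {δ : Cardinal.{u}} (hδ : ℵ₀ ≤ δ)
    {ι : Type u} {P : ι → PointClass.{u}} {J : ι → Set X} {m : ι → X}
    (h : MarkedFamily u (n + 1) δ P J m)
    (hP : ∀ i (Y : Type u) [TopologicalSpace Y] (y : Y), P i Y y →
        ∀ N ∈ 𝓝 y, δ ≤ #{z | z ∈ N ∧ AnyMark u Y z}) {q₀ : ℕ → ι} (hq₀ : q₀.Injective) :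
    ∃ (F : Set X) (y : X), IsClosed F ∧ y ∈ F ∧
      (∀ N ∈ 𝓝 y, ∃ z ∈ N, z ≠ y ∧ HoldsOn (Mark u n) F z) ∧
      (∀ z, (∀ N ∈ 𝓝 z, ∃ w ∈ N, w ≠ z ∧ HoldsOn (Mark u n) F w) → z ∈ F → z = y) ∧
      (∀ N ∈ 𝓝 y, δ ≤ #{z | z ∈ N ∧ HoldsOn (AnyMark u) F z}) ∧
      #{z | HoldsOn (AnyMark u) F z} ≤ δ ∧
      (∀ k < n, HoldsOn (Rich u k) F y) ∧
      (∀ z, ∀ k < n, ¬ HoldsOn (Mark u k) F z) ∧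
      (∀ j z, HoldsOn (Solo P j) F z → j ∈ range q₀) ∧
      ∀ N ∈ 𝓝 y, ∃ z ∈ N, ∃ k, HoldsOn (Solo P (q₀ k)) F z := by
  classical
  obtain ⟨s, O, y, hs, hO, hJO⟩ := (h.toSeparatedFamily.comp hq₀).exists_shrinksTo
  set q : ℕ → ι := q₀ ∘ s with hq
  have hqi : q.Injective := hq₀.comp hs.injective
  replace hJO : ∀ k, J (q k) ⊆ O k := hJO
  have hE : ∀ j, ∃ E ⊆ J j, IsClosed E ∧ IsPure u n E := by
    intro j
    have h1 := ((isLocal_rich n).holdsOn_isOpen (h.isClopen j).isOpen (h.mem j)).2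
      (h.rich j X (m j) (h.holds j) n (Nat.lt_succ_self n))
    obtain ⟨E, hE, hEc, hEp⟩ := ((rich_iff hu).1 h1).2 Set.univ univ_mem
    exact ⟨E, hE.trans inter_subset_right, hEc, hEp⟩
  choose E hEJ hEc hEp using hE
  have he : ∀ j, ∃ e, e ∈ E j ∧ ∀ k w, HoldsOn (Mark u k) (E j) w ↔ k = n ∧ w = e :=
    fun j => isPure_coe_iff.1 (hEp j)
  choose e heE he using he
  let K : ℕ → Set X := fun k => if Even k then J (q k) else E (q k)
  have hKe : ∀ k, Even k → K k = J (q k) := fun k hk => if_pos hk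
  have hKo : ∀ k, ¬ Even k → K k = E (q k) := fun k hk => if_neg hk
  have hKc : ∀ k, IsClosed (K k) := by
    intro k
    by_cases hk : Even k
    · rw [hKe k hk]
      exact (h.isClopen _).isClosed
    · rw [hKo k hk]
      exact hEc _
  have hKO : ∀ k, K k ⊆ O k := by
    intro k
    by_cases hk : Even k
    · rw [hKe k hk]
      exact hJO k
    · rw [hKo k hk]
      exact (hEJ _).trans (hJO k)
  set F := pointedUnion y K Set.univ with hF
  have hyF : y ∈ F := mem_pointedUnion.2 (.inl rfl)
  have hKF : ∀ k, K k ⊆ F := fun k z hz => mem_pointedUnion.2 (.inr ⟨k, trivial, hz⟩)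
  have hon : ∀ {Q : PointClass.{u}}, IsLocal Q → ∀ k z, z ∈ K k →
      (HoldsOn Q F z ↔ HoldsOn Q (K k) z) := fun hQ k z hz =>
    hO.holdsOn_iff hKO (mem_univ k) hQ hz
  have hone : ∀ {Q : PointClass.{u}}, IsLocal Q → ∀ k, Even k → ∀ z ∈ J (q k),
      (HoldsOn Q F z ↔ Q X z) := by
    intro Q hQ k hk z hz
    rw [hon hQ k z (by rwa [hKe k hk]), hKe k hk, hQ.holdsOn_isOpen (h.isClopen _).isOpen hz]
  have hono : ∀ {Q : PointClass.{u}}, IsLocal Q → ∀ k, ¬ Even k → ∀ z ∈ E (q k),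
      (HoldsOn Q F z ↔ HoldsOn Q (E (q k)) z) := by
    intro Q hQ k hk z hz
    rw [hon hQ k z (by rwa [hKo k hk]), hKo k hk]
  have heven : ∀ N ∈ 𝓝 y, ∀ a, ∃ k, Even k ∧ a < k ∧ J (q k) ⊆ N := by
    intro N hN a
    obtain ⟨b, hb⟩ := hO.eventually N hN
    exact ⟨2 * (a + b + 1), even_two_mul _, by lia, (hJO _).trans (hb _ (by lia))⟩
  have hodd : ∀ N ∈ 𝓝 y, ∃ k, ¬ Even k ∧ O k ⊆ N := by
    intro N hN
    obtain ⟨b, hb⟩ := hO.eventually N hN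
    exact ⟨2 * b + 1, by simp, hb _ (by lia)⟩
  have hmarkn : ∀ N ∈ 𝓝 y, ∃ z ∈ N, z ≠ y ∧ HoldsOn (Mark u n) F z := by
    intro N hN
    obtain ⟨k, hk, hkN⟩ := hodd N hN
    have h1 : e (q k) ∈ O k := hJO k (hEJ _ (heE _))
    exact ⟨e (q k), hkN h1, fun h2 => hO.notMem k (h2 ▸ h1),
      (hono (isLocal_mark hu n) k hk _ (heE _)).2 ((he _ _ _).2 ⟨rfl, rfl⟩)⟩
  have hnoty : ∀ k, ¬ HoldsOn (Mark u k) F y := by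
    rintro k ⟨hy, hk⟩
    obtain ⟨-, N, hN, h3⟩ := holdsOn_isolated_iff.1 ⟨hy, hk.isolated⟩
    obtain ⟨z, hz, hzy, hzm⟩ := hmarkn N hN
    exact hzy (h3 z hz (holdsOn_imp (fun Y _ y h => ⟨n, h⟩) hzm))
  have hmark : ∀ k z, HoldsOn (Mark u k) F z → (∃ i, Even i ∧ z ∈ J (q i) ∧ Mark u k X z) ∨
      ∃ i, ¬ Even i ∧ z = e (q i) ∧ k = n := by
    intro k z hz
    rcases mem_pointedUnion.1 hz.mem with rfl | ⟨i, -, hi⟩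
    · exact absurd hz (hnoty k)
    · by_cases hie : Even i
      · rw [hKe i hie] at hi
        exact .inl ⟨i, hie, hi, (hone (isLocal_mark hu k) i hie z hi).1 hz⟩
      · rw [hKo i hie] at hi
        obtain ⟨h1, h2⟩ := (he _ _ _).1 ((hono (isLocal_mark hu k) i hie z hi).1 hz)
        exact .inr ⟨i, hie, h2, h1⟩
  refine ⟨F, y, hO.isClosed_pointedUnion hKc hKO _, hyF, hmarkn, ?_, ?_, ?_, ?_, ?_, ?_, ?_⟩
  · intro z hz hzF
    by_contra hzy
    obtain ⟨k, -, hk⟩ := (mem_pointedUnion.1 hzF).resolve_left hzy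
    have key : ∀ w ∈ O k, HoldsOn (Mark u n) F w → w = e (q k) := by
      intro w hw hwm
      rcases hmark n w hwm with ⟨i, hie, hi, hiX⟩ | ⟨i, hie, rfl, -⟩
      · exact absurd hiX (h.not_mark _ w hi n (Nat.lt_succ_self n))
      · by_contra hne
        have hik : i ≠ k := fun h => hne (by rw [h])
        exact Set.disjoint_left.1 (hO.disjoint i k hik) (hJO i (hEJ _ (heE _))) hw
    rcases eq_or_ne z (e (q k)) with h1 | h1
    · obtain ⟨w, hw, hwz, hwm⟩ := hz (O k) ((hO.isOpen k).mem_nhds (hKO k hk))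
      exact hwz ((key w hw hwm).trans h1.symm)
    · obtain ⟨w, hw, hwz, hwm⟩ := hz (O k ∩ {e (q k)}ᶜ)
        (((hO.isOpen k).inter isOpen_compl_singleton).mem_nhds ⟨hKO k hk, h1⟩)
      exact hw.2 (key w hw.1 hwm)
  · intro N hN
    obtain ⟨k, hk, -, hkN⟩ := heven N hN 0
    refine (hP _ X (m (q k)) (h.holds _) (J (q k))
      ((h.isClopen _).isOpen.mem_nhds (h.mem _))).trans (mk_le_mk_of_subset ?_)
    rintro z ⟨hz, hzm⟩
    exact ⟨hkN hz, (hone (isLocal_anyMark hu) k hk z hz).2 hzm⟩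
  · have h1 : {z | HoldsOn (AnyMark u) F z} ⊆
        ⋃ i : ULift.{u} ℕ, ({z | z ∈ J (q i.down) ∧ AnyMark u X z} ∪ {e (q i.down)}) := by
      rintro z ⟨hz, k, hk⟩
      rcases hmark k z ⟨hz, hk⟩ with ⟨i, -, hi, hiX⟩ | ⟨i, -, hi, -⟩
      · exact mem_iUnion.2 ⟨⟨i⟩, .inl ⟨hi, k, hiX⟩⟩
      · exact mem_iUnion.2 ⟨⟨i⟩, .inr hi⟩
    refine (mk_le_mk_of_subset h1).trans ((mk_iUnion_le _).trans ?_)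
    have h2 : ∀ i : ULift.{u} ℕ,
        #({z | z ∈ J (q i.down) ∧ AnyMark u X z} ∪ {e (q i.down)} : Set X) ≤ δ := by
      intro i
      refine (mk_union_le _ _).trans (add_le_of_le hδ (h.count _) ?_)
      rw [mk_singleton]
      exact one_lt_aleph0.le.trans hδ
    exact (mul_le_mul' (by simpa using hδ) (ciSup_le' h2)).trans (mul_eq_self hδ).le
  · intro k hk
    refine (rich_iff hu).2 ⟨hyF, fun N hN => ?_⟩
    obtain ⟨i, hi, -, hiN⟩ := heven N hN 0
    have h1 := (hone (isLocal_rich k) i hi _ (h.mem _)).2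
      (h.rich _ X _ (h.holds (q i)) k (hk.trans (Nat.lt_succ_self n)))
    exact ((rich_iff hu).1 h1).2 N (mem_of_superset
      ((h.isClopen _).isOpen.mem_nhds (h.mem _)) hiN)
  · intro z k hk hz
    rcases hmark k z hz with ⟨i, -, hi, hiX⟩ | ⟨i, -, -, rfl⟩
    · exact h.not_mark _ z hi k (hk.trans (Nat.lt_succ_self n)) hiX
    · exact lt_irrefl _ hk
  · intro j z hz
    rcases mem_pointedUnion.1 hz.mem with rfl | ⟨i, -, hi⟩
    · exfalso
      obtain ⟨-, N, hN, h3⟩ := holdsOn_exists_near_iff.1 (holdsOn_and_iff.1 hz).2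
      obtain ⟨k, hk, -, hkN⟩ := heven N hN 0
      obtain ⟨k', hk', hlt, hkN'⟩ := heven N hN k
      have h4 : ∀ k, Even k → J (q k) ⊆ N → q k = j := by
        intro k hk hkN
        have h5 := (hone (h.isLocal _) k hk _ (h.mem _)).2 (h.holds (q k))
        exact (h3 _ (hkN (h.mem _)) h5.mem).2 _ h5.2
      exact hlt.ne (hqi ((h4 k hk hkN).trans (h4 k' hk' hkN').symm))
    · by_cases hie : Even i
      · rw [hKe i hie] at hi
        have := h.eq_of_holds _ j z hi ((hone (isLocal_solo h.isLocal j) i hie z hi).1 hz).1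
        exact ⟨s i, this.symm⟩
      · exfalso
        rw [hKo i hie] at hi
        obtain ⟨h1, h2⟩ := (hono (isLocal_solo h.isLocal j) i hie z hi).1 hz
        have h3 := hP j _ _ h2.1 Set.univ univ_mem
        have h4 : #{w | w ∈ Set.univ ∧ AnyMark u (E (q i)) w} ≤ 1 := by
          refine mk_le_one_iff_set_subsingleton.2 ?_
          rintro a ⟨-, k, ha⟩ b ⟨-, l, hb⟩
          have ha' := ((he _ _ _).1 ((holdsOn_coe a).2 ha)).2
          have hb' := ((he _ _ _).1 ((holdsOn_coe b).2 hb)).2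
          exact Subtype.ext (ha'.trans hb'.symm)
        exact (one_lt_aleph0.trans_le (hδ.trans (h3.trans h4))).false
  · intro N hN
    obtain ⟨k, hk, -, hkN⟩ := heven N hN 0
    exact ⟨m (q k), hkN (h.mem _), s k,
      (hone (isLocal_solo h.isLocal _) k hk _ (h.mem _)).2 (h.toSeparatedFamily.solo (q k))⟩

theorem HasMarkedFamily.step (hCO : IsCOSpace X) (hu : ∀ i, IsLocal (u i)) {β : Cardinal.{u}}
    (hβ : ℵ₀ < β) (h : ∀ δ, ℵ₀ ≤ δ → δ < β → HasMarkedFamily X u (n + 1) δ) :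
    HasMarkedFamily X u n β := by
  let D : Type u := Shrink.{u} (Set.Ico ℵ₀ β)
  let d : D → Cardinal.{u} := fun i => ((equivShrink (Set.Ico ℵ₀ β)).symm i).1
  have hd : ∀ i, ℵ₀ ≤ d i ∧ d i < β := fun i => ((equivShrink (Set.Ico ℵ₀ β)).symm i).2
  have hdinj : d.Injective := fun i j hij =>
    (equivShrink (Set.Ico ℵ₀ β)).symm.injective (Subtype.ext hij)
  have hdsurj : ∀ δ, ℵ₀ ≤ δ → δ < β → ∃ i, d i = δ := fun δ h1 h2 =>
    ⟨equivShrink (Set.Ico ℵ₀ β) ⟨δ, h1, h2⟩, by simp [d]⟩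
  choose I P J m hI hJ hP using fun i => (h (d i) (hd i).1 (hd i).2).succ hCO hu (hd i).1
  have hg : ∀ i, ∃ g : I i × ℕ → I i, g.Injective := by
    intro i
    have h1 : ℵ₀ ≤ #(I i) := (hd i).1.trans (hI i).le
    have h2 : lift.{u} #(I i × ℕ) ≤ lift.{u} #(I i) := by
      simp [mul_aleph0_eq h1]
    obtain ⟨g⟩ := lift_mk_le'.1 h2
    exact ⟨g, g.injective⟩
  choose g hg using hg
  choose F y hF hyF hacc hacc' hlc hcount hrich hmark hsolo hsolo' using
    fun (i : D) (a : I i) => (hJ i).exists_sequence hu (hd i).1 (hP i) (q₀ := fun k => g i (a, k))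
      (fun k l hkl => congrArg Prod.snd (hg i hkl))
  have hT : β ≤ #(Σ i, I i) := by
    by_contra! hlt
    obtain ⟨i, hi⟩ := hdsurj (max ℵ₀ #(Σ i, I i)) (le_max_left _ _) (max_lt hβ hlt)
    have h1 : #(I i) ≤ #(Σ i, I i) := mk_le_of_injective (f := Sigma.mk i) sigma_mk_injective
    exact ((h1.trans (le_max_right ℵ₀ _)).trans hi.ge).not_gt (hI i)
  obtain ⟨S, hS⟩ := le_mk_iff_exists_set.1 hT
  obtain ⟨J', m', hJ'⟩ := exists_markedFamily (n := n) (β := β) hCO hu (ι := S)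
    (P := fun p Y _ y => (∀ N ∈ 𝓝 y, ∃ z ∈ N, ∃ k, Solo (P p.1.1) (g p.1.1 (p.1.2, k)) Y z) ∧
      (∀ N ∈ 𝓝 y, ∃ z ∈ N, z ≠ y ∧ Mark u n Y z) ∧
      (∀ N ∈ 𝓝 y, d p.1.1 ≤ #{z | z ∈ N ∧ AnyMark u Y z}) ∧
      (∃ N ∈ 𝓝 y, #{z | z ∈ N ∧ AnyMark u Y z} ≤ d p.1.1) ∧ ∀ k, k < n → Rich u k Y y)
    (F := fun p => F p.1.1 p.1.2) (x := fun p => y p.1.1 p.1.2)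
    (fun p => isLocal_and (isLocal_forall_near (isLocal_exists fun k =>
        isLocal_solo (hJ _).isLocal _)) (isLocal_and (isLocal_accumulation (isLocal_mark hu n))
      (isLocal_and (isLocal_le_count (isLocal_anyMark hu) _) (isLocal_and
        (isLocal_count_le (isLocal_anyMark hu) _)
        (isLocal_forall fun k => isLocal_forall fun _ => isLocal_rich k)))))
    (fun p => hF _ _)
    (fun p => by
      refine holdsOn_and_iff.2 ⟨holdsOn_forall_near_iff.2 ⟨hyF _ _, fun N hN => ?_⟩,
        holdsOn_and_iff.2 ⟨holdsOn_accumulation_iff.2 ⟨hyF _ _, hacc _ _⟩, holdsOn_and_iff.2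
        ⟨holdsOn_le_count_iff.2 ⟨hyF _ _, hlc _ _⟩, holdsOn_and_iff.2 ⟨holdsOn_count_le_iff.2
        ⟨hyF _ _, Set.univ, univ_mem, ?_⟩, hyF _ _, fun k hk => (hrich _ _ k hk).2⟩⟩⟩⟩
      · obtain ⟨z, hz, k, hk, hk'⟩ := hsolo' p.1.1 p.1.2 N hN
        exact ⟨z, hz, hk, k, hk'⟩
      · simpa using hcount p.1.1 p.1.2)
    (by
      rintro ⟨⟨i, a⟩, hp⟩ ⟨⟨j, b⟩, hp'⟩ z hz
      obtain ⟨h1, hz⟩ := holdsOn_and_iff.1 hz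
      obtain ⟨h2, hz⟩ := holdsOn_and_iff.1 hz
      obtain ⟨h3, hz⟩ := holdsOn_and_iff.1 hz
      obtain ⟨h4, -⟩ := holdsOn_and_iff.1 hz
      obtain ⟨hzF, h2⟩ := holdsOn_accumulation_iff.1 h2
      obtain rfl := hacc' i a z h2 hzF
      have h5 : d j ≤ d i := by
        refine ((holdsOn_le_count_iff.1 h3).2 Set.univ univ_mem).trans ?_
        simpa using hcount i a
      have h6 : d i ≤ d j := by
        obtain ⟨-, N, hN, h6⟩ := holdsOn_count_le_iff.1 h4
        exact (hlc i a N hN).trans h6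
      obtain rfl := hdinj (le_antisymm h5 h6)
      obtain ⟨-, h1⟩ := holdsOn_forall_near_iff.1 h1
      obtain ⟨w, -, hw, k, hk⟩ := h1 Set.univ univ_mem
      obtain ⟨l, hl⟩ := hsolo _ a _ w ⟨hw, hk⟩
      have h7 : a = b := congrArg Prod.fst (hg _ hl)
      subst h7
      rfl)
    (fun p => hmark _ _)
    (fun p => (hcount _ _).trans (hd _).2.le)
    (fun p Y _ y hy N hN => by
      obtain ⟨z, hz, -, h⟩ := hy.2.1 N hN
      exact ⟨z, hz, n, h⟩)
    (fun p Y _ y hy => hy.2.2.2.2)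
  exact ⟨S, _, J', m', hS, hJ'⟩

/-- In a compact linearly ordered CO space there is no infinite sequence of local classes, each
realized in a closed set that realizes no other class of the sequence. -/
theorem not_independent (hCO : IsCOSpace X) {P : ℕ → PointClass.{u}} (hP : ∀ i, IsLocal (P i))
    {F : ℕ → Set X} (hF : ∀ i, IsClosed (F i)) {x : ℕ → X}
    (hx : ∀ i, HoldsOn (P i) (F i) (x i)) (hind : ∀ i j y, HoldsOn (P j) (F i) y → j = i) :
    False := by
  obtain ⟨J, m, h, -⟩ := exists_separatedFamily hCO hP hF hx hind
  obtain ⟨s, O, y, hs, hO, hJO⟩ := h.exists_shrinksTo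
  have h' := h.comp hs.injective
  have hex : ∀ n, ∃ β, ℵ₀ ≤ β ∧ ¬ HasMarkedFamily X (P ∘ s) n β := fun n =>
    ⟨max ℵ₀ (Order.succ #X), le_max_left _ _, fun hm =>
      ((Order.lt_succ #X).trans_le (le_max_right ℵ₀ _)).not_ge hm.le⟩
  let b : ℕ → Cardinal.{u} := fun n => sInf {β | ℵ₀ ≤ β ∧ ¬ HasMarkedFamily X (P ∘ s) n β}
  have hb : ∀ n, ℵ₀ ≤ b n ∧ ¬ HasMarkedFamily X (P ∘ s) n (b n) := fun n => csInf_mem (hex n)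
  have hmin : ∀ n β, ℵ₀ ≤ β → β < b n → HasMarkedFamily X (P ∘ s) n β := by
    intro n β h1 h2
    by_contra h3
    exact h2.not_ge (csInf_le' ⟨h1, h3⟩)
  have hlt : ∀ n, b (n + 1) < b n := by
    intro n
    by_contra! hle
    rcases (hb n).1.eq_or_lt with h1 | h1
    · exact (hb n).2 (h1 ▸ hasMarkedFamily_aleph0 hCO h' hO hJO n)
    · exact (hb n).2 (HasMarkedFamily.step hCO (fun i => h'.isLocal i) h1 fun δ h2 h3 =>
        hmin (n + 1) δ h2 (h3.trans_le hle))
  obtain ⟨n, hn⟩ := WellFounded.not_rel_apply_succ (r := (· < ·)) b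
  exact hn (hlt n)

end marked_sequence

section order_compactness

variable {T : Type*} [LinearOrder T] [TopologicalSpace T] [OrderTopology T]

theorem isCompact_Iic_of_isWF {x : T} (h : (Iic x).IsWF) : IsCompact (Iic x) := by
  by_contra hx
  have hne : {y ∈ Iic x | ¬ IsCompact (Iic y)}.Nonempty := ⟨x, self_mem_Iic, hx⟩
  have hwf : {y ∈ Iic x | ¬ IsCompact (Iic y)}.IsWF := h.mono (sep_subset _ _)
  obtain ⟨y, ⟨hyx, hy⟩, hmin⟩ : ∃ y ∈ {y ∈ Iic x | ¬ IsCompact (Iic y)},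
      ∀ z ∈ {y ∈ Iic x | ¬ IsCompact (Iic y)}, y ≤ z :=
    ⟨hwf.min hne, hwf.min_mem hne, fun z hz => hwf.min_le hne hz⟩
  refine hy fun f hf hfle => ?_
  by_cases hex : ∃ z < y, (f ⊓ 𝓟 (Iic z)).NeBot
  · obtain ⟨z, hz, hfz⟩ := hex
    have hzc : IsCompact (Iic z) := by
      by_contra hc
      exact (hmin z ⟨hz.le.trans hyx, hc⟩).not_gt hz
    obtain ⟨p, hp, hcl⟩ := hzc (f := f ⊓ 𝓟 (Iic z)) inf_le_right
    exact ⟨p, le_trans hp hz.le, hcl.mono inf_le_left⟩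
  · push Not at hex
    refine ⟨y, self_mem_Iic, ?_⟩
    have hle : f ≤ 𝓝 y := by
      rw [nhds_eq_order]
      refine le_inf (le_iInf₂ fun z hz => ?_) (le_iInf₂ fun z hz => ?_)
      · rw [le_principal_iff, ← compl_Iic]
        exact mem_iff_inf_principal_compl.2 (by simpa using hex z hz)
      · rw [le_principal_iff]
        exact mem_of_superset (le_principal_iff.1 hfle) fun a ha => lt_of_le_of_lt ha hz
    exact ClusterPt.of_le_nhds hle

theorem isLUB_of_mapClusterPt {c : ℕ → T} (hc : Monotone c) {p : T}
    (hp : MapClusterPt p atTop c) : IsLUB (range c) p := by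
  rw [mapClusterPt_iff_frequently] at hp
  refine ⟨?_, fun a ha => ?_⟩
  · rintro _ ⟨k, rfl⟩
    by_contra hk
    obtain ⟨n, hn, hkn⟩ := ((hp _ (Iio_mem_nhds (not_le.1 hk))).and_eventually
      (eventually_ge_atTop k)).exists
    exact (hc hkn).not_gt hn
  · by_contra hk
    obtain ⟨n, hn⟩ := (hp _ (Ioi_mem_nhds (not_le.1 hk))).exists
    exact (ha ⟨n, rfl⟩).not_gt hn

end order_compactness

namespace DoubleOrd

variable {lam mu : Cardinal.{u}}

/-- The points below the meeting point. -/
noncomputable def left (a : lam.ord.ToType) : DoubleOrd lam mu := toLex (Sum.inl (a : WithTop _))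

/-- The point at which the two parts meet. -/
noncomputable def mid : DoubleOrd lam mu := toLex (Sum.inl ⊤)

/-- The points above the meeting point. -/
noncomputable def right (b : mu.ord.ToType) : DoubleOrd lam mu := toLex (Sum.inr (OrderDual.toDual b))

theorem cases_on {p : DoubleOrd lam mu → Prop} (hl : ∀ a, p (left a)) (hm : p mid)
    (hr : ∀ b, p (right b)) (x : DoubleOrd lam mu) : p x := by
  rcases x with x | x
  · induction x using WithTop.recTopCoe with
    | top => exact hm
    | coe a => exact hl a
  · exact hr x

@[simp] theorem left_lt_left {a b : lam.ord.ToType} :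
    (left a : DoubleOrd lam mu) < left b ↔ a < b :=
  Sum.Lex.inl_lt_inl_iff.trans WithTop.coe_lt_coe

@[simp] theorem right_lt_right {a b : mu.ord.ToType} :
    (right a : DoubleOrd lam mu) < right b ↔ b < a :=
  Sum.Lex.inr_lt_inr_iff

@[simp] theorem left_lt_mid (a : lam.ord.ToType) : (left a : DoubleOrd lam mu) < mid :=
  Sum.Lex.inl_lt_inl_iff.2 (WithTop.coe_lt_top a)

@[simp] theorem mid_lt_right (b : mu.ord.ToType) : (mid : DoubleOrd lam mu) < right b :=
  Sum.Lex.inl_lt_inr _ _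

@[simp] theorem left_lt_right (a : lam.ord.ToType) (b : mu.ord.ToType) :
    (left a : DoubleOrd lam mu) < right b :=
  Sum.Lex.inl_lt_inr _ _

theorem strictMono_left : StrictMono (left : _ → DoubleOrd lam mu) := fun _ _ h => left_lt_left.2 h

theorem strictAnti_right : StrictAnti (right : _ → DoubleOrd lam mu) :=
  fun _ _ h => right_lt_right.2 h

theorem exists_left_of_lt_mid {x : DoubleOrd lam mu} (h : x < mid) : ∃ a, x = left a := by
  induction x using cases_on with
  | hl a => exact ⟨a, rfl⟩
  | hm => exact absurd h (lt_irrefl _)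
  | hr b => exact absurd h (mid_lt_right b).not_gt

theorem exists_right_of_mid_lt {x : DoubleOrd lam mu} (h : mid < x) : ∃ a, x = right a := by
  induction x using cases_on with
  | hl a => exact absurd h (left_lt_mid a).not_gt
  | hm => exact absurd h (lt_irrefl _)
  | hr b => exact ⟨b, rfl⟩

theorem isWF_Iic_mid : (Iic (mid : DoubleOrd lam mu)).IsWF := by
  have h : Iic (mid : DoubleOrd lam mu) = insert mid (left '' Set.univ) := by
    ext x
    induction x using cases_on with
    | hl a => simp [(left_lt_mid (mu := mu) a).le]
    | hm => simp
    | hr b => simp [(mid_lt_right (lam := lam) b).not_ge, (mid_lt_right (lam := lam) b).ne',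
        (left_lt_right (lam := lam) (mu := mu) _ b).ne]
  rw [h]
  exact ((Set.isWF_univ_iff.2 inferInstance).isPWO.image_of_monotone
    strictMono_left.monotone).isWF.insert _

theorem isWF_Ici_mid :
    (OrderDual.ofDual ⁻¹' Ici (mid : DoubleOrd lam mu) : Set (DoubleOrd lam mu)ᵒᵈ).IsWF := by
  have h : (OrderDual.ofDual ⁻¹' Ici (mid : DoubleOrd lam mu) : Set (DoubleOrd lam mu)ᵒᵈ) =
      insert (OrderDual.toDual mid) ((OrderDual.toDual ∘ right) '' Set.univ) := by
    ext x
    have key : ∀ x : DoubleOrd lam mu, mid ≤ x ↔ x = mid ∨ ∃ b, right b = x := by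
      intro x
      induction x using cases_on with
      | hl a => simp [(left_lt_mid (mu := mu) a).not_ge, (left_lt_mid (mu := mu) a).ne,
          (left_lt_right (lam := lam) (mu := mu) a _).ne']
      | hm => simp
      | hr b => simp [(mid_lt_right (lam := lam) b).le]
    simp only [mem_preimage, mem_Ici, mem_insert_iff, mem_image, mem_univ, true_and]
    exact key x
  rw [h]
  exact ((Set.isWF_univ_iff.2 inferInstance).isPWO.image_of_monotone
    (strictAnti_right.dual_right).monotone).isWF.insert _

theorem isCompact_Ici_mid : IsCompact (Ici (mid : DoubleOrd lam mu)) :=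
  isCompact_Iic_of_isWF (T := (DoubleOrd lam mu)ᵒᵈ) (x := OrderDual.toDual mid) isWF_Ici_mid

instance : CompactSpace (DoubleOrd lam mu) := by
  refine ⟨?_⟩
  rw [← Iic_union_Ici (a := (mid : DoubleOrd lam mu))]
  exact (isCompact_Iic_of_isWF isWF_Iic_mid).union isCompact_Ici_mid

/-- The map between double orders induced by maps of the two parts. -/
noncomputable def map {lam' mu' : Cardinal.{u}} (φ : lam.ord.ToType → lam'.ord.ToType)
    (ψ : mu.ord.ToType → mu'.ord.ToType) (x : DoubleOrd lam mu) : DoubleOrd lam' mu' :=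
  Sum.elim (fun t => toLex (Sum.inl (WithTop.map φ t))) (fun b => right (ψ (OrderDual.ofDual b)))
    (ofLex x)

section map

variable {lam' mu' : Cardinal.{u}} {φ : lam.ord.ToType → lam'.ord.ToType}
  {ψ : mu.ord.ToType → mu'.ord.ToType}

theorem strictMono_map (hφ : StrictMono φ) (hψ : StrictMono ψ) : StrictMono (map φ ψ) := by
  intro x y hxy
  induction x using cases_on with
  | hl a =>
    induction y using cases_on with
    | hl b => exact left_lt_left.2 (hφ (left_lt_left.1 hxy))
    | hm => exact left_lt_mid _
    | hr b => exact left_lt_right _ _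
  | hm =>
    induction y using cases_on with
    | hl b => exact absurd hxy (left_lt_mid b).not_gt
    | hm => exact absurd hxy (lt_irrefl _)
    | hr b => exact mid_lt_right _
  | hr a =>
    induction y using cases_on with
    | hl b => exact absurd hxy (left_lt_right b a).not_gt
    | hm => exact absurd hxy (mid_lt_right a).not_gt
    | hr b => exact right_lt_right.2 (hψ (right_lt_right.1 hxy))

theorem range_map {a : lam'.ord.ToType} {b : mu'.ord.ToType} (hφ : range φ = Ioi a)
    (hψ : range ψ = Ioi b) : range (map φ ψ) = Ioo (left a) (right b) := by
  ext y
  constructor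
  · rintro ⟨x, rfl⟩
    induction x using cases_on with
    | hl c => exact ⟨left_lt_left.2 (hφ ▸ mem_range_self c : φ c ∈ Ioi a), left_lt_right _ _⟩
    | hm => exact ⟨left_lt_mid _, mid_lt_right _⟩
    | hr c => exact ⟨left_lt_right _ _, right_lt_right.2 (hψ ▸ mem_range_self c : ψ c ∈ Ioi b)⟩
  · rintro ⟨h1, h2⟩
    induction y using cases_on with
    | hl c =>
      obtain ⟨d, rfl⟩ : c ∈ range φ := hφ ▸ left_lt_left.1 h1
      exact ⟨left d, rfl⟩
    | hm => exact ⟨mid, rfl⟩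
    | hr c =>
      obtain ⟨d, rfl⟩ : c ∈ range ψ := hψ ▸ right_lt_right.1 h2
      exact ⟨right d, rfl⟩

end map

theorem mk_Ioi_toType {c : Cardinal.{u}} (hc : ℵ₀ ≤ c) (a : c.ord.ToType) : #(Ioi a) = c := by
  have h1 : #(Iic a) < c := by
    rw [← Iio_insert]
    refine mk_insert_le.trans_lt (add_lt_of_lt hc ?_ (one_lt_aleph0.trans_le hc))
    simpa using mk_Iio_lt a
  have h2 : #(Ioi a) ≤ c := (mk_set_le _).trans (mk_ord_toType c).le
  by_contra hne
  have h3 : #(Iic a ∪ Ioi a : Set c.ord.ToType) < c :=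
    (mk_union_le _ _).trans_lt (add_lt_of_lt hc h1 (lt_of_le_of_ne h2 hne))
  rw [Iic_union_Ioi, mk_univ, mk_ord_toType] at h3
  exact lt_irrefl _ h3

/-- Proper final segments of an infinite initial ordinal are isomorphic to it. -/
theorem exists_strictMono_range_eq_Ioi {c : Cardinal.{u}} (hc : ℵ₀ ≤ c) (a : c.ord.ToType) :
    ∃ φ : c.ord.ToType → c.ord.ToType, StrictMono φ ∧ range φ = Ioi a := by
  have h1 : Ordinal.type (α := Ioi a) (· < ·) = Ordinal.type (α := c.ord.ToType) (· < ·) := by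
    apply le_antisymm
    · exact Ordinal.type_le_iff'.2 ⟨⟨Function.Embedding.subtype _, Iff.rfl⟩⟩
    · rw [Ordinal.type_toType]
      exact (congrArg ord (mk_Ioi_toType hc a)).ge.trans (ord_le_type _)
  obtain ⟨e⟩ := Ordinal.type_eq.1 h1
  refine ⟨fun x => (e.symm x : c.ord.ToType), fun x y hxy => e.symm.map_rel_iff.2 hxy, ?_⟩
  ext x
  constructor
  · rintro ⟨y, rfl⟩
    exact (e.symm y).2
  · intro hx
    exact ⟨e ⟨x, hx⟩, by simp⟩

theorem exists_Ioo_subset (hl : ℵ₀ ≤ lam) (hm : ℵ₀ ≤ mu) {N : Set (DoubleOrd lam mu)} (hN : N ∈ 𝓝 mid) :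
    ∃ a b, Ioo (left a) (right b) ⊆ N := by
  have := noMaxOrder hl
  have hnl : Nonempty lam.ord.ToType := by
    rw [← mk_ne_zero_iff, mk_ord_toType]
    exact (aleph0_pos.trans_le hl).ne'
  have hnm : Nonempty mu.ord.ToType := by
    rw [← mk_ne_zero_iff, mk_ord_toType]
    exact (aleph0_pos.trans_le hm).ne'
  obtain ⟨x, y, ⟨hx, hy⟩, h⟩ := (mem_nhds_iff_exists_Ioo_subset' ⟨_, left_lt_mid hnl.some⟩
    ⟨_, mid_lt_right hnm.some⟩).1 hN
  obtain ⟨a, rfl⟩ := exists_left_of_lt_mid hx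
  obtain ⟨b, rfl⟩ := exists_right_of_mid_lt hy
  exact ⟨a, b, h⟩

theorem exists_left_mem (hl : ℵ₀ ≤ lam) (hm : ℵ₀ ≤ mu) {N : Set (DoubleOrd lam mu)} (hN : N ∈ 𝓝 mid) : ∃ a, left a ∈ N := by
  have := noMaxOrder hl
  obtain ⟨a, b, h⟩ := exists_Ioo_subset hl hm hN
  obtain ⟨c, hc⟩ := exists_gt a
  exact ⟨c, h ⟨left_lt_left.2 hc, left_lt_right _ _⟩⟩

theorem exists_right_mem (hl : ℵ₀ ≤ lam) (hm : ℵ₀ ≤ mu) {N : Set (DoubleOrd lam mu)} (hN : N ∈ 𝓝 mid) : ∃ b, right b ∈ N := by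
  have := noMaxOrder hm
  obtain ⟨a, b, h⟩ := exists_Ioo_subset hl hm hN
  obtain ⟨c, hc⟩ := exists_gt b
  exact ⟨c, h ⟨left_lt_right _ _, right_lt_right.2 hc⟩⟩

/-- Every neighbourhood of the meeting point contains a copy of the whole space. -/
theorem exists_isOpenEmbedding (hl : ℵ₀ ≤ lam) (hm : ℵ₀ ≤ mu) {N : Set (DoubleOrd lam mu)} (hN : N ∈ 𝓝 mid) :
    ∃ h : DoubleOrd lam mu → DoubleOrd lam mu, IsOpenEmbedding h ∧ h mid = mid ∧ range h ⊆ N := by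
  obtain ⟨a, b, hab⟩ := exists_Ioo_subset hl hm hN
  obtain ⟨φ, hφ, hφr⟩ := exists_strictMono_range_eq_Ioi hl a
  obtain ⟨ψ, hψ, hψr⟩ := exists_strictMono_range_eq_Ioi hm b
  have hr := range_map hφr hψr
  refine ⟨map φ ψ, ⟨(strictMono_map hφ hψ).isEmbedding_of_ordConnected ?_, ?_⟩, rfl, ?_⟩
  · rw [hr]
    exact ordConnected_Ioo
  · rw [hr]
    exact isOpen_Ioo
  · rw [hr]
    exact hab

theorem exists_isOpenEmbedding_of_pointGerm (hl : ℵ₀ ≤ lam) (hm : ℵ₀ ≤ mu) {Y : Type u} [TopologicalSpace Y] {y : Y}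
    (h : PointGerm (DoubleOrd lam mu) mid Y y) {N : Set Y} (hN : N ∈ 𝓝 y) :
    ∃ f : DoubleOrd lam mu → Y, IsOpenEmbedding f ∧ f mid = y ∧ range f ⊆ N := by
  obtain ⟨W, tW, w, i, j, hi, hj, rfl, hw⟩ := h
  have hN' : j '' (i ⁻¹' N) ∈ 𝓝 (mid : DoubleOrd lam mu) :=
    hw ▸ hj.isOpenMap.image_mem_nhds (hi.continuous.continuousAt hN)
  obtain ⟨g, hg, hgm, hgr⟩ := exists_isOpenEmbedding hl hm hN'
  have hk : ∀ x, ∃ v, i v ∈ N ∧ j v = g x := fun x => hgr ⟨x, rfl⟩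
  choose k hkN hk using hk
  have hjk : j ∘ k = g := funext hk
  have hko : IsOpenEmbedding k := IsOpenEmbedding.of_comp k hj (hjk ▸ hg)
  refine ⟨i ∘ k, hi.comp hko, ?_, ?_⟩
  · exact congrArg i (hj.injective ((hk mid).trans (hgm.trans hw.symm)))
  · rintro _ ⟨x, rfl⟩
    exact hkN x

end DoubleOrd

namespace DoubleOrd

variable {lam mu : Cardinal.{u}}

/-- A continuous injective map into a linear order, with well-ordered range, does not exist on a
double order with an upper part of uncountable cofinality. -/
theorem not_continuous_of_isWF (hl : ℵ₀ ≤ lam) (hm : ℵ₀ ≤ mu) (hcof : ℵ_ 1 ≤ mu.ord.cof)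
    {T : Type*} [LinearOrder T] [TopologicalSpace T] [OrderTopology T] {g : DoubleOrd lam mu → T}
    (hg : Continuous g) (hgi : g.Injective) (hwf : (range g).IsWF) : False := by
  have hle : ∀ᶠ z in 𝓝 (mid : DoubleOrd lam mu), g z ≤ g mid := by
    by_cases hex : (range g ∩ Ioi (g mid)).Nonempty
    · have hwf' := hwf.mono (inter_subset_left (t := Ioi (g mid)))
      have hmem := hwf'.min_mem hex
      filter_upwards [hg.continuousAt (Iio_mem_nhds hmem.2)] with z hz
      by_contra hlt
      exact (hwf'.min_le hex ⟨⟨z, rfl⟩, not_le.1 hlt⟩).not_gt hz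
    · exact Eventually.of_forall fun z => not_lt.1 fun hlt => hex ⟨g z, ⟨z, rfl⟩, hlt⟩
  have hA : ∀ t : Iio (g mid), ∃ a, g (left a) ∈ Ioo t.1 (g mid) := by
    intro t
    obtain ⟨a, ha⟩ := exists_left_mem hl hm (hle.and (hg.continuousAt (Ioi_mem_nhds t.2)))
    exact ⟨a, ha.2, lt_of_le_of_ne ha.1 (hgi.ne (left_lt_mid a).ne)⟩
  have hB : ∀ t : Iio (g mid), ∃ b, g (right b) ∈ Ioo t.1 (g mid) := by
    intro t
    obtain ⟨b, hb⟩ := exists_right_mem hl hm (hle.and (hg.continuousAt (Ioi_mem_nhds t.2)))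
    exact ⟨b, hb.2, lt_of_le_of_ne hb.1 (hgi.ne (mid_lt_right b).ne')⟩
  choose A hA using hA
  choose B hB using hB
  obtain ⟨t₀⟩ : Nonempty (Iio (g mid)) := by
    obtain ⟨a, ha⟩ := exists_left_mem hl hm hle
    exact ⟨⟨g (left a), lt_of_le_of_ne ha (hgi.ne (left_lt_mid a).ne)⟩⟩
  let nxtA : Iio (g mid) → Iio (g mid) := fun t => ⟨g (left (A t)), (hA t).2⟩
  let nxtB : Iio (g mid) → Iio (g mid) := fun t => ⟨g (right (B t)), (hB t).2⟩
  let x : ℕ → Iio (g mid) := fun n => (fun t => nxtB (nxtA t))^[n] t₀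
  have hx : ∀ n, x (n + 1) = nxtB (nxtA (x n)) := fun n => Function.iterate_succ_apply' _ _ _
  let α : ℕ → DoubleOrd lam mu := fun n => left (A (x n))
  let β : ℕ → DoubleOrd lam mu := fun n => right (B (nxtA (x n)))
  have h1 : ∀ n, g (α n) < g (β n) := fun n => (hB (nxtA (x n))).1
  have h2 : ∀ n, g (β n) < g (α (n + 1)) := by
    intro n
    have := (hA (x (n + 1))).1
    rw [hx] at this
    have h3 : α (n + 1) = left (A (nxtB (nxtA (x n)))) := by
      simp only [α, hx]
    rw [h3]
    exact this
  have hα : Monotone (g ∘ α) := monotone_nat_of_le_succ fun n => ((h1 n).trans (h2 n)).le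
  have hβ : Monotone (g ∘ β) := monotone_nat_of_le_succ fun n => ((h2 n).trans (h1 (n + 1))).le
  obtain ⟨a, -, ha⟩ := isCompact_univ (X := DoubleOrd lam mu) (f := Filter.map α atTop) (by simp)
  obtain ⟨b, -, hb⟩ := isCompact_univ (X := DoubleOrd lam mu) (f := Filter.map β atTop) (by simp)
  have hla := isLUB_of_mapClusterPt hα
    (MapClusterPt.continuousAt_comp hg.continuousAt (show MapClusterPt a atTop α from ha))
  have hlb := isLUB_of_mapClusterPt hβ
    (MapClusterPt.continuousAt_comp hg.continuousAt (show MapClusterPt b atTop β from hb))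
  have hab : a = b := by
    apply hgi
    apply le_antisymm
    · refine hla.2 ?_
      rintro _ ⟨n, rfl⟩
      exact (h1 n).le.trans (hlb.1 ⟨n, rfl⟩)
    · refine hlb.2 ?_
      rintro _ ⟨n, rfl⟩
      exact (h2 n).le.trans (hla.1 ⟨n + 1, rfl⟩)
  have ha' : a ≤ mid := by
    by_contra hlt
    obtain ⟨n, hn⟩ := (mapClusterPt_iff_frequently.1 (show MapClusterPt a atTop α from ha) _
      (Ioi_mem_nhds (not_le.1 hlt))).exists
    exact (left_lt_mid _).not_gt hn
  have hbd : ¬ IsCofinal (range fun n => B (nxtA (x n))) := by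
    intro hc
    have h3 := Order.cof_le hc
    rw [Ordinal.cof_toType] at h3
    have h4 : ℵ_ 1 ≤ ℵ₀ := hcof.trans (h3.trans (countable_range _).le_aleph0)
    exact aleph0_lt_aleph_one.not_ge h4
  obtain ⟨c, hc⟩ := not_isCofinal_iff.1 hbd
  have hb' : right c ≤ b := by
    by_contra hlt
    obtain ⟨n, hn⟩ := (mapClusterPt_iff_frequently.1 (show MapClusterPt b atTop β from hb) _
      (Iio_mem_nhds (not_le.1 hlt))).exists
    exact (right_lt_right.2 (hc _ ⟨n, rfl⟩)).not_gt hn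
  exact ((mid_lt_right c).trans_le (hb'.trans (hab ▸ ha'))).false

theorem exists_nhds_mk_lt (hl : ℵ₀ ≤ lam) (hm : ℵ₀ ≤ mu) {q : DoubleOrd lam mu} (hq : q ≠ mid) :
    ∃ N ∈ 𝓝 q, #N < max lam mu := by
  have key : ∀ {c : Cardinal.{u}}, ℵ₀ ≤ c → ∀ a : c.ord.ToType, #(Iio a) < c := by
    intro c _ a
    simpa using mk_Iio_lt a
  induction q using cases_on with
  | hl a =>
    have := noMaxOrder hl
    obtain ⟨b, hb⟩ := exists_gt a
    refine ⟨Iio (left b), Iio_mem_nhds (left_lt_left.2 hb), ?_⟩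
    have h : Iio (left b : DoubleOrd lam mu) ⊆ left '' Iio b := by
      intro x hx
      obtain ⟨a, rfl⟩ := exists_left_of_lt_mid (lt_trans hx (left_lt_mid b))
      exact ⟨a, left_lt_left.1 hx, rfl⟩
    exact ((mk_le_mk_of_subset h).trans mk_image_le).trans_lt
      ((key hl b).trans_le (le_max_left _ _))
  | hm => exact absurd rfl hq
  | hr a =>
    have := noMaxOrder hm
    obtain ⟨b, hb⟩ := exists_gt a
    refine ⟨Ioi (right b), Ioi_mem_nhds (right_lt_right.2 hb), ?_⟩
    have h : Ioi (right b : DoubleOrd lam mu) ⊆ right '' Iio b := by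
      intro x hx
      obtain ⟨a, rfl⟩ := exists_right_of_mid_lt ((mid_lt_right b).trans hx)
      exact ⟨a, right_lt_right.1 hx, rfl⟩
    exact ((mk_le_mk_of_subset h).trans mk_image_le).trans_lt
      ((key hm b).trans_le (le_max_right _ _))

/-- The closed half of the double order that belongs to the larger cardinal. -/
def heavyHalf (lam mu : Cardinal.{u}) : Set (DoubleOrd lam mu) :=
  {x | (mu ≤ lam ∧ x ≤ mid) ∨ (lam < mu ∧ mid ≤ x)}

theorem heavyHalf_cases : heavyHalf lam mu = Iic mid ∨ heavyHalf lam mu = Ici mid := by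
  rcases le_or_gt mu lam with h | h
  · left
    ext x
    simp [heavyHalf, h, h.not_gt]
  · right
    ext x
    simp [heavyHalf, h, h.not_ge]

theorem isClosed_heavyHalf : IsClosed (heavyHalf lam mu) := by
  rcases heavyHalf_cases (lam := lam) (mu := mu) with h | h <;> rw [h]
  · exact isClosed_Iic
  · exact isClosed_Ici

theorem mid_mem_heavyHalf : (mid : DoubleOrd lam mu) ∈ heavyHalf lam mu := by
  rcases heavyHalf_cases (lam := lam) (mu := mu) with h | h <;> rw [h]
  · exact self_mem_Iic
  · exact self_mem_Ici

theorem le_mk_heavyHalf_inter (hl : ℵ₀ ≤ lam) (hm : ℵ₀ ≤ mu) {N : Set (DoubleOrd lam mu)}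
    (hN : N ∈ 𝓝 mid) : max lam mu ≤ #(N ∩ heavyHalf lam mu : Set (DoubleOrd lam mu)) := by
  obtain ⟨a, b, hab⟩ := exists_Ioo_subset hl hm hN
  rcases le_or_gt mu lam with h | h
  · rw [max_eq_left h]
    refine ((mk_Ioi_toType hl a).ge.trans (mk_image_eq (strictMono_left (mu := mu)).injective).ge).trans
      (mk_le_mk_of_subset ?_)
    rintro _ ⟨c, hc, rfl⟩
    exact ⟨hab ⟨left_lt_left.2 hc, left_lt_right _ _⟩, .inl ⟨h, (left_lt_mid c).le⟩⟩
  · rw [max_eq_right h.le]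
    refine ((mk_Ioi_toType hm b).ge.trans
      (mk_image_eq (strictAnti_right (lam := lam)).injective).ge).trans (mk_le_mk_of_subset ?_)
    rintro _ ⟨c, hc, rfl⟩
    exact ⟨hab ⟨left_lt_right _ _, right_lt_right.2 hc⟩, .inr ⟨h, (mid_lt_right c).le⟩⟩

section germs

variable {lam' mu' : Cardinal.{u}}

theorem not_continuous_of_range_subset (hl : ℵ₀ ≤ lam) (hm : ℵ₀ ≤ mu)
    (hcof : ℵ_ 1 ≤ mu.ord.cof) {g : DoubleOrd lam mu → DoubleOrd lam' mu'} (hg : Continuous g)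
    (hgi : g.Injective) : ¬ (range g ⊆ Iic mid ∨ range g ⊆ Ici mid) := by
  rintro (h | h)
  · exact not_continuous_of_isWF hl hm hcof hg hgi (isWF_Iic_mid.mono h)
  · refine not_continuous_of_isWF hl hm hcof (T := (DoubleOrd lam' mu')ᵒᵈ)
      (g := OrderDual.toDual ∘ g) (continuous_toDual.comp hg) hgi (isWF_Ici_mid.mono ?_)
    rintro _ ⟨x, rfl⟩
    exact h ⟨x, rfl⟩

/-- The germ of a double order occurs in a double order only at the meeting point. -/
theorem eq_mid_of_pointGerm (hl : ℵ₀ ≤ lam) (hm : ℵ₀ ≤ mu) (hcof : ℵ_ 1 ≤ mu.ord.cof)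
    {q : DoubleOrd lam' mu'} (h : PointGerm (DoubleOrd lam mu) mid (DoubleOrd lam' mu') q) :
    q = mid := by
  rcases lt_trichotomy q mid with hq | hq | hq
  · obtain ⟨f, hf, -, hfr⟩ := exists_isOpenEmbedding_of_pointGerm hl hm h (Iio_mem_nhds hq)
    exact absurd (.inl (hfr.trans Iio_subset_Iic_self))
      (not_continuous_of_range_subset hl hm hcof hf.continuous hf.injective)
  · exact hq
  · obtain ⟨f, hf, -, hfr⟩ := exists_isOpenEmbedding_of_pointGerm hl hm h (Ioi_mem_nhds hq)
    exact absurd (.inr (hfr.trans Ioi_subset_Ici_self))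
      (not_continuous_of_range_subset hl hm hcof hf.continuous hf.injective)

theorem not_holdsOn_heavyHalf (hl : ℵ₀ ≤ lam) (hm : ℵ₀ ≤ mu) (hcof : ℵ_ 1 ≤ mu.ord.cof)
    (q : DoubleOrd lam' mu') :
    ¬ HoldsOn (PointGerm (DoubleOrd lam mu) mid) (heavyHalf lam' mu') q := by
  rintro ⟨hq, h⟩
  obtain ⟨f, hf, -, -⟩ := exists_isOpenEmbedding_of_pointGerm hl hm h univ_mem
  refine not_continuous_of_range_subset hl hm hcof (continuous_subtype_val.comp hf.continuous)
    (Subtype.val_injective.comp hf.injective) ?_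
  rcases heavyHalf_cases (lam := lam') (mu := mu') with h | h
  · left
    rintro _ ⟨x, rfl⟩
    exact h ▸ (f x).2
  · right
    rintro _ ⟨x, rfl⟩
    exact h ▸ (f x).2

end germs

end DoubleOrd

section endpoint

open CantorBendixson

theorem iteratedDerivedSet_image {Y Z : Type u} [TopologicalSpace Y] [TopologicalSpace Z]
    {h : Y → Z} (hc : Continuous h) (hi : h.Injective) (a : Ordinal.{u}) :
    MapsTo h (iteratedDerivedSet (Set.univ : Set Y) a)
      (iteratedDerivedSet (Set.univ : Set Z) a) := by
  induction a using Ordinal.limitRecOn with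
  | zero => simp [mapsTo_univ]
  | add_one a ih =>
    simp only [iteratedDerivedSet_succ]
    rintro x ⟨hx, hx'⟩
    refine ⟨?_, ih hx'⟩
    rw [mem_derivedSet] at hx ⊢
    refine (hx.map hc.continuousAt hi).mono ?_
    rw [map_principal]
    exact principal_mono.2 ih.image_subset
  | limit a ha ih =>
    rw [iteratedDerivedSet_limit ha, iteratedDerivedSet_limit ha]
    intro x hx
    rw [mem_iInter] at hx ⊢
    exact fun b => ih b b.2 (hx b)

theorem IsEndPoint.eq_mid {lam mu : Cardinal.{u}} (hl : ℵ₀ ≤ lam) (hm : ℵ₀ ≤ mu)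
    {e : DoubleOrd lam mu} (he : IsEndPoint e) : e = DoubleOrd.mid := by
  have key : ∀ a ≤ cbRank (DoubleOrd lam mu),
      DoubleOrd.mid ∈ iteratedDerivedSet (Set.univ : Set (DoubleOrd lam mu)) a := by
    intro a
    induction a using Ordinal.limitRecOn with
    | zero => simp
    | add_one a ih =>
      intro ha
      have hlt : a < cbRank (DoubleOrd lam mu) := lt_of_lt_of_le (lt_add_one a) ha
      have h1 := notMem_of_lt_csInf' hlt
      have hinf : (iteratedDerivedSet (Set.univ : Set (DoubleOrd lam mu)) a).Infinite :=
        fun hfin => h1 (.inl hfin)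
      rw [iteratedDerivedSet_succ]
      refine ⟨?_, ih hlt.le⟩
      obtain ⟨p, hp, hpm⟩ := hinf.exists_notMem_finite (finite_singleton DoubleOrd.mid)
      change AccPt _ _
      rw [accPt_iff_nhds]
      intro N hN
      obtain ⟨h, hh, hhm, hhr⟩ := DoubleOrd.exists_isOpenEmbedding hl hm hN
      refine ⟨h p, ⟨hhr ⟨p, rfl⟩, iteratedDerivedSet_image hh.continuous hh.injective a hp⟩, ?_⟩
      intro heq
      exact hpm (hh.injective (heq.trans hhm.symm))
    | limit a ha ih =>
      intro hle
      rw [iteratedDerivedSet_limit ha, mem_iInter]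
      exact fun b => ih b b.2 (le_trans (le_of_lt b.2) hle)
  have := key _ le_rfl
  rw [he] at this
  exact this.symm

end endpoint

theorem aleph0_le_cof_ord {c : Cardinal.{u}} (hc : ℵ₀ ≤ c) : ℵ₀ ≤ c.ord.cof :=
  (isRegular_cof (isSuccLimit_ord hc)).aleph0_le

/-- An infinite initial ordinal contains a closed cofinal copy of its cofinality. -/
theorem exists_strictMono_cofinal {c : Cardinal.{u}} (hc : ℵ₀ ≤ c) :
    ∃ h : c.ord.cof.ord.ToType → c.ord.ToType, StrictMono h ∧
      (∀ x t, t < h x → ∃ j < x, t < h j ∨ Ioo j x = ∅) ∧ ∀ t, ∃ x, t < h x := by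
  have hκ : ℵ₀ ≤ c.ord.cof := aleph0_le_cof_ord hc
  obtain ⟨S, hS, hSc⟩ := Order.exists_cof_eq c.ord.ToType
  rw [Ordinal.cof_toType] at hSc
  have hg : ∃ g : c.ord.cof.ord.ToType → c.ord.ToType, range g = S := by
    obtain ⟨e⟩ := Cardinal.eq.1 ((mk_ord_toType c.ord.cof).trans hSc.symm)
    refine ⟨fun x => e x, ?_⟩
    change range (Subtype.val ∘ e) = S
    rw [e.surjective.range_comp, Subtype.range_coe]
  obtain ⟨g, hg⟩ := hg
  have hex : ∀ (x : c.ord.cof.ord.ToType) (rec : ∀ j, j < x → c.ord.ToType),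
      {t | ∀ j (hj : j < x), rec j hj < t ∧ g j < t}.Nonempty := by
    intro x rec
    have h1 : #(Iio x) < c.ord.cof := by simpa using mk_Iio_lt x
    have h2 : #((range fun j : Iio x => rec j j.2) ∪ g '' Iio x : Set c.ord.ToType) < c.ord.cof :=
      (mk_union_le _ _).trans_lt (add_lt_of_lt hκ (mk_range_le.trans_lt h1)
        (mk_image_le.trans_lt h1))
    have h3 : ¬ IsCofinal ((range fun j : Iio x => rec j j.2) ∪ g '' Iio x) := fun h =>
      h2.not_ge ((Ordinal.cof_toType c.ord).ge.trans (Order.cof_le h))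
    obtain ⟨t, ht⟩ := not_isCofinal_iff.1 h3
    exact ⟨t, fun j hj => ⟨ht _ (.inl ⟨⟨j, hj⟩, rfl⟩), ht _ (.inr ⟨j, hj, rfl⟩)⟩⟩
  let nxt : ∀ (x : c.ord.cof.ord.ToType), (∀ j, j < x → c.ord.ToType) → c.ord.ToType :=
    fun x rec => wellFounded_lt.min _ (hex x rec)
  let h : c.ord.cof.ord.ToType → c.ord.ToType := wellFounded_lt.fix nxt
  have hfix : ∀ x, h x = nxt x fun j _ => h j := fun x => wellFounded_lt.fix_eq nxt x
  have hlt : ∀ x, ∀ j < x, h j < h x ∧ g j < h x := by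
    intro x j hj
    have := wellFounded_lt.min_mem _ (hex x fun j _ => h j)
    rw [hfix x]
    exact this j hj
  have hmin : ∀ x t, (∀ j < x, h j < t ∧ g j < t) → h x ≤ t := by
    intro x t ht
    rw [hfix x]
    exact wellFounded_lt.min_le (s := {t | ∀ j (hj : j < x), h j < t ∧ g j < t}) ht
  refine ⟨h, fun j x hj => (hlt x j hj).1, ?_, ?_⟩
  · intro x t ht
    have : ¬ ∀ j < x, h j < t ∧ g j < t := fun hc => (hmin x t hc).not_gt ht
    push Not at this
    obtain ⟨j, hj, hjt⟩ := this
    by_cases hne : (Ioo j x).Nonempty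
    · obtain ⟨i, hji, hix⟩ := hne
      refine ⟨i, hix, .inl ?_⟩
      by_cases h1 : h j < t
      · exact (hjt h1).trans_lt (hlt i j hji).2
      · exact (not_lt.1 h1).trans_lt (hlt i j hji).1
    · exact ⟨j, hj, .inr (not_nonempty_iff_eq_empty.1 hne)⟩
  · intro t
    have := noMaxOrder hκ
    obtain ⟨s, hs, hts⟩ := hS t
    obtain ⟨j, rfl⟩ := hg ▸ hs
    obtain ⟨x, hx⟩ := exists_gt j
    exact ⟨x, hts.trans_lt (hlt x j hx).2⟩

theorem isOpen_preimage_Ioi_of_strictMono {T T' : Type*} [LinearOrder T] [TopologicalSpace T]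
    [OrderTopology T] [LinearOrder T'] {f : T → T'} (hf : StrictMono f) (t : T')
    (h : ∀ x, t < f x → ∃ y < x, t < f y ∨ Ioo y x = ∅) : IsOpen (f ⁻¹' Ioi t) := by
  rw [isOpen_iff_mem_nhds]
  intro x hx
  obtain ⟨y, hy, h | h⟩ := h x hx
  · filter_upwards [Ioi_mem_nhds hy] with z hz
    exact h.trans (hf hz)
  · filter_upwards [Ioi_mem_nhds hy] with z hz
    by_contra hlt
    have : z < x := by
      by_contra hzx
      exact hlt (lt_of_lt_of_le hx (hf.monotone (not_lt.1 hzx)))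
    exact (Set.eq_empty_iff_forall_notMem.1 h) z ⟨hz, this⟩

namespace DoubleOrd

variable {lam mu lam' mu' : Cardinal.{u}}

theorem exists_right_covered (hm : ℵ₀ ≤ mu) (b : mu.ord.ToType) :
    ∃ y < (right b : DoubleOrd lam mu), Ioo y (right b) = ∅ := by
  have := noMaxOrder hm
  have hne : {c | b < c}.Nonempty := exists_gt b
  refine ⟨right (wellFounded_lt.min _ hne), right_lt_right.2 (wellFounded_lt.min_mem _ hne), ?_⟩
  rw [Set.eq_empty_iff_forall_notMem]
  rintro z ⟨h1, h2⟩
  obtain ⟨c, rfl⟩ := exists_right_of_mid_lt ((mid_lt_right _).trans h1)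
  exact (right_lt_right.1 h1).not_ge (wellFounded_lt.min_le (right_lt_right.1 h2))

theorem exists_left_covered (hl : ℵ₀ ≤ lam) (b : lam.ord.ToType) :
    ∃ y > (left b : DoubleOrd lam mu), Ioo (left b) y = ∅ := by
  have := noMaxOrder hl
  have hne : {c | b < c}.Nonempty := exists_gt b
  refine ⟨left (wellFounded_lt.min _ hne), left_lt_left.2 (wellFounded_lt.min_mem _ hne), ?_⟩
  rw [Set.eq_empty_iff_forall_notMem]
  rintro z ⟨h1, h2⟩
  obtain ⟨c, rfl⟩ := exists_left_of_lt_mid (h2.trans (left_lt_mid _))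
  exact (left_lt_left.1 h2).not_ge (wellFounded_lt.min_le (left_lt_left.1 h1))

theorem continuous_map (hl : ℵ₀ ≤ lam) (hm : ℵ₀ ≤ mu) {φ : lam.ord.ToType → lam'.ord.ToType}
    {ψ : mu.ord.ToType → mu'.ord.ToType} (hφ : StrictMono φ) (hψ : StrictMono ψ)
    (hφc : ∀ x t, t < φ x → ∃ j < x, t < φ j ∨ Ioo j x = ∅) (hφu : ∀ t, ∃ x, t < φ x)
    (hψc : ∀ x t, t < ψ x → ∃ j < x, t < ψ j ∨ Ioo j x = ∅) (hψu : ∀ t, ∃ x, t < ψ x) :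
    Continuous (map φ ψ) := by
  have hmono := strictMono_map hφ hψ
  rw [OrderTopology.continuous_iff]
  intro t
  constructor
  · refine isOpen_preimage_Ioi_of_strictMono hmono t fun x hx => ?_
    induction x using cases_on with
    | hl a =>
      obtain ⟨s, rfl⟩ := exists_left_of_lt_mid (lt_trans hx (left_lt_mid _))
      obtain ⟨j, hj, h⟩ := hφc a s (left_lt_left.1 hx)
      refine ⟨left j, left_lt_left.2 hj, h.imp (fun h => left_lt_left.2 h) fun h => ?_⟩
      rw [Set.eq_empty_iff_forall_notMem] at h ⊢
      rintro z ⟨h1, h2⟩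
      obtain ⟨c, rfl⟩ := exists_left_of_lt_mid (h2.trans (left_lt_mid _))
      exact h c ⟨left_lt_left.1 h1, left_lt_left.1 h2⟩
    | hm =>
      obtain ⟨s, rfl⟩ := exists_left_of_lt_mid hx
      obtain ⟨j, hj⟩ := hφu s
      exact ⟨left j, left_lt_mid j, .inl (left_lt_left.2 hj)⟩
    | hr b =>
      obtain ⟨y, hy, h⟩ := exists_right_covered (lam := lam) hm b
      exact ⟨y, hy, .inr h⟩
  · have key := isOpen_preimage_Ioi_of_strictMono (T := (DoubleOrd lam mu)ᵒᵈ)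
      (T' := (DoubleOrd lam' mu')ᵒᵈ) (f := OrderDual.toDual ∘ map φ ψ ∘ OrderDual.ofDual)
      hmono.dual (OrderDual.toDual t) ?_
    · exact key
    intro x hx
    replace hx : map φ ψ (OrderDual.ofDual x) < t := hx
    suffices h : ∃ y > OrderDual.ofDual x, map φ ψ y < t ∨ Ioo (OrderDual.ofDual x) y = ∅ by
      obtain ⟨y, hy, h⟩ := h
      refine ⟨OrderDual.toDual y, hy, h.imp id fun h => ?_⟩
      rw [Set.eq_empty_iff_forall_notMem] at h ⊢
      exact fun z hz => h (OrderDual.ofDual z) ⟨hz.2, hz.1⟩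
    generalize OrderDual.ofDual x = x at hx
    induction x using cases_on with
    | hr a =>
      obtain ⟨s, rfl⟩ := exists_right_of_mid_lt (lt_trans (mid_lt_right _) hx)
      obtain ⟨j, hj, h⟩ := hψc a s (right_lt_right.1 hx)
      refine ⟨right j, right_lt_right.2 hj, h.imp (fun h => right_lt_right.2 h) fun h => ?_⟩
      rw [Set.eq_empty_iff_forall_notMem] at h ⊢
      rintro z ⟨h1, h2⟩
      obtain ⟨c, rfl⟩ := exists_right_of_mid_lt ((mid_lt_right _).trans h1)
      exact h c ⟨right_lt_right.1 h2, right_lt_right.1 h1⟩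
    | hm =>
      obtain ⟨s, rfl⟩ := exists_right_of_mid_lt hx
      obtain ⟨j, hj⟩ := hψu s
      exact ⟨right j, mid_lt_right j, .inl (right_lt_right.2 hj)⟩
    | hl b =>
      obtain ⟨y, hy, h⟩ := exists_left_covered (mu := mu) hl b
      exact ⟨y, hy, .inr h⟩

theorem exists_isEmbedding_cof (hl : ℵ₀ ≤ lam) (hm : ℵ₀ ≤ mu) :
    ∃ f : DoubleOrd lam.ord.cof mu.ord.cof → DoubleOrd lam mu, IsEmbedding f ∧ f mid = mid := by
  obtain ⟨φ, h1, h2, h3⟩ := exists_strictMono_cofinal hl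
  obtain ⟨ψ, h4, h5, h6⟩ := exists_strictMono_cofinal hm
  have hκ : ℵ₀ ≤ lam.ord.cof := aleph0_le_cof_ord hl
  have hν : ℵ₀ ≤ mu.ord.cof := aleph0_le_cof_ord hm
  exact ⟨map φ ψ, ((continuous_map hκ hν h1 h4 h2 h3 h5 h6).isClosedEmbedding
    (strictMono_map h1 h4).injective).isEmbedding, rfl⟩

end DoubleOrd

theorem IsDoubleLimitPoint.exists_regular {X : Type u} [TopologicalSpace X] {x : X}
    (h : IsDoubleLimitPoint x) : ∃ lam mu : Cardinal.{u}, lam.IsRegular ∧ mu.IsRegular ∧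
      ℵ_ 1 ≤ mu ∧ ∃ f : DoubleOrd lam mu → X, IsEmbedding f ∧ f DoubleOrd.mid = x := by
  obtain ⟨lam, mu, hl, hm, hcof, f, hf, e, he, rfl⟩ := h
  obtain ⟨g, hg, hgm⟩ := DoubleOrd.exists_isEmbedding_cof hl hm
  obtain rfl := he.eq_mid hl hm
  exact ⟨_, _, isRegular_cof (isSuccLimit_ord hl), isRegular_cof (isSuccLimit_ord hm), hcof,
    f ∘ g, hf.comp hg, congrArg f hgm⟩

/-- If a local class is realized in closed sets arbitrarily close to each point of a finite set,
then there are at least as many points of the class in a CO space. -/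
theorem ncard_le_of_forall_nhds {X : Type u} [TopologicalSpace X] [T2Space X] (hCO : IsCOSpace X)
    {Q : PointClass.{u}} (hQ : IsLocal Q) {T : Set X} (hT : T.Finite)
    (h : ∀ p ∈ T, ∀ N ∈ 𝓝 p, ∃ K ⊆ N, IsClosed K ∧ ∃ z, HoldsOn Q K z)
    (hfin : {x | Q X x}.Finite) : T.ncard ≤ {x | Q X x}.ncard := by
  classical
  obtain ⟨U, hU, hd⟩ := hT.t2_separation
  have h' : ∀ p : T, ∃ K ⊆ U p, IsClosed K ∧ ∃ z, HoldsOn Q K z := fun p =>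
    h p p.2 _ ((hU p).2.mem_nhds (hU p).1)
  choose K hKU hKc z hz using h'
  have := hT.to_subtype
  obtain ⟨V, hV, ⟨e⟩⟩ := hCO (⋃ p, K p) (isClosed_iUnion_of_finite hKc)
  have hF : ∀ p : T, (⋃ p, K p) ∩ U p = K p ∩ U p := by
    intro p
    refine Subset.antisymm ?_ (inter_subset_inter_left _ (subset_iUnion K p))
    rintro w ⟨hw, hwU⟩
    obtain ⟨q, hq⟩ := mem_iUnion.1 hw
    rcases eq_or_ne q p with rfl | hqp
    · exact ⟨hq, hwU⟩
    · exact absurd hwU (Set.disjoint_left.1 (hd q.2 p.2 fun e => hqp (Subtype.ext e)) (hKU q hq))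
  have hzU : ∀ p : T, z p ∈ U p := fun p => hKU p (hz p).mem
  have hzF : ∀ p : T, HoldsOn Q (⋃ p, K p) (z p) := fun p =>
    (hQ.holdsOn_congr (hU p).2 (hF p) (hzU p)).2 (hz p)
  have hzX : ∀ p : T, Q X (e ⟨z p, (hzF p).mem⟩) := fun p =>
    (hQ.holdsOn_isOpen hV.isOpen (Subtype.coe_prop _)).1
      ((holdsOn_coe _).2 ((hQ e e.isOpenEmbedding _).1 (hzF p).2))
  rw [← Nat.card_coe_set_eq, ← Nat.card_coe_set_eq]
  have := hfin.to_subtype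
  refine Nat.card_le_card_of_injective (fun p => (⟨_, hzX p⟩ : {x | Q X x})) ?_
  intro p q hpq
  have h1 := Subtype.mk.inj (e.injective (Subtype.ext (Subtype.mk.inj hpq)))
  by_contra hne
  exact Set.disjoint_left.1 (hd p.2 q.2 fun e => hne (Subtype.ext e)) (hzU p) (h1 ▸ hzU q)

section iterated_accumulation

/-- The class of `k`-fold accumulation points of points of the class `D`. -/
def IterAcc (D : PointClass.{u}) : ℕ → PointClass.{u}
  | 0 => D
  | k + 1 => fun Y _ y => ∀ N ∈ 𝓝 y, ∃ z ∈ N, z ≠ y ∧ IterAcc D k Y z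

variable {D S : PointClass.{u}}

theorem isLocal_iterAcc (hD : IsLocal D) : ∀ k, IsLocal (IterAcc D k)
  | 0 => hD
  | k + 1 => isLocal_accumulation (isLocal_iterAcc hD k)

theorem IterAcc.exists_mem_nhds {Y : Type u} [TopologicalSpace Y] {k : ℕ} {y : Y}
    (h : IterAcc D k Y y) {N : Set Y} (hN : N ∈ 𝓝 y) : ∃ z ∈ N, D Y z := by
  induction k generalizing y with
  | zero => exact ⟨y, mem_of_mem_nhds hN, h⟩
  | succ k ih =>
    obtain ⟨z, hz, -, hk⟩ := h _ (interior_mem_nhds.2 hN)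
    exact ih hk (mem_interior_iff_mem_nhds.1 hz)

theorem IterAcc.pred {Y : Type u} [TopologicalSpace Y] [T1Space Y] {k : ℕ} {y : Y}
    (h : IterAcc D (k + 2) Y y) : IterAcc D (k + 1) Y y := by
  intro N hN
  obtain ⟨z, hz, hzy, hk⟩ := h _ (interior_mem_nhds.2 hN)
  obtain ⟨w, hw, -, hk⟩ := hk _ (inter_mem (mem_interior_iff_mem_nhds.1 hz)
    (isOpen_compl_singleton.mem_nhds hzy))
  exact ⟨w, hw.1, hw.2, hk⟩

theorem IterAcc.of_le {Y : Type u} [TopologicalSpace Y] [T1Space Y] {k l : ℕ} {y : Y}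
    (hkl : k ≤ l) (h : IterAcc D (l + 1) Y y) : IterAcc D (k + 1) Y y := by
  induction l, hkl using Nat.le_induction with
  | base => exact h
  | succ l _ ih => exact ih h.pred

theorem IterAcc.infinite {Y : Type u} [TopologicalSpace Y] [T1Space Y] {k : ℕ} {y : Y}
    (h : IterAcc D (k + 1) Y y) {N : Set Y} (hN : N ∈ 𝓝 y) :
    {z | z ∈ N ∧ IterAcc D k Y z}.Infinite := by
  intro hfin
  obtain ⟨z, ⟨hz, hzA⟩, hzy, hk⟩ := h _ (inter_mem hN
    ((hfin.subset sdiff_subset).isClosed.isOpen_compl.mem_nhds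
      (show y ∈ ({z | z ∈ N ∧ IterAcc D k Y z} \ {y})ᶜ from fun h => h.2 rfl)))
  exact hzA ⟨⟨hz, hk⟩, hzy⟩

theorem not_holdsOn_iterAcc_succ {X : Type u} [TopologicalSpace X] [T1Space X] {F : Set X}
    {k : ℕ} (h : ∀ a b, HoldsOn (IterAcc D k) F a → HoldsOn (IterAcc D k) F b → a = b) (z : X) :
    ¬ HoldsOn (IterAcc D (k + 1)) F z := by
  intro hz
  have hz := (holdsOn_accumulation_iff.1 hz).2
  obtain ⟨a, -, haz, ha⟩ := hz _ univ_mem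
  obtain ⟨b, hb, -, hb'⟩ := hz _ (isOpen_compl_singleton.mem_nhds haz.symm)
  exact hb (h b a hb' ha)

/-- A closed set without points of the class `S` and with a single point of `IterAcc D k`. -/
structure IsPurePiece (D S : PointClass.{u}) (k : ℕ) {X : Type u} [TopologicalSpace X]
    (K : Set X) : Prop where
  isClosed : IsClosed K
  notHolds : ∀ z, ¬ HoldsOn S K z
  exists_unique : ∃ w, ∀ z, HoldsOn (IterAcc D k) K z ↔ z = w

/-- A closed set without points of the class `D` and with a single point of the class `S`. -/
structure IsCoPiece (D S : PointClass.{u}) {X : Type u} [TopologicalSpace X] (K : Set X) :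
    Prop where
  isClosed : IsClosed K
  notHolds : ∀ z, ¬ HoldsOn D K z
  exists_unique : ∃ w, ∀ z, HoldsOn S K z ↔ z = w

theorem IsCoPiece.not_holdsOn_iterAcc {X : Type u} [TopologicalSpace X] {K : Set X}
    (h : IsCoPiece D S K) (k : ℕ) (z : X) : ¬ HoldsOn (IterAcc D k) K z := by
  rintro ⟨hz, hk⟩
  obtain ⟨w, -, hw⟩ := hk.exists_mem_nhds univ_mem
  exact h.notHolds w ⟨w.2, hw⟩

variable {X : Type u} [TopologicalSpace X] [LinearOrder X] [OrderTopology X]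
variable {O K : ℕ → Set X} {y : X} {k : ℕ} {A : Set ℕ}

theorem ShrinksTo.holdsOn_iterAcc_iff (hO : ShrinksTo O y) (hKO : ∀ i, K i ⊆ O i)
    (hD : IsLocal D) (hA : A.Infinite) (hpure : ∀ i ∈ A, IsPurePiece D S k (K i))
    (hco : ∀ i ∉ A, IsCoPiece D S (K i)) {z : X} :
    HoldsOn (IterAcc D (k + 1)) (pointedUnion y K Set.univ) z ↔ z = y := by
  constructor
  · intro h
    rcases mem_pointedUnion.1 h.mem with rfl | ⟨i, hi, hz⟩
    · rfl
    rw [hO.holdsOn_iff hKO hi (isLocal_iterAcc hD _) hz] at h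
    by_cases hiA : i ∈ A
    · obtain ⟨w, hw⟩ := (hpure i hiA).exists_unique
      exact absurd h (not_holdsOn_iterAcc_succ
        (fun a b ha hb => ((hw a).1 ha).trans ((hw b).1 hb).symm) z)
    · exact absurd h ((hco i hiA).not_holdsOn_iterAcc _ z)
  · rintro rfl
    refine holdsOn_accumulation_iff.2 ⟨mem_pointedUnion.2 (.inl rfl), fun N hN => ?_⟩
    obtain ⟨n, hn⟩ := hO.eventually N hN
    obtain ⟨i, hi, hni⟩ := hA.exists_gt n
    obtain ⟨w, hw⟩ := (hpure i hi).exists_unique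
    have h := (hw w).2 rfl
    exact ⟨w, hn i hni.le (hKO i h.mem), fun e => hO.notMem i (e ▸ hKO i h.mem),
      (hO.holdsOn_iff hKO (mem_univ i) (isLocal_iterAcc hD _) h.mem).2 h⟩

theorem ShrinksTo.holdsOn_iterAcc_one_iff (hO : ShrinksTo O y) (hKO : ∀ i, K i ⊆ O i)
    (hS : IsLocal S) (hA : Aᶜ.Infinite) (hpure : ∀ i ∈ A, IsPurePiece D S k (K i))
    (hco : ∀ i ∉ A, IsCoPiece D S (K i)) {z : X} :
    HoldsOn (IterAcc S 1) (pointedUnion y K Set.univ) z ↔ z = y := by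
  constructor
  · intro h
    rcases mem_pointedUnion.1 h.mem with rfl | ⟨i, hi, hz⟩
    · rfl
    rw [hO.holdsOn_iff hKO hi (isLocal_iterAcc hS _) hz] at h
    refine absurd h (not_holdsOn_iterAcc_succ (fun a b ha hb => ?_) z)
    by_cases hiA : i ∈ A
    · exact absurd ha ((hpure i hiA).notHolds a)
    · obtain ⟨w, hw⟩ := (hco i hiA).exists_unique
      exact ((hw a).1 ha).trans ((hw b).1 hb).symm
  · rintro rfl
    refine holdsOn_accumulation_iff.2 ⟨mem_pointedUnion.2 (.inl rfl), fun N hN => ?_⟩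
    obtain ⟨n, hn⟩ := hO.eventually N hN
    obtain ⟨i, hi, hni⟩ := hA.exists_gt n
    obtain ⟨w, hw⟩ := (hco i hi).exists_unique
    have h := (hw w).2 rfl
    exact ⟨w, hn i hni.le (hKO i h.mem), fun e => hO.notMem i (e ▸ hKO i h.mem),
      (hO.holdsOn_iff hKO (mem_univ i) hS h.mem).2 h⟩

theorem ShrinksTo.isPurePiece (hO : ShrinksTo O y) (hKO : ∀ i, K i ⊆ O i)
    (hD : IsLocal D) (hS : IsLocal S)
    (hSD : ∀ (Y : Type u) [TopologicalSpace Y] (y : Y), S Y y → ∃ N ∈ 𝓝 y, ∀ z ∈ N, ¬ D Y z)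
    (hpure : ∀ i, IsPurePiece D S k (K i)) :
    IsPurePiece D S (k + 1) (pointedUnion y K Set.univ) := by
  have hy : ∀ z, HoldsOn (IterAcc D (k + 1)) (pointedUnion y K Set.univ) z ↔ z = y := fun z =>
    hO.holdsOn_iterAcc_iff hKO hD infinite_univ (fun i _ => hpure i)
      (fun i hi => absurd (mem_univ i) hi)
  refine ⟨hO.isClosed_pointedUnion (fun i => (hpure i).isClosed) hKO _, fun z hz => ?_, y, hy⟩
  rcases mem_pointedUnion.1 hz.mem with rfl | ⟨i, hi, hzi⟩
  · obtain ⟨N, hN, h⟩ := hSD _ _ hz.2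
    obtain ⟨w, hw, hw'⟩ := ((hy z).2 rfl).2.exists_mem_nhds hN
    exact h w hw hw'
  · exact (hpure i).notHolds z ((hO.holdsOn_iff hKO hi hS hzi).1 hz)

theorem IterAcc.exists_isPurePiece [CompactSpace X] (hD : IsLocal D) (hS : IsLocal S)
    (hSD : ∀ (Y : Type u) [TopologicalSpace Y] (y : Y), S Y y → ∃ N ∈ 𝓝 y, ∀ z ∈ N, ¬ D Y z)
    (hpure : ∀ x, D X x → ∀ N ∈ 𝓝 x, ∃ K ⊆ N, IsPurePiece D S 0 K) {x : X}
    (hx : IterAcc D k X x) {N : Set X} (hN : N ∈ 𝓝 x) : ∃ K ⊆ N, IsPurePiece D S k K := by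
  induction k generalizing x N with
  | zero => exact hpure x hx N hN
  | succ k ih =>
    obtain ⟨C, hC, hCc, hCN⟩ := exists_mem_nhds_isClosed_subset (interior_mem_nhds.2 hN)
    have hinf := hx.infinite hC
    obtain ⟨s, O, y, -, hO, hm⟩ := exists_shrinksTo
      (Subtype.val_injective.comp (hinf.natEmbedding _).injective)
    let m : ℕ → X := fun i => hinf.natEmbedding _ (s i)
    have hmO : ∀ i, m i ∈ O i := fun i => (hm i).1
    have hmC : ∀ i, m i ∈ C ∧ IterAcc D k X (m i) := fun i => (hinf.natEmbedding _ (s i)).2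
    choose K hKN hK using fun i => ih (hmC i).2
      (inter_mem ((hO.isOpen i).mem_nhds (hmO i)) (isOpen_interior.mem_nhds (hCN (hmC i).1)))
    refine ⟨_, ?_, hO.isPurePiece (fun i => (hKN i).trans inter_subset_left) hD hS hSD hK⟩
    have hyC : y ∈ C := by
      by_contra hyC
      obtain ⟨n, hn⟩ := hO.eventually _ (hCc.isOpen_compl.mem_nhds hyC)
      exact hn n le_rfl (hmO n) (hmC n).1
    intro z hz
    rcases mem_pointedUnion.1 hz with rfl | ⟨i, -, hz⟩
    · exact interior_subset (hCN hyC)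
    · exact interior_subset (hKN i hz).2

theorem exists_isClosed_iterAcc_iff [CompactSpace X] (hD : IsLocal D) (hS : IsLocal S)
    (hSD : ∀ (Y : Type u) [TopologicalSpace Y] (y : Y), S Y y → ∃ N ∈ 𝓝 y, ∀ z ∈ N, ¬ D Y z)
    (hpure : ∀ x, D X x → ∀ N ∈ 𝓝 x, ∃ K ⊆ N, IsPurePiece D S 0 K)
    (hco : ∀ x, D X x → ∀ N ∈ 𝓝 x, ∃ K ⊆ N, IsCoPiece D S K)
    (hinf : {x | IterAcc D k X x}.Infinite) :
    ∃ (F : Set X) (y : X), IsClosed F ∧ (∀ z, HoldsOn (IterAcc D (k + 1)) F z ↔ z = y) ∧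
      ∀ z, HoldsOn (IterAcc S 1) F z ↔ z = y := by
  obtain ⟨s, O, y, -, hO, hm⟩ := exists_shrinksTo
    (Subtype.val_injective.comp (hinf.natEmbedding _).injective)
  let m : ℕ → X := fun i => hinf.natEmbedding _ (s i)
  have hmO : ∀ i, O i ∈ 𝓝 (m i) := fun i => (hO.isOpen i).mem_nhds (hm i).1
  have hmk : ∀ i, IterAcc D k X (m i) := fun i => (hinf.natEmbedding _ (s i)).2
  have hex : ∀ i, ∃ K ⊆ O i, (Even i → IsPurePiece D S k K) ∧ (¬ Even i → IsCoPiece D S K) := by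
    intro i
    by_cases hi : Even i
    · obtain ⟨K, hKO, hK⟩ := (hmk i).exists_isPurePiece hD hS hSD hpure (hmO i)
      exact ⟨K, hKO, fun _ => hK, fun h => absurd hi h⟩
    · obtain ⟨z, hz, hzD⟩ := (hmk i).exists_mem_nhds (hmO i)
      obtain ⟨K, hKO, hK⟩ := hco z hzD _ ((hO.isOpen i).mem_nhds hz)
      exact ⟨K, hKO, fun h => absurd h hi, fun _ => hK⟩
  choose K hKO hKp hKc using hex
  have hclosed : ∀ i, IsClosed (K i) := fun i =>
    (em (Even i)).elim (fun h => (hKp i h).isClosed) fun h => (hKc i h).isClosed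
  refine ⟨pointedUnion y K Set.univ, y, hO.isClosed_pointedUnion hclosed hKO _,
    fun z => hO.holdsOn_iterAcc_iff (A := {i | Even i}) hKO hD ?_ hKp hKc,
    fun z => hO.holdsOn_iterAcc_one_iff (A := {i | Even i}) hKO hS ?_ hKp hKc⟩
  · exact Set.infinite_of_forall_exists_gt fun n => ⟨2 * (n + 1), even_two_mul _, by lia⟩
  · refine Set.infinite_of_forall_exists_gt fun n => ⟨2 * n + 1, ?_, by lia⟩
    simp

theorem IsCOSpace.exists_of_holdsOn (hCO : IsCOSpace X) {Q : PointClass.{u}} (hQ : IsLocal Q)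
    {F : Set X} (hF : IsClosed F) {x : X} (hx : HoldsOn Q F x) : ∃ p, Q X p := by
  obtain ⟨V, hV, ⟨e⟩⟩ := hCO F hF
  exact ⟨_, (hQ.holdsOn_isOpen hV.isOpen (Subtype.coe_prop _)).1
    ((holdsOn_coe _).2 ((hQ e e.isOpenEmbedding _).1 hx.2))⟩

theorem infinite_iterAcc [CompactSpace X] (hCO : IsCOSpace X) (hD : IsLocal D) (hS : IsLocal S)
    (hSD : ∀ (Y : Type u) [TopologicalSpace Y] (y : Y), S Y y → ∃ N ∈ 𝓝 y, ∀ z ∈ N, ¬ D Y z)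
    (hpure : ∀ x, D X x → ∀ N ∈ 𝓝 x, ∃ K ⊆ N, IsPurePiece D S 0 K)
    (hco : ∀ x, D X x → ∀ N ∈ 𝓝 x, ∃ K ⊆ N, IsCoPiece D S K)
    (hinf : {x | D X x}.Infinite) (k : ℕ) : {x | IterAcc D k X x}.Infinite := by
  induction k with
  | zero => exact hinf
  | succ k ih =>
    intro hfin
    let Q : PointClass.{u} := fun Y _ y => IterAcc D (k + 1) Y y ∧ ∃ N ∈ 𝓝 y, ∀ z ∈ N, ¬ S Y z
    have hQ : IsLocal Q :=
      isLocal_and (isLocal_iterAcc hD _) (isLocal_exists_near (isLocal_not hS))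
    have hsub : {x | Q X x} ⊆ {x | IterAcc D (k + 1) X x} := fun x hx => hx.1
    have hcard := ncard_le_of_forall_nhds hCO hQ hfin (fun p hp N hN => by
      obtain ⟨K, hKN, hK⟩ := IterAcc.exists_isPurePiece hD hS hSD hpure hp hN
      obtain ⟨w, hw⟩ := hK.exists_unique
      obtain ⟨hwK, h⟩ := (hw w).2 rfl
      exact ⟨K, hKN, hK.isClosed, w, hwK, h, Set.univ, univ_mem,
        fun z _ hz => hK.notHolds z ⟨z.2, hz⟩⟩) (hfin.subset hsub)
    have heq := Set.eq_of_subset_of_ncard_le hsub hcard hfin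
    obtain ⟨F, y, hF, hy, hy'⟩ := exists_isClosed_iterAcc_iff hD hS hSD hpure hco ih
    obtain ⟨p, hp, hp'⟩ := hCO.exists_of_holdsOn
      (isLocal_and (isLocal_iterAcc hD (k + 1)) (isLocal_iterAcc hS 1)) hF
      (holdsOn_and_iff.2 ⟨(hy y).2 rfl, (hy' y).2 rfl⟩)
    obtain ⟨-, N, hN, h⟩ : Q X p := heq.ge hp
    obtain ⟨z, hz, -, hzS⟩ := hp' N hN
    exact h z hz hzS

theorem finite_of_pieces [CompactSpace X] (hCO : IsCOSpace X) (hD : IsLocal D) (hS : IsLocal S)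
    (hSD : ∀ (Y : Type u) [TopologicalSpace Y] (y : Y), S Y y → ∃ N ∈ 𝓝 y, ∀ z ∈ N, ¬ D Y z)
    (hpure : ∀ x, D X x → ∀ N ∈ 𝓝 x, ∃ K ⊆ N, IsPurePiece D S 0 K)
    (hco : ∀ x, D X x → ∀ N ∈ 𝓝 x, ∃ K ⊆ N, IsCoPiece D S K) : {x | D X x}.Finite := by
  by_contra hinf
  choose F y hF hy hy' using fun k => exists_isClosed_iterAcc_iff hD hS hSD hpure hco
    (infinite_iterAcc hCO hD hS hSD hpure hco hinf k)
  have hPloc : ∀ k, IsLocal fun Y _ y => IterAcc D (k + 1) Y y ∧ IterAcc S 1 Y y ∧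
      ∃ N ∈ 𝓝 y, ∀ z ∈ N, IterAcc D (k + 1) Y z → z = y := fun k =>
    isLocal_and (isLocal_iterAcc hD _) (isLocal_and (isLocal_iterAcc hS _)
      (isLocal_isolated (isLocal_iterAcc hD _)))
  refine not_independent hCO hPloc hF (x := y) (fun k => ?_) fun i j z hz => ?_
  · exact holdsOn_and_iff.2 ⟨(hy k _).2 rfl, holdsOn_and_iff.2 ⟨(hy' k _).2 rfl,
      holdsOn_isolated_iff.2 ⟨((hy k _).2 rfl).mem, Set.univ, univ_mem,
        fun z _ hz => (hy k z).1 hz⟩⟩⟩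
  · obtain ⟨h1, h2⟩ := holdsOn_and_iff.1 hz
    obtain ⟨h2, h3⟩ := holdsOn_and_iff.1 h2
    obtain rfl := (hy' i z).1 h2
    rcases lt_trichotomy j i with hji | rfl | hij
    · obtain ⟨h0, N, hN, h⟩ := h3
      obtain ⟨w, hw, hne, hwk⟩ := ((hy i _).2 rfl).2.of_le (k := j + 1) hji N hN
      exact absurd (h w hw hwk) hne
    · rfl
    · exact absurd ⟨h1.1, h1.2.of_le (k := i + 1) hij⟩ (not_holdsOn_iterAcc_succ
        (fun a b ha hb => ((hy i a).1 ha).trans ((hy i b).1 hb).symm) _)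

end iterated_accumulation

theorem Topology.IsEmbedding.holdsOn_image_iff {Y X : Type u} [TopologicalSpace Y]
    [TopologicalSpace X] {g : Y → X} (hg : IsEmbedding g) {Q : PointClass.{u}} (hQ : IsLocal Q)
    {A : Set Y} {q : Y} : HoldsOn Q (g '' A) (g q) ↔ HoldsOn Q A q := by
  constructor
  · rintro ⟨⟨a, ha, hag⟩, h⟩
    obtain rfl := hg.injective hag
    exact ⟨ha, (hQ _ (hg.homeomorphImage A).isOpenEmbedding ⟨a, ha⟩).2 h⟩
  · rintro ⟨ha, h⟩
    exact ⟨⟨q, ha, rfl⟩, (hQ _ (hg.homeomorphImage A).isOpenEmbedding ⟨q, ha⟩).1 h⟩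

theorem Topology.IsEmbedding.holdsOn_range_iff {Y X : Type u} [TopologicalSpace Y]
    [TopologicalSpace X] {g : Y → X} (hg : IsEmbedding g) {Q : PointClass.{u}} (hQ : IsLocal Q)
    {q : Y} : HoldsOn Q (range g) (g q) ↔ Q Y q := by
  rw [← image_univ, hg.holdsOn_image_iff hQ, hQ.holdsOn_isOpen isOpen_univ (mem_univ q)]

/-- Every neighbourhood of the point has at least `κ` points, and no point of a neighbourhood is
in `D`. -/
def Heavy (κ : Cardinal.{u}) (D : PointClass.{u}) : PointClass.{u} := fun Y _ y =>
  (∀ N ∈ 𝓝 y, κ ≤ #{z | z ∈ N ∧ True}) ∧ ∃ N ∈ 𝓝 y, ∀ z ∈ N, ¬ D Y z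

theorem isLocal_heavy {κ : Cardinal.{u}} {D : PointClass.{u}} (hD : IsLocal D) :
    IsLocal (Heavy κ D) :=
  isLocal_and (isLocal_le_count (P := fun _ _ _ => True) (fun _ _ _ _ _ _ _ => Iff.rfl) κ)
    (isLocal_exists_near (isLocal_not hD))

theorem Heavy.le_mk {X : Type u} [TopologicalSpace X] {κ : Cardinal.{u}} {D : PointClass.{u}}
    {F : Set X} {x : X} (h : HoldsOn (Heavy κ D) F x) {N : Set X} (hN : N ∈ 𝓝 x) :
    κ ≤ #(N ∩ F : Set X) := by
  have := (holdsOn_le_count_iff.1 (holdsOn_and_iff.1 h).1).2 N hN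
  exact this.trans (mk_le_mk_of_subset fun z hz => ⟨hz.1, hz.2.1⟩)

section copies

variable {lam mu : Cardinal.{u}} {X : Type u} [TopologicalSpace X]

theorem exists_isEmbedding_of_mem_nhds (hl : ℵ₀ ≤ lam) (hm : ℵ₀ ≤ mu) {f : DoubleOrd lam mu → X}
    (hf : IsEmbedding f) {N : Set X} (hN : N ∈ 𝓝 (f DoubleOrd.mid)) :
    ∃ g : DoubleOrd lam mu → X, IsEmbedding g ∧ g DoubleOrd.mid = f DoubleOrd.mid ∧ range g ⊆ N := by
  obtain ⟨h, hh, hmid, hr⟩ :=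
    DoubleOrd.exists_isOpenEmbedding hl hm (hf.continuous.continuousAt hN)
  refine ⟨f ∘ h, hf.comp hh.isEmbedding, congrArg f hmid, ?_⟩
  rw [range_comp]
  exact image_subset_iff.2 hr

theorem exists_isPurePiece_of_isEmbedding [T2Space X] (hl : ℵ₀ ≤ lam) (hm : ℵ₀ ≤ mu)
    (hcof : ℵ_ 1 ≤ mu.ord.cof) {f : DoubleOrd lam mu → X} (hf : IsEmbedding f) {N : Set X}
    (hN : N ∈ 𝓝 (f DoubleOrd.mid)) : ∃ K ⊆ N, IsPurePiece (PointGerm (DoubleOrd lam mu) DoubleOrd.mid)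
      (Heavy (max lam mu) (PointGerm (DoubleOrd lam mu) DoubleOrd.mid)) 0 K := by
  obtain ⟨g, hg, -, hr⟩ := exists_isEmbedding_of_mem_nhds hl hm hf hN
  have hD := isLocal_pointGerm (DoubleOrd lam mu) DoubleOrd.mid
  refine ⟨range g, hr, (isCompact_range hg.continuous).isClosed, fun z hz => ?_, g DoubleOrd.mid,
    fun z => ⟨fun hz => ?_, ?_⟩⟩
  · obtain ⟨q, rfl⟩ := hz.mem
    rw [hg.holdsOn_range_iff (isLocal_heavy hD)] at hz
    obtain ⟨h1, M, hM, h2⟩ := hz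
    rcases eq_or_ne q DoubleOrd.mid with rfl | hq
    · exact h2 _ (mem_of_mem_nhds hM) (PointGerm.refl _)
    · obtain ⟨U, hU, hlt⟩ := DoubleOrd.exists_nhds_mk_lt hl hm hq
      exact ((h1 U hU).trans (mk_le_mk_of_subset fun z hz => hz.1)).not_gt hlt
  · obtain ⟨q, rfl⟩ := hz.mem
    exact congrArg g (DoubleOrd.eq_mid_of_pointGerm hl hm hcof ((hg.holdsOn_range_iff hD).1 hz))
  · rintro rfl
    exact (hg.holdsOn_range_iff hD).2 (PointGerm.refl _)

theorem exists_isCoPiece_of_isEmbedding [T2Space X] (hl : ℵ₀ ≤ lam) (hm : ℵ₀ ≤ mu)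
    (hcof : ℵ_ 1 ≤ mu.ord.cof) {f : DoubleOrd lam mu → X} (hf : IsEmbedding f) {N : Set X}
    (hN : N ∈ 𝓝 (f DoubleOrd.mid)) : ∃ K ⊆ N, IsCoPiece (PointGerm (DoubleOrd lam mu) DoubleOrd.mid)
      (Heavy (max lam mu) (PointGerm (DoubleOrd lam mu) DoubleOrd.mid)) K := by
  obtain ⟨g, hg, -, hr⟩ := exists_isEmbedding_of_mem_nhds hl hm hf hN
  have hD := isLocal_pointGerm (DoubleOrd lam mu) DoubleOrd.mid
  have hno : ∀ q, ¬ HoldsOn (PointGerm (DoubleOrd lam mu) DoubleOrd.mid) (DoubleOrd.heavyHalf lam mu) q :=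
    DoubleOrd.not_holdsOn_heavyHalf hl hm hcof
  refine ⟨g '' DoubleOrd.heavyHalf lam mu, (image_subset_range _ _).trans hr,
    (DoubleOrd.isClosed_heavyHalf.isCompact.image hg.continuous).isClosed, fun z hz => ?_,
    g DoubleOrd.mid, fun z => ⟨fun hz => ?_, ?_⟩⟩
  · obtain ⟨q, -, rfl⟩ := hz.mem
    exact hno q ((hg.holdsOn_image_iff hD).1 hz)
  · obtain ⟨q, -, rfl⟩ := hz.mem
    rw [hg.holdsOn_image_iff (isLocal_heavy hD)] at hz
    by_contra hq
    obtain ⟨U, hU, hlt⟩ := DoubleOrd.exists_nhds_mk_lt hl hm (fun e => hq (congrArg g e))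
    exact ((Heavy.le_mk hz hU).trans (mk_le_mk_of_subset inter_subset_left)).not_gt hlt
  · rintro rfl
    refine (hg.holdsOn_image_iff (isLocal_heavy hD)).2 (holdsOn_and_iff.2
      ⟨holdsOn_le_count_iff.2 ⟨DoubleOrd.mid_mem_heavyHalf, fun M hM => ?_⟩,
        DoubleOrd.mid_mem_heavyHalf, Set.univ, univ_mem, fun z _ hz => hno z ⟨z.2, hz⟩⟩)
    exact (DoubleOrd.le_mk_heavyHalf_inter hl hm hM).trans
      (mk_le_mk_of_subset fun z hz => ⟨hz.1, hz.2, trivial⟩)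

theorem finite_isEmbedding_mid [CompactSpace X] [LinearOrder X] [OrderTopology X]
    (hCO : IsCOSpace X) (hl : ℵ₀ ≤ lam) (hm : ℵ₀ ≤ mu) (hcof : ℵ_ 1 ≤ mu.ord.cof) :
    {x | ∃ f : DoubleOrd lam mu → X, IsEmbedding f ∧ f DoubleOrd.mid = x}.Finite := by
  have hD := isLocal_pointGerm (DoubleOrd lam mu) DoubleOrd.mid
  have hemb : ∀ x, PointGerm (DoubleOrd lam mu) DoubleOrd.mid X x →
      ∃ f : DoubleOrd lam mu → X, IsEmbedding f ∧ f DoubleOrd.mid = x := fun x hx => by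
    obtain ⟨f, hf, hfx, -⟩ := DoubleOrd.exists_isOpenEmbedding_of_pointGerm hl hm hx univ_mem
    exact ⟨f, hf.isEmbedding, hfx⟩
  have hfin : {x | PointGerm (DoubleOrd lam mu) DoubleOrd.mid X x}.Finite := by
    refine finite_of_pieces hCO hD (isLocal_heavy (κ := max lam mu) hD) (fun Y _ y h => h.2)
      (fun x hx N hN => ?_) (fun x hx N hN => ?_)
    · obtain ⟨f, hf, rfl⟩ := hemb x hx
      exact exists_isPurePiece_of_isEmbedding hl hm hcof hf hN
    · obtain ⟨f, hf, rfl⟩ := hemb x hx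
      exact exists_isCoPiece_of_isEmbedding hl hm hcof hf hN
  by_contra hinf
  obtain ⟨T, hT, hTf, hcard⟩ :=
    Set.Infinite.exists_subset_ncard_eq hinf ({x | PointGerm (DoubleOrd lam mu) DoubleOrd.mid X x}.ncard + 1)
  have := ncard_le_of_forall_nhds hCO hD hTf (fun p hp N hN => by
    obtain ⟨f, hf, rfl⟩ := hT hp
    obtain ⟨K, hK, h⟩ := exists_isPurePiece_of_isEmbedding hl hm hcof hf hN
    obtain ⟨w, hw⟩ := h.exists_unique
    exact ⟨K, hK, h.isClosed, w, (hw w).2 rfl⟩) hfin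
  lia

end copies

section main

variable {X : Type u} [TopologicalSpace X] [CompactSpace X] [LinearOrder X] [OrderTopology X]

theorem aleph_one_le_cof_ord {mu : Cardinal.{u}} (hm : mu.IsRegular) (h : ℵ_ 1 ≤ mu) :
    ℵ_ 1 ≤ mu.ord.cof := hm.cof_ord.symm ▸ h

theorem finite_isEmbedding_mid_of_isRegular (hCO : IsCOSpace X) :
    {x : X | ∃ lam mu : Cardinal.{u}, lam.IsRegular ∧ mu.IsRegular ∧ ℵ_ 1 ≤ mu ∧
      ∃ f : DoubleOrd lam mu → X, IsEmbedding f ∧ f DoubleOrd.mid = x}.Finite := by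
  by_contra hinf
  let p : ℕ → X := fun n => Set.Infinite.natEmbedding _ hinf n
  have hpinj : Function.Injective p :=
    Subtype.val_injective.comp (Set.Infinite.natEmbedding _ hinf).injective
  choose lam mu hl hm hmu f hf hfp using fun n =>
    (Set.Infinite.natEmbedding _ hinf n).2
  have hcof := fun n => aleph_one_le_cof_ord (hm n) (hmu n)
  let r : ℕ → ℕ → Prop := fun i j =>
    PointGerm (DoubleOrd (lam i) (mu i)) DoubleOrd.mid (DoubleOrd (lam j) (mu j)) DoubleOrd.mid
  have : IsTrans ℕ r := ⟨fun _ _ _ => PointGerm.trans⟩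
  obtain ⟨g, hg⟩ := exists_increasing_or_nonincreasing_subseq r id
  rcases hg with hg | hg
  · refine (infinite_range_of_injective (hpinj.comp g.injective)) ((finite_isEmbedding_mid
      (X := X) hCO (hl (g 0)).aleph0_le (hm (g 0)).aleph0_le (hcof (g 0))).subset ?_)
    rintro _ ⟨n, rfl⟩
    have h : r (g 0) (g n) := by
      rcases n.eq_zero_or_pos with rfl | hn
      · exact PointGerm.refl _
      · exact hg 0 n hn
    obtain ⟨e, he, hem, -⟩ := DoubleOrd.exists_isOpenEmbedding_of_pointGerm
      (hl (g 0)).aleph0_le (hm (g 0)).aleph0_le h univ_mem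
    exact ⟨f (g n) ∘ e, (hf _).comp he.isEmbedding, (congrArg _ hem).trans (hfp _)⟩
  · refine not_independent hCO (fun i => isLocal_pointGerm
      (DoubleOrd (lam (g i)) (mu (g i))) DoubleOrd.mid) (F := fun i => range (f (g i)))
      (fun i => (isCompact_range (hf (g i)).continuous).isClosed)
      (x := fun i => f (g i) DoubleOrd.mid)
      (fun i => ((hf (g i)).holdsOn_range_iff (isLocal_pointGerm _ _)).2 (PointGerm.refl _)) ?_
    intro i j y hy
    obtain ⟨q, rfl⟩ := hy.mem
    rw [(hf (g i)).holdsOn_range_iff (isLocal_pointGerm _ _)] at hy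
    obtain rfl := DoubleOrd.eq_mid_of_pointGerm (hl _).aleph0_le (hm _).aleph0_le (hcof _) hy
    rcases lt_trichotomy j i with hji | rfl | hij
    · exact absurd hy (hg j i hji)
    · rfl
    · exact absurd hy.symm (hg i j hij)

/-- The point has a neighbourhood homeomorphic to a double order of regular cardinals, the second
uncountable, the point being in the middle. -/
def IsDoubleGerm : PointClass.{u} := fun Y _ y =>
  ∃ lam mu : Cardinal.{u}, lam.IsRegular ∧ mu.IsRegular ∧ ℵ_ 1 ≤ mu ∧
    PointGerm (DoubleOrd lam mu) DoubleOrd.mid Y y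

theorem isLocal_isDoubleGerm : IsLocal IsDoubleGerm.{u} := by
  refine isLocal_exists fun lam => isLocal_exists fun mu => ?_
  have hc : ∀ p : Prop, IsLocal fun _ _ _ => p := fun p _ _ _ _ _ _ _ => Iff.rfl
  exact isLocal_and (hc _) (isLocal_and (hc _) (isLocal_and (hc _) (isLocal_pointGerm _ _)))

theorem IsDoubleLimitPoint.isDoubleGerm (hCO : IsCOSpace X) {x : X} (hx : IsDoubleLimitPoint x) :
    IsDoubleGerm X x := by
  have hreg := finite_isEmbedding_mid_of_isRegular hCO
  have hemb : ∀ z, IsDoubleGerm X z → ∃ lam mu : Cardinal.{u}, lam.IsRegular ∧ mu.IsRegular ∧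
      ℵ_ 1 ≤ mu ∧ ∃ f : DoubleOrd lam mu → X, IsEmbedding f ∧ f DoubleOrd.mid = z := by
    rintro z ⟨lam, mu, hl, hm, hmu, h⟩
    obtain ⟨f, hf, hfz, -⟩ :=
      DoubleOrd.exists_isOpenEmbedding_of_pointGerm hl.aleph0_le hm.aleph0_le h univ_mem
    exact ⟨lam, mu, hl, hm, hmu, f, hf.isEmbedding, hfz⟩
  have hfin : {z | IsDoubleGerm X z}.Finite := hreg.subset hemb
  by_contra hnot
  have hcard := ncard_le_of_forall_nhds hCO isLocal_isDoubleGerm (hfin.insert x)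
    (fun p hp N hN => ?_) hfin
  · rw [Set.ncard_insert_of_notMem (s := {z | IsDoubleGerm X z}) hnot hfin] at hcard
    lia
  · obtain ⟨lam, mu, hl, hm, hmu, f, hf, rfl⟩ := hp.elim (fun h => h ▸ hx.exists_regular) (hemb p)
    obtain ⟨g, hg, -, hr⟩ := exists_isEmbedding_of_mem_nhds hl.aleph0_le hm.aleph0_le hf hN
    exact ⟨range g, hr, (isCompact_range hg.continuous).isClosed, g DoubleOrd.mid,
      (hg.holdsOn_range_iff isLocal_isDoubleGerm).2 ⟨lam, mu, hl, hm, hmu, PointGerm.refl _⟩⟩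

end main

theorem proposition7p2 {X : Type u} [TopologicalSpace X] [CompactSpace X]
    (hI : IsIntervalSpace X) (hCO : IsCOSpace X) :
    (∀ x : X, IsDoubleLimitPoint x →
      ∃ lam mu : Cardinal.{u}, lam.IsRegular ∧ mu.IsRegular ∧ Cardinal.aleph 1 ≤ mu ∧
        ∃ U : Set X, IsClopen U ∧ x ∈ U ∧ Nonempty (U ≃ₜ DoubleOrd lam mu)) ∧
    {x : X | IsDoubleLimitPoint x}.Finite := by
  obtain ⟨_, _⟩ := hI
  refine ⟨fun x hx => ?_, (finite_isEmbedding_mid_of_isRegular hCO).subset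
    fun x hx => hx.exists_regular⟩
  obtain ⟨lam, mu, hl, hm, hmu, h⟩ := hx.isDoubleGerm hCO
  obtain ⟨f, hf, hfx, -⟩ :=
    DoubleOrd.exists_isOpenEmbedding_of_pointGerm hl.aleph0_le hm.aleph0_le h univ_mem
  exact ⟨lam, mu, hl, hm, hmu, range f,
    ⟨(isCompact_range hf.continuous).isClosed, hf.isOpen_range⟩, ⟨_, hfx⟩,
    ⟨hf.isEmbedding.toHomeomorph.symm⟩⟩
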